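/- An instance of the multicommodity flow game consists of a finite undirected supply graph $G=(V,E)$ with node capacities $c_v\in\mathbb{Q}_{\ge 0}\cup\{\infty\}$, and a commodity graph $H=(V,F)$ with a demand $d_e\in\mathbb{Q}_{\ge 0}$ for every $e\in F$. For $S\subseteq V$, a feasible flow of $S$ assigns a real number $f_P\ge 0$ to every simple path $P$ of the induced subgraph $G[S]$ that joins the ends of a commodity, such that $\sum_{P\ni v} f_P\le c_v$ for every node $v$ (the ends of a path count as nodes on it), and such that for every commodity $uv\in F$ the total flow $f_{uv}$ on the paths joining $u$ and $v$ is at most $d_{uv}$. Its payoff vector is $\pi\in\mathbb{R}^V$ with $\pi_v=\sum_{w:\,wv\in F} f_{wv}$, and $\Pi(S)$ is the set of payoff vectors of feasible flows of $S$. A vector $\pi\in\Pi(V)$ is in the core if there are no proper nonempty subset $S$ of $V$ and no $\pi'\in\Pi(S)$ with $\pi'_i>\pi_i$ for all $i\in S$. The social welfare of $\pi$ is $\sum_{v\in V}\pi_v$, and its fairness is the minimum of its entries. The instance is single-sink if all edges of $H$ are incident to one common node. Theorem. There is a polynomial-time algorithm (polynomial in the number of bits of the input, rational data being given by numerators and denominators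 in binary) which, given any instance $(G,c,H,d)$ with an arbitrary supply graph $G$ and a single-sink commodity graph $H$, produces a core vector $\pi\in\Pi(V)$ that simultaneously has the maximum social welfare among all vectors of $\Pi(V)$ and the maximum fairness among all vectors of $\Pi(V)$. The latter holds both when fairness is the minimum payoff over all players, and when it is the minimum payoff over the players incident to at least one commodity. -/

import Mathlib

/-! ### Coalition games without side payments -/

/-- The core of the coalition game with player set `N` and characteristic function `Pay`
(`Pay S` is the set of payoff vectors available to the coalition `S`): the payoff vectors of the
grand coalition for which no proper (nonempty) coalition `S` has a payoff vector that is strictly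
better for every member of `S`. -/
def coalitionCore {N : Type*} (Pay : Set N → Set (N → ℝ)) : Set (N → ℝ) :=
  {x | x ∈ Pay Set.univ ∧
    ∀ S : Set N, S.Nonempty → S ≠ Set.univ → ¬ ∃ y ∈ Pay S, ∀ i ∈ S, x i < y i}

/-- Social welfare: the sum of all individual payoffs. -/
def socialWelfare {N : Type*} [Fintype N] (x : N → ℝ) : ℝ := ∑ i, x i

/-- Fairness among the players in `W`: the smallest payoff of a player in `W`. -/
noncomputable def fairness {N : Type*} (W : Set N) (x : N → ℝ) : ℝ := ⨅ i : W, x i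

/-! ### Multiflow games -/

/-- An instance of the multicommodity flow game: an undirected supply graph with a capacity on
every node (possibly infinite), and a commodity graph on the same node set with a (finite) demand
on every edge. The values of `demand` off the edges of the commodity graph play no role. -/
structure MultiflowInstance where
  /-- the number of nodes (the players) -/
  n : ℕ
  /-- the supply graph -/
  supply : SimpleGraph (Fin n)
  /-- the node capacities -/
  cap : Fin n → WithTop ℚ≥0
  /-- the commodity graph -/
  commodity : SimpleGraph (Fin n)
  /-- the demands of the commodities -/
  demand : Sym2 (Fin n) → ℚ≥0

namespace MultiflowInstance

variable (I : MultiflowInstance)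

/-- An assignment of a real number to every simple path of the supply graph. A simple path joining
`u` and `v` can be written from `u` to `v` or from `v` to `u`; flow may be put on either writing,
and the flow on the undirected path is the sum of the two. -/
abbrev PathFlow : Type := ∀ u v : Fin I.n, I.supply.Path u v → ℝ

variable {I}

open Classical in
/-- The amount of flow that an assignment routes between `u` and `v`. -/
noncomputable def PathFlow.routed (f : I.PathFlow) (u v : Fin I.n) : ℝ :=
  ∑ P, f u v P + ∑ P, f v u P

open Classical in
/-- The total flow on the paths containing the node `x` (as an end or in the interior). -/
noncomputable def PathFlow.load (f : I.PathFlow) (x : Fin I.n) : ℝ :=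
  ∑ u, ∑ v, ∑ P, if x ∈ P.1.support then f u v P else 0

/-- The payoff to `v`: all the flow that terminates at `v`. -/
noncomputable def PathFlow.payoff (f : I.PathFlow) (v : Fin I.n) : ℝ :=
  ∑ w, f.routed w v

/-- `f` is a feasible flow of the subgame on the node set `S`, that is, in the subgraph of the
supply graph induced by `S` (its simple paths are the simple paths all of whose nodes lie in `S`). -/
structure PathFlow.Feasible (f : I.PathFlow) (S : Set (Fin I.n)) : Prop where
  nonneg : ∀ u v P, 0 ≤ f u v P
  joins_commodity : ∀ u v P, f u v P ≠ 0 → I.commodity.Adj u v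
  inside : ∀ u v P, f u v P ≠ 0 → ∀ x ∈ P.1.support, x ∈ S
  capacity : ∀ x, ∀ c : ℚ≥0, I.cap x = (c : WithTop ℚ≥0) → f.load x ≤ (c : ℝ)
  demand : ∀ u v, I.commodity.Adj u v → f.routed u v ≤ (I.demand s(u, v) : ℝ)

variable (I)

/-- The payoff vectors available to the coalition `S`. -/
def payoffs (S : Set (Fin I.n)) : Set (Fin I.n → ℝ) :=
  {x | ∃ f : I.PathFlow, f.Feasible S ∧ x = f.payoff}

/-- All commodities are incident to one common node. -/
def SingleSink : Prop := ∃ t : Fin I.n, ∀ e ∈ I.commodity.edgeSet, t ∈ e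

/-- The players that take part in at least one commodity. -/
def terminals : Set (Fin I.n) := {v | ∃ w, I.commodity.Adj v w}

end MultiflowInstance

/-! ### A machine model with running times

Random access machines in structured form. The memory holds natural numbers in registers and in
arrays; the running time is logarithmic: every operation is charged by the number of bits
of the numbers (data and addresses) that it handles. -/

namespace RAM

/-- Memory contents. -/
structure State where
  /-- the contents of the registers -/
  reg : ℕ → ℕ
  /-- `arr a i` is the content of cell `i` of array `a` -/
  arr : ℕ → ℕ → ℕ

/-- Arithmetic expressions. -/
inductive Expr where
  | const (k : ℕ)
  | reg (r : ℕ)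
  | cell (a : ℕ) (i : Expr)
  | add (e₁ e₂ : Expr)
  | sub (e₁ e₂ : Expr)
  | mul (e₁ e₂ : Expr)
  | div (e₁ e₂ : Expr)
  | le (e₁ e₂ : Expr)

/-- The value of an expression; subtraction is truncated at `0`, division rounds down (and gives
`0` if the divisor is `0`), and a comparison gives `1` or `0`. -/
def Expr.val (σ : State) : Expr → ℕ
  | .const k => k
  | .reg r => σ.reg r
  | .cell a i => σ.arr a (i.val σ)
  | .add e₁ e₂ => e₁.val σ + e₂.val σ
  | .sub e₁ e₂ => e₁.val σ - e₂.val σ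
  | .mul e₁ e₂ => e₁.val σ * e₂.val σ
  | .div e₁ e₂ => e₁.val σ / e₂.val σ
  | .le e₁ e₂ => if e₁.val σ ≤ e₂.val σ then 1 else 0

/-- The time to evaluate an expression: for every node of the expression one step plus the number
of bits of its value. -/
def Expr.time (σ : State) : Expr → ℕ
  | .const k => 1 + Nat.size k
  | .reg r => 1 + Nat.size (σ.reg r)
  | .cell a i => i.time σ + 1 + Nat.size ((Expr.cell a i).val σ)
  | .add e₁ e₂ => e₁.time σ + e₂.time σ + 1 + Nat.size ((Expr.add e₁ e₂).val σ)
  | .sub e₁ e₂ => e₁.time σ + e₂.time σ + 1 + Nat.size ((Expr.sub e₁ e₂).val σ)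
  | .mul e₁ e₂ => e₁.time σ + e₂.time σ + 1 + Nat.size ((Expr.mul e₁ e₂).val σ)
  | .div e₁ e₂ => e₁.time σ + e₂.time σ + 1 + Nat.size ((Expr.div e₁ e₂).val σ)
  | .le e₁ e₂ => e₁.time σ + e₂.time σ + 1 + Nat.size ((Expr.le e₁ e₂).val σ)

/-- Programs. -/
inductive Program where
  | skip
  | assign (r : ℕ) (e : Expr)
  | store (a : ℕ) (i e : Expr)
  | seq (p q : Program)
  | cond (e : Expr) (p q : Program)
  | loop (e : Expr) (p : Program)

/-- The memory after writing `k` into register `r`. -/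
def State.setReg (σ : State) (r k : ℕ) : State :=
  { σ with reg := Function.update σ.reg r k }

/-- The memory after writing `k` into cell `i` of array `a`. -/
def State.setCell (σ : State) (a i k : ℕ) : State :=
  { σ with arr := Function.update σ.arr a (Function.update (σ.arr a) i k) }

/-- `Runs p σ τ k`: started in memory `σ`, the program `p` halts in memory `τ` after time `k`.
The tests of `cond` and `loop` succeed if the value of the expression is not `0`. -/
inductive Runs : Program → State → State → ℕ → Prop
  | skip (σ : State) : Runs .skip σ σ 1
  | assign (σ : State) (r : ℕ) (e : Expr) :
      Runs (.assign r e) σ (σ.setReg r (e.val σ)) (1 + e.time σ)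
  | store (σ : State) (a : ℕ) (i e : Expr) :
      Runs (.store a i e) σ (σ.setCell a (i.val σ) (e.val σ)) (1 + i.time σ + e.time σ)
  | seq {p q : Program} {σ τ υ : State} {k l : ℕ} :
      Runs p σ τ k → Runs q τ υ l → Runs (.seq p q) σ υ (k + l)
  | cond_true {e : Expr} {p q : Program} {σ τ : State} {k : ℕ} :
      e.val σ ≠ 0 → Runs p σ τ k → Runs (.cond e p q) σ τ (1 + e.time σ + k)
  | cond_false {e : Expr} {p q : Program} {σ τ : State} {k : ℕ} :
      e.val σ = 0 → Runs q σ τ k → Runs (.cond e p q) σ τ (1 + e.time σ + k)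
  | loop_true {e : Expr} {p : Program} {σ τ υ : State} {k l : ℕ} :
      e.val σ ≠ 0 → Runs p σ τ k → Runs (.loop e p) τ υ l →
        Runs (.loop e p) σ υ (1 + e.time σ + k + l)
  | loop_false {e : Expr} {p : Program} {σ : State} :
      e.val σ = 0 → Runs (.loop e p) σ σ (1 + e.time σ)

end RAM

namespace MultiflowInstance

variable (I : MultiflowInstance)

/-- Numerator and denominator of the capacity of `v`; infinity is written as `1 / 0`. -/
def capNum (v : Fin I.n) : ℕ :=
  match I.cap v with
  | some c => c.num
  | none => 1

/-- See `capNum`. -/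
def capDen (v : Fin I.n) : ℕ :=
  match I.cap v with
  | some c => c.den
  | none => 0

open Classical in
/-- The adjacency matrix of the supply graph. -/
noncomputable def supplyBit (u v : Fin I.n) : ℕ := if I.supply.Adj u v then 1 else 0

open Classical in
/-- Numerator of the demand of the commodity `uv`; for non-adjacent `u` and `v`, the pair
numerator, denominator is `0`, `0`. -/
noncomputable def demandNum (u v : Fin I.n) : ℕ :=
  if I.commodity.Adj u v then (I.demand s(u, v)).num else 0

open Classical in
/-- See `demandNum`. The denominator is nonzero exactly if `uv` is a commodity. -/
noncomputable def demandDen (u v : Fin I.n) : ℕ :=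
  if I.commodity.Adj u v then (I.demand s(u, v)).den else 0

/-- A list of numbers, indexed by the nodes, as the contents of an array. -/
def vecToArr {n : ℕ} (x : Fin n → ℕ) (i : ℕ) : ℕ :=
  if h : i < n then x ⟨i, h⟩ else 0

/-- A square matrix of numbers as the contents of an array, row after row: the entry `(u, v)` is in
cell `u * n + v`. -/
def matToArr {n : ℕ} (A : Fin n → Fin n → ℕ) (i : ℕ) : ℕ :=
  if h : i / n < n ∧ i % n < n then A ⟨i / n, h.1⟩ ⟨i % n, h.2⟩ else 0

/-- The memory in which the instance is written: `n` in register `0`, the capacities (numerators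
and denominators) in arrays `0` and `1`, the supply graph in array `2`, the demands (numerators
and denominators) in arrays `3` and `4`; zeros elsewhere. -/
noncomputable def input : RAM.State where
  reg r := if r = 0 then I.n else 0
  arr
    | 0 => vecToArr I.capNum
    | 1 => vecToArr I.capDen
    | 2 => matToArr I.supplyBit
    | 3 => matToArr I.demandNum
    | 4 => matToArr I.demandDen
    | _ => fun _ => 0

/-- The size of the instance: the number of bits of all the numbers in the input, plus one for
every number. -/
noncomputable def size : ℕ :=
  (Nat.size I.n + 1) + ∑ v, ((Nat.size (I.capNum v) + 1) + (Nat.size (I.capDen v) + 1)) +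
    ∑ u, ∑ v, ((Nat.size (I.supplyBit u v) + 1) + (Nat.size (I.demandNum u v) + 1) +
      (Nat.size (I.demandDen u v) + 1))

/-- The memory `σ` contains the vector `x` as output: numerators in array `5`, (nonzero)
denominators in array `6`. -/
def IsOutput (σ : RAM.State) (x : Fin I.n → ℝ) : Prop :=
  ∀ v : Fin I.n, σ.arr 6 v ≠ 0 ∧ x v = (σ.arr 5 v : ℝ) / (σ.arr 6 v : ℝ)

end MultiflowInstance

/-! Let `t` be the node common to all commodities. Every flow path ends at `t`, so a node `v ≠ t`
earns its flow to `t`, the node `t` earns the whole flow value, and social welfare is twice the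
value. A flow of maximum value therefore maximizes welfare, and it is automatically in the core: a
coalition containing `t` would have to pay `t` more than the maximum value, and a coalition without
`t` earns nothing at all. It remains to find a maximum flow that is also as fair as possible.

Since `t` earns at least as much as each of its partners, fairness over the terminals is the least
amount sent by a partner. Let `ℓ` be the largest amount that all partners can send simultaneously. A
flow in which each of them sends `ℓ` extends to a maximum flow by augmentations that never return
flow to the source, so no partner loses. Optimality is certified by cuts: the value by a cut of
equal capacity, and `ℓ` by a demand of at most `ℓ` or by a cut whose capacity is at most `ℓ` times
the number of partners behind it. If some player takes part in no commodity, fairness over all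
players is always `0`; otherwise the two notions of fairness coincide.

For the algorithm, nodes are split into arcs (`net`), and the total demand stands in for infinite
capacities. All data are multiplied by the relevant denominators and by `n!`. Then the capacity of a
cut is divisible by every possible number `j ≤ n` of partners, so the best `ℓ` is an integer. It is
found by bisection, each trial being a maximum flow computed by capacity scaling (`total_maxflow`).
The lemma `exists_feasible_of_netFlow` turns network flows into path flows, `routed_sum_le_innerCap`
is weak duality, `exists_netFlow` combines the two stages, and `IsScaling.optimal` draws the
conclusion. `Steps.runs` reduces the running time to a count of unit steps. -/

namespace RAM

/-! ### Unit cost against logarithmic running time. -/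

/-- The unit cost of an expression: one step for every node, except that a constant is charged
with its value and a multiplication also with the number of bits of its second factor. -/
def Expr.cost (σ : State) : Expr → ℕ
  | .const k => k + 1
  | .reg _ => 1
  | .cell _ i => i.cost σ + 1
  | .add e₁ e₂ => e₁.cost σ + e₂.cost σ + 1
  | .sub e₁ e₂ => e₁.cost σ + e₂.cost σ + 1
  | .mul e₁ e₂ => e₁.cost σ + e₂.cost σ + 1 + Nat.size (e₂.val σ)
  | .div e₁ e₂ => e₁.cost σ + e₂.cost σ + 1
  | .le e₁ e₂ => e₁.cost σ + e₂.cost σ + 1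

/-- All numbers in the memory have at most `M` bits. -/
def State.Bdd (M : ℕ) (σ : State) : Prop :=
  (∀ r, σ.reg r < 2 ^ M) ∧ ∀ a i, σ.arr a i < 2 ^ M

/-- Each operation adds at most as many bits as it costs. A product has at most as many bits as its
factors together, which is why a multiplication is charged with the length of its second factor. -/
theorem Expr.val_lt {M : ℕ} {σ : State} (h : σ.Bdd M) (e : Expr) :
    e.val σ < 2 ^ (M + e.cost σ) := by
  have add_le : ∀ {x y c d : ℕ}, x < 2 ^ (M + c) → y < 2 ^ (M + d) →
      x + y < 2 ^ (M + (c + d + 1)) := by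
    intro x y c d hx hy
    have h1 : 2 ^ (M + c) ≤ 2 ^ (M + (c + d)) := Nat.pow_le_pow_right (by norm_num) (by omega)
    have h2 : 2 ^ (M + d) ≤ 2 ^ (M + (c + d)) := Nat.pow_le_pow_right (by norm_num) (by omega)
    have h3 : 2 ^ (M + (c + d + 1)) = 2 * 2 ^ (M + (c + d)) := by ring
    omega
  induction e with
  | const k =>
    have h1 : k < 2 ^ k := Nat.lt_two_pow_self
    exact h1.trans_le (Nat.pow_le_pow_right (by norm_num) (by simp [Expr.cost]; omega))
  | reg r => exact (h.1 r).trans_le (Nat.pow_le_pow_right (by norm_num) (by omega))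
  | cell a i _ => exact (h.2 a _).trans_le (Nat.pow_le_pow_right (by norm_num) (by omega))
  | add a b ha hb => exact add_le ha hb
  | sub a b ha hb =>
    exact (Nat.sub_le _ _).trans_lt ((Nat.le_add_right _ _).trans_lt (add_le ha hb))
  | mul a b ha _ =>
    have h1 : b.val σ < 2 ^ Nat.size (b.val σ) := Nat.lt_size_self _
    calc a.val σ * b.val σ < 2 ^ (M + a.cost σ) * 2 ^ Nat.size (b.val σ) :=
          Nat.mul_lt_mul'' ha h1
      _ = 2 ^ (M + a.cost σ + Nat.size (b.val σ)) := by rw [← pow_add]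
      _ ≤ _ := Nat.pow_le_pow_right (by norm_num) (by simp [Expr.cost]; omega)
  | div a b ha hb =>
    exact (Nat.div_le_self _ _).trans_lt ((Nat.le_add_right _ _).trans_lt (add_le ha hb))
  | le a b ha hb =>
    have h1 : (Expr.le a b).val σ ≤ 1 := by simp only [Expr.val]; split_ifs <;> simp
    exact lt_of_le_of_lt h1 (Nat.one_lt_two_pow (by simp [Expr.cost]))

theorem Expr.size_val_le {M : ℕ} {σ : State} (h : σ.Bdd M) (e : Expr) :
    Nat.size (e.val σ) ≤ M + e.cost σ := Nat.size_le.2 (e.val_lt h)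

/-- There are at most `cost` nodes, and every value met during the evaluation has at most `M` plus
`cost` bits. -/
theorem Expr.time_le {M : ℕ} {σ : State} (h : σ.Bdd M) (e : Expr) :
    e.time σ ≤ e.cost σ * (1 + M + e.cost σ) := by
  have key : ∀ {x y c d s C : ℕ}, x ≤ c * (1 + M + c) → y ≤ d * (1 + M + d) → s ≤ M + C →
      c + d + 1 ≤ C → x + y + 1 + s ≤ C * (1 + M + C) := by
    intro x y c d s C hx hy hs hC
    obtain ⟨m, rfl⟩ := Nat.exists_eq_add_of_le hC
    nlinarith [Nat.zero_le (c * d), Nat.zero_le (m * c), Nat.zero_le (m * d), Nat.zero_le (m * M),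
      Nat.zero_le (m * m), Nat.zero_le (c * M), Nat.zero_le (d * M)]
  induction e with
  | const k =>
    have := Expr.size_val_le h (.const k)
    have h2 := key (x := 0) (y := 0) (c := 0) (d := 0) (Nat.zero_le _) (Nat.zero_le _) this
      (by simp [Expr.cost])
    simpa [Expr.time, Expr.val] using h2
  | reg r =>
    have := Expr.size_val_le h (.reg r)
    have h2 := key (x := 0) (y := 0) (c := 0) (d := 0) (Nat.zero_le _) (Nat.zero_le _) this
      (by simp [Expr.cost])
    simpa [Expr.time, Expr.val] using h2
  | cell a i hi =>
    have := Expr.size_val_le h (.cell a i)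
    have h2 := key (y := 0) (d := 0) hi (Nat.zero_le _) this (by simp [Expr.cost])
    simpa [Expr.time] using h2
  | add a b ha hb => exact key ha hb (Expr.size_val_le h _) le_rfl
  | sub a b ha hb => exact key ha hb (Expr.size_val_le h _) le_rfl
  | mul a b ha hb => exact key ha hb (Expr.size_val_le h _) (by simp [Expr.cost])
  | div a b ha hb => exact key ha hb (Expr.size_val_le h _) le_rfl
  | le a b ha hb => exact key ha hb (Expr.size_val_le h _) le_rfl

/-- `Steps p σ τ k`: started in `σ`, the program `p` halts in `τ` at unit cost `k`. -/
inductive Steps : Program → State → State → ℕ → Prop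
  | skip (σ : State) : Steps .skip σ σ 1
  | assign (σ : State) (r : ℕ) (e : Expr) :
      Steps (.assign r e) σ (σ.setReg r (e.val σ)) (1 + e.cost σ)
  | store (σ : State) (a : ℕ) (i e : Expr) :
      Steps (.store a i e) σ (σ.setCell a (i.val σ) (e.val σ)) (1 + i.cost σ + e.cost σ)
  | seq {p q : Program} {σ τ υ : State} {k l : ℕ} :
      Steps p σ τ k → Steps q τ υ l → Steps (.seq p q) σ υ (k + l)
  | cond_true {e : Expr} {p q : Program} {σ τ : State} {k : ℕ} :
      e.val σ ≠ 0 → Steps p σ τ k → Steps (.cond e p q) σ τ (1 + e.cost σ + k)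
  | cond_false {e : Expr} {p q : Program} {σ τ : State} {k : ℕ} :
      e.val σ = 0 → Steps q σ τ k → Steps (.cond e p q) σ τ (1 + e.cost σ + k)
  | loop_true {e : Expr} {p : Program} {σ τ υ : State} {k l : ℕ} :
      e.val σ ≠ 0 → Steps p σ τ k → Steps (.loop e p) τ υ l →
        Steps (.loop e p) σ υ (1 + e.cost σ + k + l)
  | loop_false {e : Expr} {p : Program} {σ : State} :
      e.val σ = 0 → Steps (.loop e p) σ σ (1 + e.cost σ)

theorem State.Bdd.mono {M M' : ℕ} {σ : State} (h : σ.Bdd M) (hM : M ≤ M') : σ.Bdd M' :=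
  ⟨fun r => (h.1 r).trans_le (Nat.pow_le_pow_right (by norm_num) hM),
    fun a i => (h.2 a i).trans_le (Nat.pow_le_pow_right (by norm_num) hM)⟩

theorem State.Bdd.setReg {M k : ℕ} {σ : State} (h : σ.Bdd M) (hk : k < 2 ^ M) (r : ℕ) :
    (σ.setReg r k).Bdd M := by
  refine ⟨fun r' => ?_, h.2⟩
  simp only [State.setReg, Function.update_apply]
  split_ifs
  exacts [hk, h.1 r']

theorem State.Bdd.setCell {M k : ℕ} {σ : State} (h : σ.Bdd M) (hk : k < 2 ^ M) (a i : ℕ) :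
    (σ.setCell a i k).Bdd M := by
  refine ⟨h.1, fun a' i' => ?_⟩
  simp only [State.setCell, Function.update_apply]
  split_ifs
  · simp only [Function.update_apply]
    split_ifs
    exacts [hk, h.2 _ _]
  · exact h.2 _ _

/-- Numbers lengthen by at most the unit cost spent, so polynomially many units cannot produce
numbers of superpolynomial length, even by repeated multiplication. -/
theorem Steps.bdd {p : Program} {σ τ : State} {k : ℕ} (h : Steps p σ τ k) :
    ∀ {M : ℕ}, σ.Bdd M → τ.Bdd (M + k) := by
  induction h with
  | skip σ => exact fun h => h.mono (by omega)
  | assign σ r e =>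
    exact fun h => (h.mono (by omega)).setReg ((e.val_lt h).trans_le
      (Nat.pow_le_pow_right (by norm_num) (by omega))) r
  | store σ a i e =>
    exact fun h => (h.mono (by omega)).setCell ((e.val_lt h).trans_le
      (Nat.pow_le_pow_right (by norm_num) (by omega))) a _
  | seq _ _ h1 h2 => exact fun h => (h2 (h1 h)).mono (by omega)
  | cond_true _ _ h1 => exact fun h => (h1 h).mono (by omega)
  | cond_false _ _ h1 => exact fun h => (h1 h).mono (by omega)
  | loop_true _ _ _ h1 h2 => exact fun h => (h2 (h1 h)).mono (by omega)
  | loop_false _ => exact fun h => h.mono (by omega)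

/-- The running time is polynomial in the unit cost and the number of bits of the initial
contents of the memory. -/
theorem Steps.runs {p : Program} {σ τ : State} {k : ℕ} (h : Steps p σ τ k) :
    ∀ {M : ℕ}, σ.Bdd M → ∃ k' ≤ k * (1 + M + k), Runs p σ τ k' := by
  have two : ∀ {M x y a b : ℕ}, x ≤ a * (1 + M + a) → y ≤ b * (1 + (M + a) + b) →
      x + y ≤ (a + b) * (1 + M + (a + b)) := by
    intro M x y a b hx hy
    nlinarith [Nat.zero_le (a * b)]
  have step : ∀ {M x y a b : ℕ}, x ≤ a * (1 + M + a) → y ≤ b * (1 + M + b) →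
      1 + x + y ≤ (1 + a + b) * (1 + M + (1 + a + b)) := by
    intro M x y a b hx hy
    nlinarith [Nat.zero_le (a * b), Nat.zero_le (a * M), Nat.zero_le (b * M)]
  induction h with
  | skip σ => exact fun {M} h => ⟨1, by omega, .skip σ⟩
  | assign σ r e =>
    exact fun {M} h => ⟨_, by simpa using step (e.time_le h) (Nat.zero_le (0 * (1 + M + 0))),
      .assign σ r e⟩
  | store σ a i e => exact fun h => ⟨_, step (i.time_le h) (e.time_le h), .store σ a i e⟩
  | seq s1 _ h1 h2 =>
    intro M h
    obtain ⟨k1, hk1, r1⟩ := h1 h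
    obtain ⟨k2, hk2, r2⟩ := h2 (s1.bdd h)
    exact ⟨_, two hk1 hk2, .seq r1 r2⟩
  | cond_true he _ h1 =>
    intro M h
    obtain ⟨k1, hk1, r1⟩ := h1 h
    exact ⟨_, step (Expr.time_le h _) hk1, .cond_true he r1⟩
  | cond_false he _ h1 =>
    intro M h
    obtain ⟨k1, hk1, r1⟩ := h1 h
    exact ⟨_, step (Expr.time_le h _) hk1, .cond_false he r1⟩
  | loop_true he s1 _ h1 h2 =>
    intro M h
    obtain ⟨k1, hk1, r1⟩ := h1 h
    obtain ⟨k2, hk2, r2⟩ := h2 (s1.bdd h)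
    refine ⟨_, two (step (Expr.time_le h _) hk1) (hk2.trans ?_), .loop_true he r1 r2⟩
    gcongr
    omega
  | loop_false he =>
    exact fun {M} h => ⟨_, by simpa using step (Expr.time_le h _) (Nat.zero_le (0 * (1 + M + 0))),
      .loop_false he⟩

/-! ### Frames and rules of total correctness. -/

/-- The registers that a program may write. -/
def Program.regs : Program → List ℕ
  | .skip => []
  | .assign r _ => [r]
  | .store _ _ _ => []
  | .seq p q => p.regs ++ q.regs
  | .cond _ p q => p.regs ++ q.regs
  | .loop _ p => p.regs

/-- The arrays that a program may write. -/
def Program.arrs : Program → List ℕ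
  | .skip => []
  | .assign _ _ => []
  | .store a _ _ => [a]
  | .seq p q => p.arrs ++ q.arrs
  | .cond _ p q => p.arrs ++ q.arrs
  | .loop _ p => p.arrs

/-- The memories `σ` and `τ` agree on everything that `p` does not write. -/
structure Frame (p : Program) (σ τ : State) : Prop where
  reg : ∀ r, r ∉ p.regs → τ.reg r = σ.reg r
  arr : ∀ a, a ∉ p.arrs → τ.arr a = σ.arr a

theorem Frame.refl (p : Program) (σ : State) : Frame p σ σ := ⟨fun _ _ => rfl, fun _ _ => rfl⟩

theorem Frame.trans {p : Program} {σ τ υ : State} (h : Frame p σ τ) (h' : Frame p τ υ) :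
    Frame p σ υ :=
  ⟨fun r hr => (h'.reg r hr).trans (h.reg r hr), fun a ha => (h'.arr a ha).trans (h.arr a ha)⟩

theorem Frame.mono {p q : Program} {σ τ : State} (h : Frame p σ τ) (h1 : p.regs ⊆ q.regs)
    (h2 : p.arrs ⊆ q.arrs) : Frame q σ τ :=
  ⟨fun r hr => h.reg r fun h' => hr (h1 h'), fun a ha => h.arr a fun h' => ha (h2 h')⟩

/-- What stays unchanged is read off the program text, so that for concrete programs `decide`
settles it. -/
theorem Steps.frame {p : Program} {σ τ : State} {k : ℕ} (h : Steps p σ τ k) : Frame p σ τ := by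
  induction h with
  | skip σ => exact .refl _ _
  | assign σ r e =>
    refine ⟨fun r' hr => ?_, fun _ _ => rfl⟩
    simp only [Program.regs, List.mem_singleton] at hr
    simp [State.setReg, hr]
  | store σ a i e =>
    refine ⟨fun _ _ => rfl, fun a' ha => ?_⟩
    simp only [Program.arrs, List.mem_singleton] at ha
    simp [State.setCell, ha]
  | seq _ _ h1 h2 =>
    exact (h1.mono (by simp [Program.regs]) (by simp [Program.arrs])).trans
      (h2.mono (by simp [Program.regs]) (by simp [Program.arrs]))
  | cond_true _ _ h1 => exact h1.mono (by simp [Program.regs]) (by simp [Program.arrs])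
  | cond_false _ _ h1 => exact h1.mono (by simp [Program.regs]) (by simp [Program.arrs])
  | loop_true _ _ _ h1 h2 =>
    exact (h1.mono (by simp [Program.regs]) (by simp [Program.arrs])).trans h2
  | loop_false _ => exact .refl _ _

/-- Total correctness: `p` halts when started in `σ`, and final memory and unit cost satisfy `Q`. -/
def Total (p : Program) (σ : State) (Q : State → ℕ → Prop) : Prop :=
  ∃ τ k, Steps p σ τ k ∧ Q τ k

/-- The consequence rule also supplies the frame of the run, so specifications need not list what is
preserved. -/
theorem Total.mono {p : Program} {σ : State} {Q Q' : State → ℕ → Prop} (h : Total p σ Q)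
    (hQ : ∀ τ k, Frame p σ τ → Q τ k → Q' τ k) : Total p σ Q' := by
  obtain ⟨τ, k, h1, h2⟩ := h
  exact ⟨τ, k, h1, hQ τ k h1.frame h2⟩

/-- The rules for loop-free programs are equivalences: rewriting with them executes a program
symbolically. -/
theorem total_skip {σ : State} {Q : State → ℕ → Prop} : Total .skip σ Q ↔ Q σ 1 :=
  ⟨fun ⟨_, _, h, hQ⟩ => by cases h; exact hQ, fun h => ⟨_, _, .skip σ, h⟩⟩

theorem total_assign {σ : State} {r : ℕ} {e : Expr} {Q : State → ℕ → Prop} :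
    Total (.assign r e) σ Q ↔ Q (σ.setReg r (e.val σ)) (1 + e.cost σ) :=
  ⟨fun ⟨_, _, h, hQ⟩ => by cases h; exact hQ, fun h => ⟨_, _, .assign σ r e, h⟩⟩

theorem total_store {σ : State} {a : ℕ} {i e : Expr} {Q : State → ℕ → Prop} :
    Total (.store a i e) σ Q ↔ Q (σ.setCell a (i.val σ) (e.val σ)) (1 + i.cost σ + e.cost σ) :=
  ⟨fun ⟨_, _, h, hQ⟩ => by cases h; exact hQ, fun h => ⟨_, _, .store σ a i e, h⟩⟩

theorem total_seq {σ : State} {p q : Program} {Q : State → ℕ → Prop} :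
    Total (.seq p q) σ Q ↔ Total p σ fun τ k => Total q τ fun υ l => Q υ (k + l) := by
  constructor
  · rintro ⟨_, _, h, hQ⟩
    cases h with
    | seq h1 h2 => exact ⟨_, _, h1, _, _, h2, hQ⟩
  · rintro ⟨_, _, h1, _, _, h2, hQ⟩
    exact ⟨_, _, .seq h1 h2, hQ⟩

theorem total_cond {σ : State} {e : Expr} {p q : Program} {Q : State → ℕ → Prop} :
    Total (.cond e p q) σ Q ↔
      (e.val σ ≠ 0 → Total p σ fun τ k => Q τ (1 + e.cost σ + k)) ∧
      (e.val σ = 0 → Total q σ fun τ k => Q τ (1 + e.cost σ + k)) := by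
  constructor
  · rintro ⟨_, _, h, hQ⟩
    cases h with
    | cond_true he h1 => exact ⟨fun _ => ⟨_, _, h1, hQ⟩, fun h => absurd h he⟩
    | cond_false he h1 => exact ⟨fun h => absurd he h, fun _ => ⟨_, _, h1, hQ⟩⟩
  · rintro ⟨h1, h2⟩
    by_cases he : e.val σ = 0
    · obtain ⟨τ, k, h, hQ⟩ := h2 he
      exact ⟨_, _, .cond_false he h, hQ⟩
    · obtain ⟨τ, k, h, hQ⟩ := h1 he
      exact ⟨_, _, .cond_true he h, hQ⟩

/-- The rule for loops: `Inv m` is an invariant with variant `m`. -/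
theorem Total.loop {e : Expr} {p : Program} (Inv : ℕ → State → Prop) (c : ℕ) {m : ℕ} {σ₀ : State}
    (h0 : Inv m σ₀)
    (step : ∀ m σ, Frame p σ₀ σ → Inv m σ → e.cost σ ≤ c ∧
      (e.val σ ≠ 0 → Total p σ fun τ k => k ≤ c ∧ ∃ m' < m, Inv m' τ)) :
    Total (.loop e p) σ₀ fun τ k =>
      k ≤ (m + 1) * (2 * c + 1) ∧ (∃ m' ≤ m, Inv m' τ) ∧ e.val τ = 0 := by
  suffices H : ∀ m σ, Frame p σ₀ σ → Inv m σ → Total (.loop e p) σ fun τ k =>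
      k ≤ (m + 1) * (2 * c + 1) ∧ (∃ m' ≤ m, Inv m' τ) ∧ e.val τ = 0 from H m σ₀ (.refl _ _) h0
  intro m
  induction m using Nat.strong_induction_on with
  | _ m ih =>
    intro σ hF hI
    obtain ⟨hc, hb⟩ := step m σ hF hI
    by_cases he : e.val σ = 0
    · exact ⟨σ, _, .loop_false he, by nlinarith, ⟨m, le_rfl, hI⟩, he⟩
    · obtain ⟨τ, k, hs, hk, m', hm, hI'⟩ := hb he
      obtain ⟨υ, l, hs', hl, ⟨m'', hm', hI''⟩, he'⟩ := ih m' hm τ (hF.trans hs.frame) hI'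
      refine ⟨υ, _, .loop_true he hs hs', ?_, ⟨m'', by omega, hI''⟩, he'⟩
      -- One round costs at most `1 + c` for the test and `c` for the body.
      have : (m' + 1) * (2 * c + 1) + (2 * c + 1) ≤ (m + 1) * (2 * c + 1) := by
        have : (m' + 1 + 1) * (2 * c + 1) ≤ (m + 1) * (2 * c + 1) := by gcongr; omega
        linarith
      omega

@[simp] theorem setReg_reg (σ : State) (r k r' : ℕ) :
    (σ.setReg r k).reg r' = if r' = r then k else σ.reg r' := by
  simp [State.setReg, Function.update_apply]

@[simp] theorem setReg_arr (σ : State) (r k : ℕ) : (σ.setReg r k).arr = σ.arr := rfl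

@[simp] theorem setCell_reg (σ : State) (a i k : ℕ) : (σ.setCell a i k).reg = σ.reg := rfl

theorem setCell_arr (σ : State) (a i k a' i' : ℕ) :
    (σ.setCell a i k).arr a' i' = if a' = a ∧ i' = i then k else σ.arr a' i' := by
  simp only [State.setCell, Function.update_apply]
  by_cases h : a' = a
  · subst h; simp [Function.update_apply]
  · simp [h]

theorem setCell_arr_self (σ : State) (a i k i' : ℕ) :
    (σ.setCell a i k).arr a i' = if i' = i then k else σ.arr a i' := by simp [setCell_arr]

theorem setCell_arr_eq_update (σ : State) (a i k : ℕ) :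
    (σ.setCell a i k).arr a = Function.update (σ.arr a) i k := by simp [State.setCell]

theorem setCell_arr_of_ne (σ : State) {a a' : ℕ} (i k : ℕ) (h : a' ≠ a) :
    (σ.setCell a i k).arr a' = σ.arr a' := by
  ext i'; simp [setCell_arr, h]

end RAM

/-! ### Net flows, cuts, residual capacities and search trees. -/

section NetFlow
open Finset

/-- A flow of value `x` from `s` to `z` in the complete network on the nodes `0, …, N - 1`, given by
the net amounts on the ordered pairs of nodes. -/
structure IsNetFlow (N s z : ℕ) (Δ : ℕ → ℕ → ℤ) (x : ℤ) : Prop where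
  antisymm : ∀ a b, Δ a b = -Δ b a
  excess : ∀ a < N, ∑ b ∈ range N, Δ a b = (if a = s then x else 0) - (if a = z then x else 0)

/-- For equal source and sink the two excess terms cancel, whatever the value. This starts the walk
back from the sink in `total_augment`. -/
theorem IsNetFlow.zero (N s : ℕ) (x : ℤ) : IsNetFlow N s s (fun _ _ => 0) x :=
  ⟨by simp, by simp⟩

theorem IsNetFlow.add {N s z : ℕ} {Δ Δ' : ℕ → ℕ → ℤ} {x x' : ℤ} (h : IsNetFlow N s z Δ x)
    (h' : IsNetFlow N s z Δ' x') : IsNetFlow N s z (fun a b => Δ a b + Δ' a b) (x + x') := by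
  refine ⟨fun a b => by rw [h.antisymm, h'.antisymm]; ring, fun a ha => ?_⟩
  rw [sum_add_distrib, h.excess a ha, h'.excess a ha]
  split_ifs <;> ring

/-- Prolong a flow from `v` to `z` by an arc from `p` to `v`. -/
theorem IsNetFlow.cons {N p v z : ℕ} {Δ : ℕ → ℕ → ℤ} {x : ℤ} (h : IsNetFlow N v z Δ x)
    (hp : p < N) (hv : v < N) :
    IsNetFlow N p z (fun a b => Δ a b + ((if a = p ∧ b = v then x else 0) -
      (if a = v ∧ b = p then x else 0))) x := by
  refine ⟨fun a b => ?_, fun a ha => ?_⟩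
  · have h1 : (if a = p ∧ b = v then x else 0) = if b = v ∧ a = p then x else 0 := by
      simp [and_comm]
    have h2 : (if a = v ∧ b = p then x else 0) = if b = p ∧ a = v then x else 0 := by
      simp [and_comm]
    rw [h.antisymm, h1, h2]; ring
  · rw [sum_add_distrib, h.excess a ha, sum_sub_distrib]
    have h1 : ∑ b ∈ range N, (if a = p ∧ b = v then x else 0) = if a = p then x else 0 := by
      by_cases h : a = p <;> simp [h, hv]
    have h2 : ∑ b ∈ range N, (if a = v ∧ b = p then x else 0) = if a = v then x else 0 := by
      by_cases h : a = v <;> simp [h, hp]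
    rw [h1, h2]; ring

/-- By antisymmetry the amounts inside `R` cancel, so the flow across the boundary is the sum of the
excesses in `R`, to which only `s` contributes. -/
theorem IsNetFlow.cut {N s z : ℕ} {Δ : ℕ → ℕ → ℤ} {x : ℤ} (h : IsNetFlow N s z Δ x)
    {R : Finset ℕ} (hR : R ⊆ range N) (hs : s ∈ R) (hz : z ∉ R) :
    ∑ a ∈ R, ∑ b ∈ range N \ R, Δ a b = x := by
  have h1 : ∑ a ∈ R, ∑ b ∈ R, Δ a b = 0 := by
    have : ∑ a ∈ R, ∑ b ∈ R, Δ a b = -∑ a ∈ R, ∑ b ∈ R, Δ a b := by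
      conv_lhs => rw [sum_comm]
      rw [← sum_neg_distrib]
      refine sum_congr rfl fun a _ => ?_
      rw [← sum_neg_distrib]
      exact sum_congr rfl fun b _ => h.antisymm _ _
    linarith
  have h2 : ∑ a ∈ R, ∑ b ∈ range N, Δ a b = x := by
    rw [sum_congr rfl fun a ha => h.excess a (mem_range.1 (hR ha)), sum_sub_distrib]
    simp [hs, hz]
  rw [← h2]
  simp_rw [← sum_sdiff hR, sum_add_distrib]
  rw [h1, add_zero]

/-- The capacity of the cut around `R`. -/
def cutCap (N : ℕ) (r : ℕ → ℕ → ℕ) (R : Finset ℕ) : ℕ := ∑ a ∈ R, ∑ b ∈ range N \ R, r a b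

/-- Pushing a flow of value `x` from `s` to `z` turns the residual capacities `r` into `r'`. -/
def Pushes (N s z : ℕ) (r r' : ℕ → ℕ → ℕ) (x : ℤ) : Prop :=
  ∃ Δ, IsNetFlow N s z Δ x ∧ ∀ a < N, ∀ b < N, (r a b : ℤ) = r' a b + Δ a b

theorem Pushes.refl (N s z : ℕ) (r : ℕ → ℕ → ℕ) : Pushes N s z r r 0 :=
  ⟨fun _ _ => 0, ⟨by simp, by simp⟩, by simp⟩

theorem Pushes.trans {N s z : ℕ} {r r' r'' : ℕ → ℕ → ℕ} {x x' : ℤ} (h : Pushes N s z r r' x)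
    (h' : Pushes N s z r' r'' x') : Pushes N s z r r'' (x + x') := by
  obtain ⟨Δ, h1, h2⟩ := h
  obtain ⟨Δ', h3, h4⟩ := h'
  refine ⟨_, h1.add h3, fun a ha b hb => ?_⟩
  rw [h2 a ha b hb, h4 a ha b hb]; ring

/-- All cuts separating `s` from `z` lose the same amount. Comparing a saturated cut with the cut
around the source does the work of the max-flow min-cut theorem below. -/
theorem Pushes.cutCap {N s z : ℕ} {r r' : ℕ → ℕ → ℕ} {x : ℤ} (h : Pushes N s z r r' x)
    {R : Finset ℕ} (hR : R ⊆ range N) (hs : s ∈ R) (hz : z ∉ R) :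
    (cutCap N r R : ℤ) = cutCap N r' R + x := by
  obtain ⟨Δ, h1, h2⟩ := h
  rw [← h1.cut hR hs hz]
  simp only [_root_.cutCap]
  push_cast
  rw [← sum_add_distrib]
  refine sum_congr rfl fun a ha => ?_
  rw [← sum_add_distrib]
  refine sum_congr rfl fun b hb => h2 a (mem_range.1 (hR ha)) b ?_
  exact mem_range.1 (mem_sdiff.1 hb).1

/-- There is a cut of residual capacity `0`. -/
def Saturated (N s z : ℕ) (r : ℕ → ℕ → ℕ) : Prop :=
  ∃ R ⊆ range N, s ∈ R ∧ z ∉ R ∧ cutCap N r R = 0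

/-- The nodes reached by a search. -/
def visited (N : ℕ) (par : ℕ → ℕ) : Finset ℕ := {v ∈ range N | par v ≠ 0}

/-- A search tree from `s` in the arcs of residual capacity at least `δ`: the entry `par v` is `0`
if `v` has not been reached, and otherwise one more than the parent of `v`. -/
structure IsTree (N s δ : ℕ) (r : ℕ → ℕ → ℕ) (par rank : ℕ → ℕ) : Prop where
  root : par s ≠ 0
  parent : ∀ v < N, par v ≠ 0 → v ≠ s →
    ∃ p < N, par v = p + 1 ∧ par p ≠ 0 ∧ rank p < rank v ∧ δ ≤ r p v
  rank_lt : ∀ v < N, par v ≠ 0 → rank v < #(visited N par)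

theorem IsTree.single {N s δ : ℕ} {r : ℕ → ℕ → ℕ} {par : ℕ → ℕ} (hs : s < N) (h0 : par s ≠ 0)
    (h : ∀ v < N, v ≠ s → par v = 0) : IsTree N s δ r par (fun _ => 0) where
  root := h0
  parent v hv h1 h2 := absurd (h v hv h2) h1
  rank_lt v hv _ := card_pos.2 ⟨s, by simp [visited, hs, h0]⟩

theorem card_visited_update {N : ℕ} {par : ℕ → ℕ} {b q : ℕ} (hb : b < N) (hpb : par b = 0) :
    #(visited N (Function.update par b (q + 1))) = #(visited N par) + 1 := by
  have : visited N (Function.update par b (q + 1)) = insert b (visited N par) := by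
    ext v
    by_cases h : v = b
    · subst h; simp [visited, hb]
    · simp [visited, h]
  rw [this, card_insert_of_notMem (by simp [visited, hpb])]

theorem card_visited_le (N : ℕ) (par : ℕ → ℕ) : #(visited N par) ≤ N :=
  (card_filter_le _ _).trans (card_range N).le

/-- The new node gets the rank of its parent plus one, while the number of visited nodes also grows
by one; hence ranks stay below that number. -/
theorem IsTree.insert {N s δ : ℕ} {r : ℕ → ℕ → ℕ} {par rank : ℕ → ℕ}
    (h : IsTree N s δ r par rank) {a b : ℕ} (ha : a < N) (hb : b < N) (hpa : par a ≠ 0)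
    (hpb : par b = 0) (hr : δ ≤ r a b) :
    IsTree N s δ r (Function.update par b (a + 1)) (Function.update rank b (rank a + 1)) := by
  have hab : a ≠ b := by rintro rfl; exact hpa hpb
  refine ⟨?_, fun v hv h1 h2 => ?_, fun v hv h1 => ?_⟩
  · have : s ≠ b := by rintro rfl; exact h.root hpb
    simpa [this] using h.root
  · by_cases hvb : v = b
    · subst hvb
      exact ⟨a, ha, by simp, by simp [hab, hpa], by simp [hab], hr⟩
    · simp only [ne_eq, hvb, not_false_eq_true, Function.update_of_ne] at h1 ⊢
      obtain ⟨p, hp, e1, e2, e3, e4⟩ := h.parent v hv h1 h2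
      have hpb' : p ≠ b := by rintro rfl; exact e2 hpb
      exact ⟨p, hp, e1, by simpa [hpb'] using e2, by simpa [hpb'] using e3, e4⟩
  · rw [card_visited_update hb hpb]
    by_cases hvb : v = b
    · subst hvb; simpa using h.rank_lt a ha hpa
    · simp only [ne_eq, hvb, not_false_eq_true, Function.update_of_ne] at h1 ⊢
      exact (h.rank_lt v hv h1).trans (by omega)

/-- Each arc leaving the visited set has residual capacity at most `δ - 1`, and there are at most `N
* N` such arcs. -/
theorem cutCap_visited_le {N δ : ℕ} {r : ℕ → ℕ → ℕ} {par : ℕ → ℕ}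
    (h : ∀ a < N, ∀ b < N, par a ≠ 0 → par b = 0 → r a b < δ) :
    cutCap N r (visited N par) ≤ N * N * (δ - 1) := by
  have h1 : ∀ a ∈ visited N par, ∑ b ∈ range N \ visited N par, r a b ≤ N * (δ - 1) := by
    intro a ha
    refine (sum_le_card_nsmul _ _ (δ - 1) fun b hb => ?_).trans ?_
    · simp only [visited, mem_filter, mem_range, mem_sdiff, not_and, not_not] at ha hb
      have := h a ha.1 b hb.1 ha.2 (hb.2 hb.1)
      omega
    · rw [smul_eq_mul]
      exact Nat.mul_le_mul_right _ ((card_le_card sdiff_subset).trans (card_range N).le)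
  refine (sum_le_card_nsmul _ _ _ h1).trans ?_
  rw [smul_eq_mul, mul_assoc]
  exact Nat.mul_le_mul_right _ (card_visited_le N par)

end NetFlow

/-! ### Counting loops and graph search. -/

namespace RAM
open Finset

/-- Execute `q` with the register `i` running from `0` to the content of register `m` minus `1`. -/
def Program.for (i m : ℕ) (q : Program) : Program :=
  .seq (.assign i (.const 0)) (.loop (.le (.add (.reg i) (.const 1)) (.reg m))
    (.seq q (.assign i (.add (.reg i) (.const 1)))))

/-- The invariant is asserted with the counter already advanced, hence the `setReg` in the premises.
Neither the counter nor its bound may be written by the body. -/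
theorem total_for {i m : ℕ} {q : Program} {σ₀ : State} (Inv : ℕ → State → Prop) (c : ℕ)
    (hiq : i ∉ q.regs) (hmq : m ∉ q.regs) (him : m ≠ i) (h0 : Inv 0 (σ₀.setReg i 0))
    (step : ∀ j < σ₀.reg m, ∀ σ, Frame (.for i m q) σ₀ σ → σ.reg i = j → Inv j σ →
      Total q σ fun τ k => k ≤ c ∧ Inv (j + 1) (τ.setReg i (j + 1))) :
    Total (.for i m q) σ₀ fun τ k =>
      k ≤ (σ₀.reg m + 1) * (2 * c + 25) ∧ Inv (σ₀.reg m) τ := by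
  have hF : ∀ {σ τ}, Frame q σ τ → Frame (.for i m q) σ τ := fun h =>
    h.mono (by simp [Program.for, Program.regs]) (by simp [Program.for, Program.arrs])
  have hF0 : Frame (.for i m q) σ₀ (σ₀.setReg i 0) :=
    ⟨fun r hr => by
      have : r ≠ i := by rintro rfl; simp [Program.for, Program.regs] at hr
      simp [this], fun _ _ => rfl⟩
  have hmF : m ∉ (Program.for i m q).regs := by simp [Program.for, Program.regs, hmq, him]
  unfold Program.for
  rw [total_seq, total_assign]
  refine (Total.loop (fun v σ => σ.reg i ≤ σ₀.reg m ∧ v = σ₀.reg m - σ.reg i ∧ Inv (σ.reg i) σ)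
    (c + 7) (m := σ₀.reg m) ?_ ?_).mono ?_
  · simpa [Expr.val] using h0
  · rintro v σ hFσ ⟨h1, h2, h3⟩
    have hFσ' : Frame (.for i m q) σ₀ σ := hF0.trans
      (hFσ.mono (by simp [Program.for, Program.regs]) (by simp [Program.for, Program.arrs]))
    refine ⟨by simp [Expr.cost], fun hv => ?_⟩
    have hm : σ.reg m = σ₀.reg m := hFσ'.reg m hmF
    have hlt : σ.reg i < σ₀.reg m := by
      simpa [Expr.val, hm, Nat.succ_le_iff] using hv
    rw [total_seq]
    refine (step _ hlt σ hFσ' rfl h3).mono ?_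
    rintro τ k hFτ ⟨hk, hI⟩
    rw [total_assign]
    have hi : τ.reg i = σ.reg i := hFτ.reg i hiq
    simp only [Expr.cost, Expr.val, hi, setReg_reg, if_true]
    exact ⟨by omega, _, by omega, by omega, rfl, hI⟩
  · rintro τ k hFτ ⟨hk, ⟨v, hv, h1, h2, h3⟩, hz⟩
    have hm : τ.reg m = σ₀.reg m := by
      have := (hF0.trans (hFτ.mono (q := .for i m q) (by simp [Program.for, Program.regs])
        (by simp [Program.for, Program.arrs]))).reg m hmF
      exact this
    have hi : τ.reg i = σ₀.reg m := by
      simp only [Expr.val, hm] at hz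
      split_ifs at hz
      omega
    simp only [Expr.cost]
    refine ⟨?_, hi ▸ h3⟩
    nlinarith

/-- The `N × N` matrix in array `7`. -/
def res (N : ℕ) (σ : State) (a b : ℕ) : ℕ := σ.arr 7 (a * N + b)

theorem index_lt {N a b : ℕ} (ha : a < N) (hb : b < N) : a * N + b < N * N := by
  have : (a + 1) * N ≤ N * N := Nat.mul_le_mul_right _ ha
  linarith

theorem index_inj {N a b a' b' : ℕ} (hb : b < N) (hb' : b' < N) :
    a * N + b = a' * N + b' ↔ a = a' ∧ b = b' := by
  refine ⟨fun h => ?_, fun ⟨h1, h2⟩ => by rw [h1, h2]⟩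
  have h1 : (a * N + b) / N = a := by
    rw [mul_comm, Nat.mul_add_div (by omega), Nat.div_eq_of_lt hb, add_zero]
  have h2 : (a' * N + b') / N = a' := by
    rw [mul_comm, Nat.mul_add_div (by omega), Nat.div_eq_of_lt hb', add_zero]
  have h3 : a = a' := by rw [← h1, ← h2, h]
  subst h3
  exact ⟨rfl, by omega⟩

theorem size_le_self (N : ℕ) : Nat.size N ≤ N := Nat.size_le.2 Nat.lt_two_pow_self

theorem size_ite_le (p : Prop) [Decidable p] : Nat.size (if p then 1 else 0) ≤ 1 := by
  split_ifs <;> simp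

/-- Registers: `1` holds the number `N` of nodes, `18` its square, `14` the source, and `7` the
bound `δ`. Array `8` receives a search tree in the arcs of residual capacity at least `δ`. -/
def search : Program :=
  .seq (.for 8 1 (.store 8 (.reg 8) (.const 0)))
  (.seq (.store 8 (.reg 14) (.const 1))
  (.seq (.assign 8 (.const 0))
  (.loop (.le (.add (.reg 8) (.const 1)) (.reg 18))
    (.seq (.assign 9 (.div (.reg 8) (.reg 1)))
    (.seq (.assign 10 (.sub (.reg 8) (.mul (.reg 9) (.reg 1))))
    (.cond (.mul (.mul (.le (.const 1) (.cell 8 (.reg 9))) (.le (.cell 8 (.reg 10)) (.const 0)))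
        (.le (.reg 7) (.cell 7 (.reg 8))))
      (.seq (.store 8 (.reg 10) (.add (.reg 9) (.const 1))) (.assign 8 (.const 0)))
      (.assign 8 (.add (.reg 8) (.const 1)))))))))

/-- The scan of all pairs restarts at `0` after every new node, so a completed scan shows that no
arc of capacity at least `δ` leaves the visited set. -/
theorem total_search {σ : State} {N s δ : ℕ} (h1 : σ.reg 1 = N) (h18 : σ.reg 18 = N * N)
    (h14 : σ.reg 14 = s) (h7 : σ.reg 7 = δ) (hs : s < N) :
    Total search σ fun τ k => k ≤ 200 * (N + 1) ^ 4 ∧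
      (∃ rank, IsTree N s δ (res N σ) (τ.arr 8) rank) ∧
      ∀ a < N, ∀ b < N, τ.arr 8 a ≠ 0 → τ.arr 8 b = 0 → res N σ a b < δ := by
  unfold search
  rw [total_seq]
  refine (total_for (fun j τ => ∀ v < j, τ.arr 8 v = 0) 5 (by decide) (by decide) (by decide)
    (by simp) ?_).mono ?_
  · rintro j hj σ hF rfl hI
    rw [total_store]
    simp only [Expr.cost, Expr.val, setReg_arr, setCell_arr_self]
    refine ⟨by omega, fun v hv => ?_⟩
    split_ifs with h
    · rfl
    · exact hI v (by omega)
  intro σ1 k1 hF1 ⟨hk1, hI1⟩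
  rw [h1] at hk1 hI1
  have e1 : σ1.reg 1 = N := (hF1.reg 1 (by decide)).trans h1
  have e18 : σ1.reg 18 = N * N := (hF1.reg 18 (by decide)).trans h18
  have e14 : σ1.reg 14 = s := (hF1.reg 14 (by decide)).trans h14
  have e7 : σ1.reg 7 = δ := (hF1.reg 7 (by decide)).trans h7
  have a7 : σ1.arr 7 = σ.arr 7 := hF1.arr 7 (by decide)
  rw [total_seq, total_store, total_seq, total_assign]
  simp only [Expr.val, Expr.cost, e14]
  -- The variant is lexicographic: the unvisited nodes first, then the rest of the scan, which is
  -- less than `N * N + 1`.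
  refine (Total.loop (fun m τ => τ.reg 8 ≤ N * N ∧ (∃ rank, IsTree N s δ (res N σ) (τ.arr 8) rank) ∧
    (∀ a < N, ∀ b < N, a * N + b < τ.reg 8 → τ.arr 8 a ≠ 0 → τ.arr 8 b = 0 → res N σ a b < δ) ∧
    (N - #(visited N (τ.arr 8))) * (N * N + 1) + (N * N - τ.reg 8) ≤ m)
    (N + 60) (m := N * (N * N + 1) + N * N) ?_ ?_).mono ?_
  · simp only [setReg_reg, setReg_arr, setCell_arr_eq_update, if_true]
    have hz : ∀ v < N, v ≠ s → Function.update (σ1.arr 8) s 1 v = 0 := fun v hv hvs => by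
      rw [Function.update_of_ne hvs]; exact hI1 v hv
    have hc : (N - #(visited N (Function.update (σ1.arr 8) s 1))) * (N * N + 1) ≤
        N * (N * N + 1) := Nat.mul_le_mul_right _ (Nat.sub_le _ _)
    exact ⟨by omega, ⟨_, IsTree.single hs (by simp) hz⟩, by simp, by simp [hc]⟩
  · rintro m τ hFτ ⟨hle, ⟨rank, hT⟩, hC, hm⟩
    have f1 : τ.reg 1 = N := by rw [hFτ.reg 1 (by decide)]; simpa using e1
    have f18 : τ.reg 18 = N * N := by rw [hFτ.reg 18 (by decide)]; simpa using e18
    have f14 : τ.reg 14 = s := by rw [hFτ.reg 14 (by decide)]; simpa using e14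
    have f7 : τ.reg 7 = δ := by rw [hFτ.reg 7 (by decide)]; simpa using e7
    have b7 : τ.arr 7 = σ.arr 7 := by
      rw [hFτ.arr 7 (by decide), setReg_arr, setCell_arr_of_ne _ _ _ (by decide), a7]
    refine ⟨by simp [Expr.cost], fun hv => ?_⟩
    have hlt : τ.reg 8 < N * N := by simpa [Expr.val, f18, Nat.succ_le_iff] using hv
    have hN : 0 < N := by omega
    obtain ⟨a, b, ha, hb, hab⟩ : ∃ a b, a < N ∧ b < N ∧ τ.reg 8 = a * N + b :=
      ⟨τ.reg 8 / N, τ.reg 8 % N, Nat.div_lt_of_lt_mul hlt, Nat.mod_lt _ hN,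
        (Nat.div_add_mod' _ _).symm⟩
    have hdiv : (a * N + b) / N = a := by
      rw [mul_comm, Nat.mul_add_div hN, Nat.div_eq_of_lt hb, add_zero]
    simp only [total_seq, total_assign, total_cond, total_store, Expr.val, Expr.cost, setReg_reg,
      setReg_arr, setCell_arr_eq_update, f1, f7, b7, hab, hdiv, Nat.add_sub_cancel_left,
      if_true, if_false, Nat.reduceEqDiff]
    have hsz := size_le_self N
    have hs1 := size_ite_le (τ.arr 8 b ≤ 0)
    have hs2 := size_ite_le (δ ≤ σ.arr 7 (a * N + b))
    have hab' := index_lt ha hb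
    refine ⟨fun hc => ⟨by omega, ?_⟩, fun hc => ⟨by omega, ?_⟩⟩
    · simp only [mul_ne_zero_iff, ne_eq, ite_eq_right_iff, one_ne_zero, imp_false, not_not,
        Nat.one_le_iff_ne_zero, Nat.le_zero] at hc
      obtain ⟨⟨hpa, hpb⟩, hr⟩ := hc
      refine ⟨_, ?_, by omega, ⟨_, hT.insert ha hb hpa hpb hr⟩, by simp, le_rfl⟩
      refine lt_of_lt_of_le ?_ hm
      rw [card_visited_update hb hpb]
      have h2 := card_visited_le N (Function.update (τ.arr 8) b (a + 1))
      rw [card_visited_update hb hpb] at h2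
      obtain ⟨d, hd⟩ := Nat.exists_eq_add_of_le h2
      have h3 : N - (#(visited N (τ.arr 8)) + 1) = d := by omega
      have h4 : N - #(visited N (τ.arr 8)) = d + 1 := by omega
      rw [h3, h4, add_mul]
      omega
    · refine ⟨_, ?_, hab', ⟨_, hT⟩, fun a' ha' b' hb' hlt' hpa hpb => ?_, le_rfl⟩
      · omega
      · rcases Nat.lt_succ_iff_lt_or_eq.1 hlt' with h | h
        · exact hC a' ha' b' hb' (by omega) hpa hpb
        · obtain ⟨rfl, rfl⟩ := (index_inj hb' hb).1 h
          by_contra hr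
          simp [hpb, Nat.one_le_iff_ne_zero.2 hpa] at hc
          exact hr (by simpa [res] using hc)
  · rintro τ k hFτ ⟨hk, ⟨m', hm', hle, hT, hC, -⟩, hz⟩
    have f18 : τ.reg 18 = N * N := by rw [hFτ.reg 18 (by decide)]; simpa using e18
    have hidx : N * N ≤ τ.reg 8 := by
      simp only [Expr.val, f18] at hz
      split_ifs at hz
      omega
    refine ⟨?_, hT, fun a ha b hb => hC a ha b hb ((index_lt ha hb).trans_le hidx)⟩
    have : (N * (N * N + 1) + N * N + 1) * (2 * (N + 60) + 1) + (N + 1) * 35 + 20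
      ≤ 200 * (N + 1) ^ 4 := by
      ring_nf; nlinarith [Nat.zero_le (N^2)]
    omega

end RAM

/-! ### Maximum flow by capacity scaling. -/

namespace RAM
open Finset

/-- Push the amount in register `7` along the path to the sink (register `15`) in the search
tree in array `8`. -/
def augment : Program :=
  .seq (.assign 11 (.reg 15))
  (.loop (.add (.sub (.reg 11) (.reg 14)) (.sub (.reg 14) (.reg 11)))
    (.seq (.assign 12 (.sub (.cell 8 (.reg 11)) (.const 1)))
    (.seq (.store 7 (.add (.mul (.reg 12) (.reg 1)) (.reg 11))
      (.sub (.cell 7 (.add (.mul (.reg 12) (.reg 1)) (.reg 11))) (.reg 7)))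
    (.seq (.store 7 (.add (.mul (.reg 11) (.reg 1)) (.reg 12))
      (.add (.cell 7 (.add (.mul (.reg 11) (.reg 1)) (.reg 12))) (.reg 7)))
    (.assign 11 (.reg 12))))))

/-- The path is traced from the sink towards the root, prolonging at its front a flow from the
current node to `z`. The ranks decrease, which bounds the number of steps and prevents a tree arc
from being used twice. -/
theorem total_augment {σ : State} {N s z δ : ℕ} {rank : ℕ → ℕ} (h1 : σ.reg 1 = N)
    (h14 : σ.reg 14 = s) (h15 : σ.reg 15 = z) (h7 : σ.reg 7 = δ) (hz : z < N)
    (hT : IsTree N s δ (res N σ) (σ.arr 8) rank) (hpz : σ.arr 8 z ≠ 0) :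
    Total augment σ fun τ k => k ≤ 200 * (N + 1) ^ 2 ∧ Pushes N s z (res N σ) (res N τ) δ := by
  unfold augment
  rw [total_seq, total_assign]
  simp only [Expr.val, Expr.cost, h15]
  -- The last clause holds since the arcs decreased so far lead into nodes of rank above the current
  -- one; the reversed arcs have only gained capacity.
  refine (Total.loop (fun m τ => τ.reg 11 < N ∧ σ.arr 8 (τ.reg 11) ≠ 0 ∧ m = rank (τ.reg 11) ∧
    (∃ Δ, IsNetFlow N (τ.reg 11) z Δ δ ∧
      ∀ a < N, ∀ b < N, (res N σ a b : ℤ) = res N τ a b + Δ a b) ∧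
    ∀ w < N, w ≠ s → σ.arr 8 w ≠ 0 → rank w ≤ rank (τ.reg 11) → ∀ p < N, σ.arr 8 w = p + 1 →
      δ ≤ res N τ p w) (4 * N + 60) (m := rank z) ?_ ?_).mono ?_
  · simp only [setReg_reg, if_true]
    refine ⟨hz, hpz, trivial, ⟨_, IsNetFlow.zero N z δ, fun a _ b _ => by simp [res]⟩, ?_⟩
    intro w hw hws hpw _ p hp hpp
    obtain ⟨p', hp', e1, -, -, e2⟩ := hT.parent w hw hpw hws
    obtain rfl : p = p' := by omega
    exact e2
  · rintro m τ hFτ ⟨hv, hpv, rfl, ⟨Δ, hΔ, hr⟩, hw⟩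
    have f1 : τ.reg 1 = N := by rw [hFτ.reg 1 (by decide)]; simpa using h1
    have f14 : τ.reg 14 = s := by rw [hFτ.reg 14 (by decide)]; simpa using h14
    have f7 : τ.reg 7 = δ := by rw [hFτ.reg 7 (by decide)]; simpa using h7
    have f8 : τ.arr 8 = σ.arr 8 := by rw [hFτ.arr 8 (by decide)]; rfl
    refine ⟨by simp [Expr.cost], fun hne => ?_⟩
    generalize hv' : τ.reg 11 = v at *
    have hvs : v ≠ s := by
      rintro rfl
      simp [Expr.val, hv', f14] at hne
    obtain ⟨p, hp, e1, e2, e3, e4⟩ := hT.parent v hv hpv hvs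
    have hpv' : p ≠ v := by rintro rfl; omega
    simp only [total_seq, total_assign, total_store, Expr.val, Expr.cost, setReg_reg, setReg_arr,
      setCell_reg, f1, f7, f8, hv', e1, Nat.add_sub_cancel, if_true, if_false, Nat.reduceEqDiff]
    have hsz := size_le_self N
    have hδ : δ ≤ res N τ p v := hw v hv hvs hpv le_rfl p hp e1
    have hres : ∀ a < N, ∀ b < N, res N ((((τ.setReg 12 p).setCell 7 (p * N + v)
        (τ.arr 7 (p * N + v) - δ)).setCell 7 (v * N + p)
          (((τ.setReg 12 p).setCell 7 (p * N + v) (τ.arr 7 (p * N + v) - δ)).arr 7 (v * N + p) +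
            δ)).setReg 11 p) a b =
        if a = p ∧ b = v then res N τ p v - δ else
          if a = v ∧ b = p then res N τ v p + δ else res N τ a b := by
      intro a ha b hb
      simp only [res, setReg_arr, setCell_arr_self, index_inj hb hp, index_inj hb hv,
        index_inj hp hv]
      by_cases h1 : a = p ∧ b = v
      · simp [h1, hpv']
      · by_cases h2 : a = v ∧ b = p
        · simp [h2, hpv'.symm]
        · simp [h1, h2]
    refine ⟨by omega, _, e3, hp, e2, rfl, ⟨_, hΔ.cons hp hv, fun a ha b hb => ?_⟩, ?_⟩
    · rw [hres a ha b hb, hr a ha b hb]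
      by_cases h1 : a = p ∧ b = v
      · obtain ⟨rfl, rfl⟩ := h1
        simp [hpv', hδ]
      · by_cases h2 : a = v ∧ b = p
        · obtain ⟨rfl, rfl⟩ := h2
          simp [hpv'.symm]
          ring
        · simp [h1, h2]
    · intro w hw' hws hpw hrk p' hp' hpp
      rw [hres p' hp' w hw']
      have n1 : ¬ (p' = p ∧ w = v) := by rintro ⟨rfl, rfl⟩; omega
      rw [if_neg n1]
      have := hw w hw' hws hpw (by omega) p' hp' hpp
      split_ifs with h
      · obtain ⟨rfl, rfl⟩ := h; omega
      · exact this
  · rintro τ k hFτ ⟨hk, ⟨m', hm', hv, hpv, -, ⟨Δ, hΔ, hr⟩, -⟩, hend⟩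
    have f14 : τ.reg 14 = s := by rw [hFτ.reg 14 (by decide)]; simpa using h14
    have hvs : τ.reg 11 = s := by
      simp only [Expr.val, f14] at hend; omega
    rw [hvs] at hΔ
    refine ⟨?_, Δ, hΔ, hr⟩
    have h2 : rank z + 1 ≤ N := (hT.rank_lt z hz hpz).trans_le (card_visited_le _ _)
    have h3 : (rank z + 1) * (2 * (4 * N + 60) + 1) ≤ N * (2 * (4 * N + 60) + 1) :=
      Nat.mul_le_mul_right _ h2
    nlinarith

/-- Augment along paths of residual capacity at least `δ` (register `7`) as long as there are
any. -/
def phase : Program := .seq search (.loop (.cell 8 (.reg 15)) (.seq augment search))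

/-- Each augmentation lowers the capacity of the given cut by `δ`, so there are at most `2 * (N *
N)` of them. The set reached by the last, failing search is the new cut. -/
theorem total_phase {σ : State} {N s z δ : ℕ} (h1 : σ.reg 1 = N) (h18 : σ.reg 18 = N * N)
    (h14 : σ.reg 14 = s) (h15 : σ.reg 15 = z) (h7 : σ.reg 7 = δ) (hs : s < N) (hz : z < N)
    (hδ : 0 < δ) {R : Finset ℕ} (hR : R ⊆ range N) (hsR : s ∈ R) (hzR : z ∉ R)
    (hcut : cutCap N (res N σ) R ≤ 2 * (N * N) * δ) :
    Total phase σ fun τ k => k ≤ 3000 * (N + 1) ^ 6 ∧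
      (∃ x, 0 ≤ x ∧ Pushes N s z (res N σ) (res N τ) x) ∧
      ∃ R ⊆ range N, s ∈ R ∧ z ∉ R ∧ cutCap N (res N τ) R ≤ N * N * (δ - 1) := by
  have hp : 1 ≤ (N + 1) ^ 4 := Nat.one_le_pow _ _ (by omega)
  have hp2 : (N + 1) ^ 2 ≤ (N + 1) ^ 4 := Nat.pow_le_pow_right (by omega) (by omega)
  unfold phase
  rw [total_seq]
  refine (total_search h1 h18 h14 h7 hs).mono fun σ1 k1 hF1 ⟨hk1, hT1, hC1⟩ => ?_
  have e1 : σ1.reg 1 = N := (hF1.reg 1 (by decide)).trans h1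
  have e18 : σ1.reg 18 = N * N := (hF1.reg 18 (by decide)).trans h18
  have e14 : σ1.reg 14 = s := (hF1.reg 14 (by decide)).trans h14
  have e15 : σ1.reg 15 = z := (hF1.reg 15 (by decide)).trans h15
  have e7 : σ1.reg 7 = δ := (hF1.reg 7 (by decide)).trans h7
  have r1 : res N σ1 = res N σ := by unfold res; rw [hF1.arr 7 (by decide)]
  rw [← r1] at hT1 hC1 hcut ⊢
  refine (Total.loop (fun m τ => (∃ x, 0 ≤ x ∧ Pushes N s z (res N σ1) (res N τ) x) ∧
    (∃ rank, IsTree N s δ (res N τ) (τ.arr 8) rank) ∧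
    (∀ a < N, ∀ b < N, τ.arr 8 a ≠ 0 → τ.arr 8 b = 0 → res N τ a b < δ) ∧
    cutCap N (res N τ) R ≤ m * δ) (400 * (N + 1) ^ 4) (m := 2 * (N * N))
    ⟨⟨0, le_rfl, .refl _ _ _ _⟩, hT1, hC1, hcut⟩ ?_).mono ?_
  · rintro m τ hFτ ⟨⟨x, hx, hP⟩, ⟨rank, hT⟩, hC, hcut⟩
    refine ⟨by simp only [Expr.cost]; omega, fun hv => ?_⟩
    have f1 : τ.reg 1 = N := (hFτ.reg 1 (by decide)).trans e1
    have f18 : τ.reg 18 = N * N := (hFτ.reg 18 (by decide)).trans e18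
    have f14 : τ.reg 14 = s := (hFτ.reg 14 (by decide)).trans e14
    have f15 : τ.reg 15 = z := (hFτ.reg 15 (by decide)).trans e15
    have f7 : τ.reg 7 = δ := (hFτ.reg 7 (by decide)).trans e7
    rw [total_seq]
    refine (total_augment f1 f14 f15 f7 hz hT (by simpa [Expr.val, f15] using hv)).mono
      fun υ k hFυ ⟨hk, hP'⟩ => ?_
    have g1 : υ.reg 1 = N := (hFυ.reg 1 (by decide)).trans f1
    have g18 : υ.reg 18 = N * N := (hFυ.reg 18 (by decide)).trans f18
    have g14 : υ.reg 14 = s := (hFυ.reg 14 (by decide)).trans f14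
    have g7 : υ.reg 7 = δ := (hFυ.reg 7 (by decide)).trans f7
    refine (total_search g1 g18 g14 g7 hs).mono fun φ l hFφ ⟨hl, hT2, hC2⟩ => ?_
    have r2 : res N φ = res N υ := by unfold res; rw [hFφ.arr 7 (by decide)]
    rw [← r2] at hT2 hC2 hP'
    have hc := hP'.cutCap hR hsR hzR
    have hc' : cutCap N (res N τ) R = cutCap N (res N φ) R + δ := by exact_mod_cast hc
    have hm : m ≠ 0 := by rintro rfl; omega
    obtain ⟨m', rfl⟩ := Nat.exists_eq_succ_of_ne_zero hm
    refine ⟨by omega, m', by omega, ⟨_, by positivity, hP.trans hP'⟩, hT2, hC2, ?_⟩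
    rw [Nat.succ_mul] at hcut
    omega
  · rintro τ k hFτ ⟨hk, ⟨m', hm', hP, ⟨rank, hT⟩, hC, hcut⟩, hend⟩
    have f15 : τ.reg 15 = z := (hFτ.reg 15 (by decide)).trans e15
    have hz0 : τ.arr 8 z = 0 := by simpa [Expr.val, f15] using hend
    refine ⟨?_, hP, visited N (τ.arr 8), filter_subset _ _, by simp [visited, hs, hT.root],
      by simp [visited, hz0], cutCap_visited_le hC⟩
    have h6 : (N + 1) ^ 6 = (N + 1) ^ 4 * (N * N + 2 * N + 1) := by ring
    rw [h6]
    generalize (N + 1) ^ 4 = Y at *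
    have : (2 * (N * N) + 1) * (2 * (400 * Y) + 1) ≤ (2 * (N * N) + 1) * (801 * Y) := by
      gcongr; omega
    nlinarith [Nat.zero_le (N * Y)]

/-- Compute a maximum flow by capacity scaling: array `7` is a matrix of residual capacities, and
register `13` a power of `2` that bounds the capacity of the cut around the source. -/
def maxflow : Program :=
  .seq (.assign 7 (.reg 13)) (.loop (.le (.const 2) (.reg 7))
    (.seq (.assign 7 (.div (.reg 7) (.const 2))) phase))

/-- Halving the threshold turns the bound left by one phase into the one that the next phase needs,
as `2 * δ - 1 < 2 * δ`. At threshold `1` the bound is `0`, and the flow is maximum. -/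
theorem total_maxflow {σ : State} {N s z K : ℕ} (h1 : σ.reg 1 = N) (h18 : σ.reg 18 = N * N)
    (h14 : σ.reg 14 = s) (h15 : σ.reg 15 = z) (h13 : σ.reg 13 = 2 ^ K) (hs : s < N) (hz : z < N)
    (hsz : s ≠ z) (hcut : cutCap N (res N σ) {s} < 2 ^ K) :
    Total maxflow σ fun τ k => k ≤ 7000 * (N + 1) ^ 6 * (K + 1) ∧
      (∃ x, 0 ≤ x ∧ Pushes N s z (res N σ) (res N τ) x) ∧ Saturated N s z (res N τ) := by
  have hp : 1 ≤ (N + 1) ^ 6 := Nat.one_le_pow _ _ (by omega)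
  unfold maxflow
  rw [total_seq, total_assign]
  simp only [Expr.val, Expr.cost, h13]
  refine (Total.loop (fun m τ => τ.reg 7 = 2 ^ m ∧
    (∃ x, 0 ≤ x ∧ Pushes N s z (res N σ) (res N τ) x) ∧
      ∃ R ⊆ range N, s ∈ R ∧ z ∉ R ∧ cutCap N (res N τ) R ≤ N * N * (2 ^ m - 1))
    (3010 * (N + 1) ^ 6) (m := K) ?_ ?_).mono ?_
  · refine ⟨by simp, ⟨0, le_rfl, .refl _ _ _ _⟩, {s}, by simpa using hs, by simp,
      by simpa using hsz.symm, ?_⟩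
    have : cutCap N (res N (σ.setReg 7 (2 ^ K))) {s} = cutCap N (res N σ) {s} := rfl
    rw [this]
    have h2 : 1 * (2 ^ K - 1) ≤ N * N * (2 ^ K - 1) :=
      Nat.mul_le_mul_right _ (Nat.mul_pos (by omega) (by omega))
    omega
  · rintro m τ hFτ ⟨h7, ⟨x, hx, hP⟩, R, hR, hsR, hzR, hcut⟩
    refine ⟨by simp only [Expr.cost]; omega, fun hv => ?_⟩
    have f1 : τ.reg 1 = N := by rw [hFτ.reg 1 (by decide)]; simpa using h1
    have f18 : τ.reg 18 = N * N := by rw [hFτ.reg 18 (by decide)]; simpa using h18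
    have f14 : τ.reg 14 = s := by rw [hFτ.reg 14 (by decide)]; simpa using h14
    have f15 : τ.reg 15 = z := by rw [hFτ.reg 15 (by decide)]; simpa using h15
    have hm : m ≠ 0 := by rintro rfl; simp [Expr.val, h7] at hv
    obtain ⟨m, rfl⟩ := Nat.exists_eq_succ_of_ne_zero hm
    have h2 : 2 ^ (m + 1) / 2 = 2 ^ m := by rw [pow_succ]; simp
    rw [total_seq, total_assign]
    simp only [Expr.val, Expr.cost, h7, h2, Nat.succ_eq_add_one]
    refine (total_phase (σ := τ.setReg 7 (2 ^ m)) (z := z) (δ := 2 ^ m) (by simpa using f1)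
      (by simpa using f18) (by simpa using f14) (by simpa using f15) (by simp) hs hz (by positivity)
      hR hsR hzR ?_).mono fun υ k hFυ ⟨hk, ⟨x', hx', hP'⟩, hR'⟩ => ?_
    · refine hcut.trans ?_
      calc N * N * (2 ^ (m + 1) - 1) ≤ N * N * 2 ^ (m + 1) := by gcongr; omega
        _ = _ := by ring
    · have hfr : Frame phase (τ.setReg 7 (2 ^ m)) υ := hFυ
      refine ⟨by omega, m, by omega, ?_, ⟨_, by positivity, hP.trans hP'⟩, hR'⟩
      rw [hfr.reg 7 (by decide)]; simp
  · rintro τ k hFτ ⟨hk, ⟨m, hm, h7, hP, R, hR, hsR, hzR, hcut⟩, hend⟩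
    have hm0 : m = 0 := by
      by_contra h
      have : 2 ^ 1 ≤ 2 ^ m := Nat.pow_le_pow_right (by omega) (by omega)
      simp only [Expr.val, h7] at hend
      split_ifs at hend
      omega
    subst hm0
    refine ⟨?_, hP, R, hR, hsR, hzR, by simpa using hcut⟩
    generalize (N + 1) ^ 6 = Y at *
    have : (K + 1) * (2 * (3010 * Y) + 1) ≤ (K + 1) * (6021 * Y) := by gcongr; omega
    nlinarith [Nat.zero_le (K * Y)]

end RAM

/-! ### Decomposition of integral flows into paths. -/

section PathDecomposition
open Finset
namespace SimpleGraph
variable {V : Type*} [DecidableEq V] {G : SimpleGraph V}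

/-- How often a walk uses the arc from `a` to `b`. -/
def Walk.arcCount : ∀ {u v : V}, G.Walk u v → V → V → ℕ
  | _, _, .nil, _, _ => 0
  | u, _, .cons (v := w) _ p, a, b => (if a = u ∧ b = w then 1 else 0) + p.arcCount a b

/-- Every visit to `a` is followed by an arc leaving `a`, except the visit that ends the walk. -/
theorem Walk.sum_arcCount_out [Fintype V] {u v : V} (p : G.Walk u v) (a : V) :
    ∑ b, p.arcCount a b + (if a = v then 1 else 0) = p.support.count a := by
  induction p with
  | nil =>
    rename_i u
    by_cases h : a = u
    · subst h; simp [arcCount]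
    · simp [arcCount, h, Ne.symm h]
  | cons h p ih =>
    simp only [arcCount, sum_add_distrib, support_cons, List.count_cons, ← ih, beq_iff_eq]
    rename_i u _ _
    by_cases h : a = u
    · subst h; simp; ring
    · simp [h, Ne.symm h]

theorem Walk.sum_arcCount_in [Fintype V] {u v : V} (p : G.Walk u v) (a : V) :
    ∑ b, p.arcCount b a + (if a = u then 1 else 0) = p.support.count a := by
  induction p with
  | nil =>
    rename_i u
    by_cases h : a = u
    · subst h; simp [arcCount]
    · simp [arcCount, h, Ne.symm h]
  | cons h p ih =>
    simp only [arcCount, sum_add_distrib, support_cons, List.count_cons, ← ih, beq_iff_eq]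
    rename_i u w _
    have : ∑ x, (if x = u ∧ a = w then 1 else 0) = if a = w then 1 else 0 := by
      by_cases h : a = w <;> simp [h]
    rw [this]
    by_cases h : a = u
    · subst h; simp; ring
    · simp [h, Ne.symm h]; ring

theorem Walk.exists_dart_of_arcCount_ne_zero {u v : V} (p : G.Walk u v) {a b : V}
    (h : p.arcCount a b ≠ 0) : ∃ d ∈ p.darts, d.fst = a ∧ d.snd = b := by
  induction p with
  | nil => simp [arcCount] at h
  | cons hadj p ih =>
    rename_i u w _
    by_cases h1 : a = u ∧ b = w
    · exact ⟨⟨(u, w), hadj⟩, by simp, h1.1.symm, h1.2.symm⟩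
    · obtain ⟨d, hd, h2⟩ := ih (by simpa [arcCount, h1] using h)
      exact ⟨d, by simp [hd], h2⟩

/-- A node that injects flow is joined to `t` by a path of arcs that carry flow. -/
theorem exists_path_of_flow [Fintype V] {t : V} {g : V → V → ℕ} {y : V → ℕ}
    (hadj : ∀ v w, g v w ≠ 0 → G.Adj v w)
    (hcons : ∀ v, v ≠ t → ∑ w, g v w = ∑ w, g w v + y v) {u : V} (hu : y u ≠ 0) :
    ∃ p : G.Walk u t, p.IsPath ∧ ∀ d ∈ p.darts, g d.fst d.snd ≠ 0 := by
  classical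
  let Rel : V → Prop := fun v => ∃ p : G.Walk u v, ∀ d ∈ p.darts, g d.fst d.snd ≠ 0
  suffices h : Rel t by
    obtain ⟨p, hp⟩ := h
    exact ⟨p.bypass, p.bypass_isPath, fun d hd => hp d (p.darts_bypass_subset_darts hd)⟩
  by_contra ht
  -- If `t` were not reached, all outflow of the reachable set `R` would stay inside and hence be at
  -- most the inflow of `R`; but conservation makes it larger by the positive injection.
  let R : Finset V := {v | Rel v}
  have hclosed : ∀ v ∈ R, ∀ w ∉ R, g v w = 0 := by
    intro v hv w hw
    by_contra hne
    refine hw ?_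
    obtain ⟨p, hp⟩ := (mem_filter.1 hv).2
    refine mem_filter.2 ⟨mem_univ _, p.concat (hadj v w hne), fun d hd => ?_⟩
    rw [Walk.darts_concat, List.concat_eq_append, List.mem_append, List.mem_singleton] at hd
    rcases hd with hd | rfl
    exacts [hp d hd, hne]
  have huR : u ∈ R := mem_filter.2 ⟨mem_univ _, .nil, by simp⟩
  have h1 : ∑ v ∈ R, ∑ w, g v w = ∑ v ∈ R, ∑ w ∈ R, g v w :=
    sum_congr rfl fun v hv => (sum_subset (subset_univ _) fun w _ hw => hclosed v hv w hw).symm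
  have h2 : ∑ v ∈ R, ∑ w, g v w = ∑ v ∈ R, (∑ w, g w v + y v) :=
    sum_congr rfl fun v hv => hcons v fun h => ht (by subst h; exact (mem_filter.1 hv).2)
  have h3 : ∑ v ∈ R, ∑ w ∈ R, g w v ≤ ∑ v ∈ R, ∑ w, g w v :=
    sum_le_sum fun v _ => sum_le_sum_of_subset (subset_univ _)
  have h4 : y u ≤ ∑ v ∈ R, y v := single_le_sum (fun _ _ => Nat.zero_le _) huR
  rw [sum_comm] at h3
  rw [sum_add_distrib] at h2
  omega

open Classical in
/-- An integral flow to `t` decomposes into paths (and cycles). -/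
theorem exists_path_decomposition [Fintype V] {t : V} (m : ℕ) : ∀ {g : V → V → ℕ} {y : V → ℕ},
    (∀ v w, g v w ≠ 0 → G.Adj v w) → (∀ w, g t w = 0) →
    (∀ v, v ≠ t → ∑ w, g v w = ∑ w, g w v + y v) → ∑ v, y v = m →
    ∃ h : ∀ u v : V, G.Path u v → ℕ, (∀ u v P, h u v P ≠ 0 → v = t) ∧
      (∀ u, ∑ P, h u t P = y u) ∧
      ∀ x, ∑ u, ∑ v, ∑ P : G.Path u v, (if x ∈ P.1.support then h u v P else 0) ≤
        ∑ w, g w x + y x := by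
  induction m with
  | zero =>
    intro g y _ _ _ hy
    have hy : ∀ u, y u = 0 := by simpa using hy
    exact ⟨fun _ _ _ => 0, by simp, by simp [hy], by simp⟩
  | succ m ih =>
    intro g y hadj ht hcons hy
    obtain ⟨u, hu⟩ : ∃ u, y u ≠ 0 := by
      by_contra! h
      simp [h] at hy
    obtain ⟨p, hp, hpg⟩ := exists_path_of_flow hadj hcons hu
    have hcnt : ∀ a, p.support.count a = if a ∈ p.support then 1 else 0 := fun a =>
      hp.support_nodup.count
    -- Taking one unit along `p` out of `g` and `y` lowers inflow plus injection by one at exactly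
    -- the nodes of `p`.
    have hin : ∀ a, ∑ b, p.arcCount b a + (if a = u then 1 else 0) =
        if a ∈ p.support then 1 else 0 := fun a => by rw [← hcnt, ← p.sum_arcCount_in]
    have hout : ∀ a, ∑ b, p.arcCount a b + (if a = t then 1 else 0) =
        if a ∈ p.support then 1 else 0 := fun a => by rw [← hcnt, ← p.sum_arcCount_out]
    have hle : ∀ a b, p.arcCount a b ≤ g a b := by
      intro a b
      by_cases h : p.arcCount a b = 0
      · omega
      · obtain ⟨d, hd, rfl, rfl⟩ := p.exists_dart_of_arcCount_ne_zero h
        have h1 := hpg d hd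
        have h2 := hout d.fst
        have h3 : p.arcCount d.fst d.snd ≤ ∑ b, p.arcCount d.fst b :=
          single_le_sum (f := fun b => p.arcCount d.fst b) (fun _ _ => Nat.zero_le _) (mem_univ _)
        split_ifs at h2 <;> omega
    have hsub : ∀ a b, g a b - p.arcCount a b + p.arcCount a b = g a b := fun a b =>
      Nat.sub_add_cancel (hle a b)
    have hgo : ∀ a, ∑ b, (g a b - p.arcCount a b) + ∑ b, p.arcCount a b = ∑ b, g a b := fun a => by
      rw [← sum_add_distrib]; exact sum_congr rfl fun b _ => hsub a b
    have hgi : ∀ a, ∑ b, (g b a - p.arcCount b a) + ∑ b, p.arcCount b a = ∑ b, g b a := fun a => by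
      rw [← sum_add_distrib]; exact sum_congr rfl fun b _ => hsub b a
    have hyu : ∀ v, y v - (if v = u then 1 else 0) + (if v = u then 1 else 0) = y v := fun v => by
      split_ifs with h
      · subst h; omega
      · rfl
    obtain ⟨h, h1, h2, h3⟩ := ih (g := fun a b => g a b - p.arcCount a b)
      (y := fun v => y v - (if v = u then 1 else 0))
      (fun v w hvw => hadj v w (by omega)) (fun w => by simp [ht])
      (fun v hv => by
        have := hcons v hv
        have e1 := hgo v
        have e2 := hgi v
        have e3 := hyu v
        have e4 := hin v
        have e5 := hout v
        rw [if_neg hv] at e5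
        omega)
      (by
        have : ∑ v, (y v - (if v = u then 1 else 0)) + ∑ v, (if v = u then 1 else 0) = m + 1 := by
          rw [← hy, ← sum_add_distrib]; exact sum_congr rfl fun v _ => hyu v
        simpa using this)
    -- Paths with different ends have different types; as elements of a sigma type they can be
    -- compared with `p`.
    let X : Σ a b : V, G.Path a b := ⟨u, t, p, hp⟩
    have hX : ∀ (a b : V) (F : G.Path a b → ℕ), ∑ P, (if (⟨a, b, P⟩ : Σ a b : V, G.Path a b) = X
        then F P else 0) = if h : a = u ∧ b = t then F (h.1 ▸ h.2 ▸ ⟨p, hp⟩) else 0 := by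
      intro a b F
      split_ifs with hab
      · obtain ⟨rfl, rfl⟩ := hab
        rw [sum_eq_single (⟨p, hp⟩ : G.Path a b)]
        · simp [X]
        · intro P _ hP
          rw [if_neg]
          simpa [X] using hP
        · simp
      · refine sum_eq_zero fun P _ => if_neg fun e => hab ?_
        simp only [X, Sigma.mk.injEq] at e
        obtain ⟨rfl, e⟩ := e
        simp only [heq_eq_eq, Sigma.mk.injEq] at e
        exact ⟨rfl, e.1⟩
    refine ⟨fun a b P => h a b P + if (⟨a, b, P⟩ : Σ a b : V, G.Path a b) = X then 1 else 0,
      fun a b P hP => ?_, fun a => ?_, fun x => ?_⟩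
    · by_cases e : (⟨a, b, P⟩ : Σ a b : V, G.Path a b) = X
      · simp only [X, Sigma.mk.injEq] at e
        obtain ⟨rfl, e⟩ := e
        simp only [heq_eq_eq, Sigma.mk.injEq] at e
        exact e.1
      · exact h1 a b P (by simpa [e] using hP)
    · rw [sum_add_distrib, h2, hX a t (fun _ => 1)]
      simpa using hyu a
    · have e1 : ∀ a b, ∑ P : G.Path a b, (if x ∈ P.1.support then
          (h a b P + if (⟨a, b, P⟩ : Σ a b : V, G.Path a b) = X then 1 else 0) else 0) =
          ∑ P : G.Path a b, (if x ∈ P.1.support then h a b P else 0) +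
            if a = u ∧ b = t then (if x ∈ p.support then 1 else 0) else 0 := by
        intro a b
        have : (if a = u ∧ b = t then (if x ∈ p.support then 1 else 0) else 0) =
            ∑ P : G.Path a b, (if (⟨a, b, P⟩ : Σ a b : V, G.Path a b) = X
              then (if x ∈ P.1.support then 1 else 0) else 0) := by
          rw [hX a b (fun P => if x ∈ P.1.support then 1 else 0)]
          by_cases hab : a = u ∧ b = t
          · obtain ⟨rfl, rfl⟩ := hab; simp
          · simp [hab]
        rw [this, ← sum_add_distrib]
        refine sum_congr rfl fun P _ => ?_
        split_ifs <;> simp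
      simp_rw [e1, sum_add_distrib]
      have e2 : ∑ a, ∑ b, (if a = u ∧ b = t then (if x ∈ p.support then 1 else 0) else 0) =
          if x ∈ p.support then 1 else 0 := by
        simp [ite_and]
      rw [e2]
      have e3 := h3 x
      have e4 := hgi x
      have e5 := hyu x
      have e6 := hin x
      omega

end SimpleGraph
end PathDecomposition

/-! ### The split network, and the passage from network flows to path flows. -/

namespace MultiflowInstance
open Finset

/-- The capacities of a network on the nodes `0, …, 2 * n`: the arc from `v` to `v + n` stands for
the node `v`, the arcs from `v + n` to `w` stand for the edges of the supply graph, and `2 * n` is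
the source. The sink is `n + t`. -/
def net (n t B : ℕ) (adj : ℕ → ℕ → ℕ) (c d : ℕ → ℕ) (a b : ℕ) : ℕ :=
  if a < n then (if b = a + n then c a else 0)
  else if a < 2 * n then (if b < n ∧ a ≠ n + t ∧ adj (a - n) b ≠ 0 then B else 0)
  else if b < n then d b else 0

section net
variable {n t B : ℕ} {adj : ℕ → ℕ → ℕ} {c d : ℕ → ℕ}

theorem net_in {v : ℕ} (hv : v < n) (b : ℕ) :
    net n t B adj c d v b = if b = v + n then c v else 0 := by simp [net, hv]

theorem net_out {v : ℕ} (hv : v < n) (b : ℕ) :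
    net n t B adj c d (n + v) b = if b < n ∧ v ≠ t ∧ adj v b ≠ 0 then B else 0 := by
  have h1 : n + v < 2 * n := by omega
  simp [net, h1]

theorem net_source (b : ℕ) : net n t B adj c d (2 * n) b = if b < n then d b else 0 := by
  by_cases h : n = 0
  · simp [net, h]
  · have h1 : ¬ 2 * n < n := by omega
    simp [net, h1]

/-- The capacity of the arcs of the cut around `R` that do not leave the source. -/
def innerCap (n t B : ℕ) (adj : ℕ → ℕ → ℕ) (c : ℕ → ℕ) (R : Finset ℕ) : ℕ :=
  ∑ a ∈ R.erase (2 * n), ∑ b ∈ range (2 * n + 1) \ R, net n t B adj c (fun _ => 0) a b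

/-- Separating the source arcs leaves a term independent of the demands, so a cut found with the
truncated demands `min ℓ (d b)` also says something about the original instance. -/
theorem cutCap_net {R : Finset ℕ} (hR : R ⊆ range (2 * n + 1)) (hs : 2 * n ∈ R) :
    cutCap (2 * n + 1) (net n t B adj c d) R =
      innerCap n t B adj c R + ∑ b ∈ range n \ R, d b := by
  unfold cutCap innerCap
  rw [← add_sum_erase _ _ hs, add_comm]
  congr 1
  · refine sum_congr rfl fun a ha => sum_congr rfl fun b _ => ?_
    have h1 := mem_range.1 (hR (mem_of_mem_erase ha))
    have h2 := ne_of_mem_erase ha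
    have h3 : a < 2 * n := by omega
    simp [net, h3]
  · simp_rw [net_source]
    rw [← sum_filter]
    refine sum_congr ?_ fun _ _ => rfl
    ext b
    simp only [mem_filter, mem_sdiff, mem_range]
    constructor
    · rintro ⟨⟨_, h1⟩, h2⟩; exact ⟨h2, h1⟩
    · rintro ⟨h2, h1⟩; exact ⟨⟨by omega, h1⟩, h2⟩

theorem sum_range_net (n : ℕ) (F : ℕ → ℤ) :
    ∑ b ∈ range (2 * n + 1), F b = ∑ w : Fin n, F w + ∑ w : Fin n, F (n + w) + F (2 * n) := by
  rw [sum_range_succ, two_mul, sum_range_add, sum_range, sum_range]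

end net

variable {I : MultiflowInstance}

/-- `t` is the sink, and `d`, `c` are the demands and capacities, scaled by the factor `D`;
`B` is the total demand, which replaces infinite capacities. -/
structure IsScaling (I : MultiflowInstance) (t : Fin I.n) (D B : ℕ) (adj : ℕ → ℕ → ℕ)
    (c d : ℕ → ℕ) : Prop where
  sink : ∀ u v, I.commodity.Adj u v → u = t ∨ v = t
  pos : 0 < D
  adj_iff : ∀ u v : Fin I.n, adj u v ≠ 0 ↔ I.supply.Adj u v
  dem : ∀ u : Fin I.n, I.commodity.Adj u t → (d u : ℝ) = D * (I.demand s(u, t) : ℝ)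
  dem_zero : ∀ u : Fin I.n, ¬ I.commodity.Adj u t → d u = 0
  cap_coe : ∀ (v : Fin I.n) (q : ℚ≥0), I.cap v = (q : WithTop ℚ≥0) → (c v : ℝ) = D * (q : ℝ)
  cap_top : ∀ v : Fin I.n, I.cap v = ⊤ → c v = B
  total : B = ∑ u : Fin I.n, d u

theorem PathFlow.routed_comm (f : I.PathFlow) (u v : Fin I.n) : f.routed u v = f.routed v u :=
  add_comm _ _

theorem PathFlow.Feasible.routed_eq_zero {f : I.PathFlow} {S : Set (Fin I.n)} (hf : f.Feasible S)
    {u v : Fin I.n} (h : ¬ I.commodity.Adj u v) : f.routed u v = 0 := by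
  classical
  have h1 : ∀ P, f u v P = 0 := fun P => by_contra fun h' => h (hf.joins_commodity u v P h')
  have h2 : ∀ P, f v u P = 0 := fun P =>
    by_contra fun h' => h (hf.joins_commodity v u P h').symm
  simp [PathFlow.routed, h1, h2]

theorem PathFlow.Feasible.routed_nonneg {f : I.PathFlow} {S : Set (Fin I.n)} (hf : f.Feasible S)
    (u v : Fin I.n) : 0 ≤ f.routed u v :=
  add_nonneg (sum_nonneg fun P _ => hf.nonneg u v P) (sum_nonneg fun P _ => hf.nonneg v u P)

/-- Contracting the split nodes turns `φ` into an integral flow `g` on the supply graph that injects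
`y u` at `u`; its path decomposition, divided by `D`, is the required flow. The load of `v` is
bounded by the flow on the arc that stands for `v`. -/
theorem exists_feasible_of_netFlow {t : Fin I.n} {D B : ℕ} {adj : ℕ → ℕ → ℕ} {c d : ℕ → ℕ}
    (hS : IsScaling I t D B adj c d) {φ : ℕ → ℕ → ℤ} {x : ℤ}
    (hφ : IsNetFlow (2 * I.n + 1) (2 * I.n) (I.n + t) φ x)
    (hle : ∀ a < 2 * I.n + 1, ∀ b < 2 * I.n + 1, φ a b ≤ net I.n t B adj c d a b)
    {y : ℕ → ℕ} (hy : ∀ b < I.n, φ (2 * I.n) b = y b) :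
    ∃ f : I.PathFlow, f.Feasible Set.univ ∧ ∀ u, f.routed u t = (y u : ℝ) / D := by
  classical
  have hlt : ∀ v : Fin I.n, (v : ℕ) < I.n := fun v => v.2
  have hzero : ∀ a < 2 * I.n + 1, ∀ b < 2 * I.n + 1, net I.n t B adj c d a b = 0 →
      net I.n t B adj c d b a = 0 → φ a b = 0 := by
    intro a ha b hb h1 h2
    have e1 := hle a ha b hb
    have e2 := hle b hb a ha
    rw [h1] at e1
    rw [h2] at e2
    have := hφ.antisymm a b
    omega
  have hthrough : ∀ v : Fin I.n, 0 ≤ φ v (I.n + v) := by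
    intro v
    have e2 := hle (I.n + v) (by omega) v (by omega)
    have hadj : ¬ adj v v ≠ 0 := fun h => I.supply.loopless.irrefl v ((hS.adj_iff v v).1 h)
    rw [net_out (hlt v), if_neg (fun h => hadj h.2.2)] at e2
    have := hφ.antisymm v (I.n + v)
    omega
  have harc : ∀ v w : Fin I.n, v ≠ w → 0 ≤ φ (I.n + v) w := by
    intro v w hvw
    have e2 := hle w (by omega) (I.n + v) (by omega)
    have : (v : ℕ) ≠ w := fun h => hvw (Fin.ext h)
    rw [net_in (hlt w), if_neg (by omega)] at e2
    have := hφ.antisymm w (I.n + v)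
    omega
  -- For `v = w` the entry of `φ` is the negative of the flow through `v`, and `toNat` discards it.
  let g : Fin I.n → Fin I.n → ℕ := fun v w => (φ (I.n + v) w).toNat
  have hg : ∀ v w : Fin I.n, φ (I.n + v) w = (g v w : ℤ) - if v = w then φ v (I.n + v) else 0 := by
    intro v w
    by_cases h : v = w
    · subst h
      have h1 := hthrough v
      have h2 := hφ.antisymm v (I.n + v)
      have : g v v = 0 := by simp only [g]; omega
      simp [this]; omega
    · simp only [h, if_false, g]
      have := harc v w h
      omega
  have hgle : ∀ v w, g v w ≤ net I.n t B adj c d (I.n + v) w := by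
    intro v w
    have := hle (I.n + v) (by omega) w (by omega)
    simp only [g]; omega
  have hout : ∀ v : Fin I.n, v ≠ t → (∑ w, g v w : ℤ) = φ v (I.n + v) := by
    intro v hv
    have h1 := hφ.excess (I.n + v) (by omega)
    have hvt : (v : ℕ) ≠ t := fun h => hv (Fin.ext h)
    rw [if_neg (by omega), if_neg (by omega), sum_range_net] at h1
    have h2 : ∀ w : Fin I.n, φ (I.n + v) (I.n + w) = 0 := fun w =>
      hzero _ (by omega) _ (by omega) (by rw [net_out (hlt v), if_neg (by omega)])
        (by rw [net_out (hlt w), if_neg (by omega)])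
    have h3 : φ (I.n + v) (2 * I.n) = 0 :=
      hzero _ (by omega) _ (by omega) (by rw [net_out (hlt v), if_neg (by omega)])
        (by rw [net_source, if_neg (by omega)])
    simp_rw [h2, h3, hg, sum_sub_distrib] at h1
    simp at h1
    omega
  have hin : ∀ v : Fin I.n, (∑ w, g w v : ℤ) + y v = φ v (I.n + v) := by
    intro v
    have h1 := hφ.excess v (by omega)
    have hvt : (v : ℕ) < I.n := v.2
    rw [if_neg (by omega), if_neg (by omega), sum_range_net] at h1
    have h2 : ∀ w : Fin I.n, φ v w = 0 := fun w =>
      hzero _ (by omega) _ (by omega) (by rw [net_in (hlt v), if_neg (by omega)])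
        (by rw [net_in (hlt w), if_neg (by omega)])
    have h3 : φ v (2 * I.n) = -y v := by rw [hφ.antisymm, hy v (hlt v)]
    have h4 : ∀ w : Fin I.n, φ v (I.n + w) = -(g w v : ℤ) + if w = v then φ v (I.n + v) else 0 := by
      intro w
      rw [hφ.antisymm, hg]
      by_cases h : w = v
      · subst h; simp; ring
      · simp [h]
    rw [sum_congr rfl fun w _ => h2 w, sum_congr rfl fun w _ => h4 w, h3, sum_add_distrib,
      sum_neg_distrib] at h1
    simp only [sum_const_zero, sum_ite_eq', mem_univ, if_true] at h1
    omega
  obtain ⟨h, h1, h2, h3⟩ := SimpleGraph.exists_path_decomposition (G := I.supply) (t := t) _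
    (g := g) (y := fun v => y v)
    (fun v w hvw => by
      have := hgle v w
      rw [net_out (hlt v)] at this
      by_contra hadj
      rw [if_neg (fun h => hadj ((hS.adj_iff v w).1 h.2.2))] at this
      omega)
    (fun w => by
      have := hgle t w
      rw [net_out (hlt t), if_neg (fun h => h.2.1 rfl)] at this
      omega)
    (fun v hv => by
      have e1 := hout v hv
      have e2 := hin v
      zify
      omega) rfl
  have hD : (0 : ℝ) < D := by exact_mod_cast hS.pos
  have hyd : ∀ u : Fin I.n, y u ≤ d u := by
    intro u
    have := hle (2 * I.n) (by omega) u (by omega)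
    rw [net_source, if_pos (hlt u), hy u (hlt u)] at this
    exact_mod_cast this
  have hyt : y t = 0 := by
    have := hyd t
    rw [hS.dem_zero t (I.commodity.loopless.irrefl t)] at this
    omega
  have hadj : ∀ u v P, h u v P ≠ 0 → I.commodity.Adj u v := by
    intro u v P hP
    obtain rfl := h1 u v P hP
    by_contra hc
    have e1 := hyd u
    rw [hS.dem_zero u hc] at e1
    have e2 : h u v P ≤ ∑ P, h u v P := single_le_sum (fun _ _ => Nat.zero_le _) (mem_univ P)
    rw [h2] at e2
    omega
  let f : I.PathFlow := fun u v P => (h u v P : ℝ) / D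
  have hf0 : ∀ {u v P}, f u v P ≠ 0 → h u v P ≠ 0 := by
    intro u v P hP h0
    exact hP (by simp [f, h0])
  have hrouted : ∀ u, f.routed u t = (y u : ℝ) / D := by
    intro u
    have e1 : ∑ P, f u t P = (y u : ℝ) / D := by
      simp only [f]
      rw [← sum_div, ← h2 u]
      push_cast
      rfl
    have e2 : ∑ P, f t u P = 0 := by
      refine sum_eq_zero fun P _ => ?_
      by_contra h0
      have h4 := hf0 h0
      have h5 := h1 t u P h4
      exact I.commodity.loopless.irrefl t (h5 ▸ hadj t u P h4)
    unfold PathFlow.routed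
    rw [e1, e2, add_zero]
  have hdem : ∀ u, I.commodity.Adj u t → f.routed u t ≤ (I.demand s(u, t) : ℝ) := by
    intro u hu
    rw [hrouted, div_le_iff₀ hD, mul_comm, ← hS.dem u hu]
    exact_mod_cast hyd u
  refine ⟨f, ⟨fun u v P => by positivity, fun u v P hP => hadj u v P (hf0 hP), by simp, ?_, ?_⟩,
    hrouted⟩
  · intro v q hq
    have e1 : f.load v = (∑ u, ∑ w, ∑ P : I.supply.Path u w,
        (if v ∈ P.1.support then h u w P else 0) : ℕ) / (D : ℝ) := by
      simp only [PathFlow.load, f]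
      push_cast
      simp_rw [sum_div]
      refine sum_congr rfl fun u _ => sum_congr rfl fun w _ => sum_congr rfl fun P _ => ?_
      split_ifs <;> simp
    rw [e1, div_le_iff₀ hD, mul_comm, ← hS.cap_coe v q hq]
    have e2 := h3 v
    have e3 := hle v (by omega) (I.n + v) (by omega)
    rw [net_in (hlt v), if_pos (by omega), ← hin v] at e3
    refine Nat.cast_le.2 (e2.trans ?_)
    exact_mod_cast e3
  · intro u v huv
    rcases hS.sink u v huv with rfl | rfl
    · rw [PathFlow.routed_comm, Sym2.eq_swap]
      exact hdem v huv.symm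
    · exact hdem u huv

end MultiflowInstance

/-! ### Cuts bound path flows; the certificate of optimality. -/

namespace MultiflowInstance
open Finset

variable {I : MultiflowInstance}

/-- A path to `t` that starts inside of a cut leaves it at a node, unless the cut has an arc that
stands for an edge. -/
theorem exists_mem_support_cut {G : SimpleGraph (Fin I.n)} {R : Finset ℕ} {u t : Fin I.n}
    (p : G.Walk u t) (ht : I.n + t ∉ R) (hu : (u : ℕ) ∈ R)
    (hR : ∀ v w : Fin I.n, v ≠ t → G.Adj v w → I.n + v ∈ R → (w : ℕ) ∈ R) :
    ∃ v ∈ p.support, (v : ℕ) ∈ R ∧ I.n + v ∉ R := by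
  induction p with
  | nil => exact ⟨_, by simp, hu, ht⟩
  | cons h p ih =>
    rename_i a b c
    by_cases ha : I.n + a ∈ R
    · have hac : a ≠ c := by rintro rfl; exact ht ha
      obtain ⟨v, hv, h2⟩ := ih ht (hR a b hac h ha) hR
      exact ⟨v, by simp [hv], h2⟩
    · exact ⟨a, by simp, hu, ha⟩

section
variable {t : Fin I.n} {D B : ℕ} {adj : ℕ → ℕ → ℕ} {c d : ℕ → ℕ}

theorem le_innerCap {R : Finset ℕ} {a b : ℕ} (ha : a ∈ R) (has : a ≠ 2 * I.n)
    (hb : b < 2 * I.n + 1) (hbR : b ∉ R) :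
    net I.n t B adj c (fun _ => 0) a b ≤ innerCap I.n t B adj c R := by
  refine le_trans ?_ (single_le_sum (f := fun a => ∑ b ∈ range (2 * I.n + 1) \ R,
    net I.n t B adj c (fun _ => 0) a b) (fun _ _ => Nat.zero_le _) (mem_erase.2 ⟨has, ha⟩))
  exact single_le_sum (f := fun b => net I.n t B adj c (fun _ => 0) a b)
    (fun _ _ => Nat.zero_le _) (mem_sdiff.2 ⟨mem_range.2 hb, hbR⟩)

theorem IsScaling.routed_le (hS : IsScaling I t D B adj c d) {f : I.PathFlow} {S : Set (Fin I.n)}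
    (hf : f.Feasible S) (u : Fin I.n) : D * f.routed u t ≤ d u := by
  have hD : (0 : ℝ) < D := by exact_mod_cast hS.pos
  by_cases h : I.commodity.Adj u t
  · rw [hS.dem u h]
    exact mul_le_mul_of_nonneg_left (hf.demand u t h) hD.le
  · rw [hf.routed_eq_zero h, hS.dem_zero u h]; simp

/-- Weak duality for the nodes in `R` alone. If the cut has an arc of capacity `B`, the total demand
suffices. Otherwise every path from `R` to the sink passes a node whose arc is cut, so the loads of
these nodes, bounded by their capacities, dominate the flow. -/
theorem IsScaling.routed_sum_le_innerCap (hS : IsScaling I t D B adj c d) {f : I.PathFlow}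
    {S : Set (Fin I.n)} (hf : f.Feasible S) {R : Finset ℕ} (ht : I.n + t ∉ R) :
    D * ∑ u ∈ univ.filter fun u : Fin I.n => (u : ℕ) ∈ R, f.routed u t ≤ innerCap I.n t B adj c R := by
  classical
  have hlt : ∀ v : Fin I.n, (v : ℕ) < I.n := fun v => v.2
  have hB : D * ∑ u ∈ univ.filter fun u : Fin I.n => (u : ℕ) ∈ R, f.routed u t ≤ (B : ℝ) := by
    rw [hS.total, mul_sum]
    push_cast
    refine (sum_le_sum fun u _ => hS.routed_le hf u).trans ?_
    exact sum_le_sum_of_subset_of_nonneg (subset_univ _) fun _ _ _ => by positivity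
  by_cases h1 : ∃ v w : Fin I.n, v ≠ t ∧ I.supply.Adj v w ∧ I.n + v ∈ R ∧ (w : ℕ) ∉ R
  · obtain ⟨v, w, hvt, hvw, hv, hw⟩ := h1
    refine hB.trans (Nat.cast_le.2 ?_)
    have := le_innerCap (t := t) (B := B) (adj := adj) (c := c) hv (by omega) (b := w) (by omega) hw
    rwa [net_out (hlt v), if_pos ⟨hlt w, fun h => hvt (Fin.ext h), (hS.adj_iff v w).2 hvw⟩] at this
  by_cases h2 : ∃ v : Fin I.n, (v : ℕ) ∈ R ∧ I.n + v ∉ R ∧ I.cap v = ⊤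
  · obtain ⟨v, hv, hw, hc⟩ := h2
    refine hB.trans (Nat.cast_le.2 ?_)
    have := le_innerCap (t := t) (B := B) (adj := adj) (c := c) hv (by omega) (by omega) hw
    rwa [net_in (hlt v), if_pos (add_comm _ _), hS.cap_top v hc] at this
  push Not at h1 h2
  let K : Finset (Fin I.n) := {v | (v : ℕ) ∈ R ∧ I.n + v ∉ R}
  have hcross : ∀ {u : Fin I.n} (p : I.supply.Walk u t), (u : ℕ) ∈ R → ∃ v ∈ p.support, v ∈ K := by
    intro u p hu
    obtain ⟨v, hv, h3⟩ := exists_mem_support_cut p ht hu fun v w hvt hvw hv => h1 v w hvt hvw hv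
    exact ⟨v, hv, by simpa [K] using h3⟩
  have hpath : ∀ (u v : Fin I.n) (P : I.supply.Path u v), (∃ x ∈ P.1.support, x ∈ K) →
      f u v P ≤ ∑ x ∈ K, if x ∈ P.1.support then f u v P else 0 := by
    rintro u v P ⟨x, hx, hxK⟩
    have := single_le_sum (f := fun x => if x ∈ P.1.support then f u v P else 0)
      (fun y _ => by
        split_ifs
        exacts [hf.nonneg u v P, le_rfl]) hxK
    simpa [hx] using this
  have hload : ∑ u ∈ univ.filter fun u : Fin I.n => (u : ℕ) ∈ R, f.routed u t ≤ ∑ x ∈ K, f.load x := by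
    have e1 : ∑ x ∈ K, f.load x =
        ∑ u, ∑ v, ∑ P, ∑ x ∈ K, if x ∈ P.1.support then f u v P else 0 := by
      simp only [PathFlow.load]
      rw [sum_comm]
      refine sum_congr rfl fun u _ => ?_
      rw [sum_comm]
      refine sum_congr rfl fun v _ => ?_
      rw [sum_comm]
    -- A path may be written in either direction. For a commodity at most one of the two terms is
    -- present, as its ends are not both `t`.
    have e2 : ∀ u v : Fin I.n, (if v = t ∧ (u : ℕ) ∈ R then ∑ P, f u v P else 0) +
        (if u = t ∧ (v : ℕ) ∈ R then ∑ P, f u v P else 0) ≤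
        ∑ P, ∑ x ∈ K, if x ∈ P.1.support then f u v P else 0 := by
      intro u v
      have nonneg : 0 ≤ ∑ P : I.supply.Path u v, ∑ x ∈ K,
          if x ∈ P.1.support then f u v P else 0 := by
        refine sum_nonneg fun P _ => sum_nonneg fun x _ => ?_
        split_ifs
        exacts [hf.nonneg u v P, le_rfl]
      by_cases huv : I.commodity.Adj u v
      · have hne : ¬ (u = t ∧ v = t) := by rintro ⟨rfl, rfl⟩; exact huv.ne rfl
        by_cases hv : v = t ∧ (u : ℕ) ∈ R
        · rw [if_pos hv, if_neg (fun h => hne ⟨h.1, hv.1⟩), add_zero]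
          obtain ⟨rfl, hu⟩ := hv
          exact sum_le_sum fun P _ => hpath u v P (hcross P.1 hu)
        · rw [if_neg hv, zero_add]
          split_ifs with hu
          · obtain ⟨rfl, hvR⟩ := hu
            refine sum_le_sum fun P _ => hpath u v P ?_
            obtain ⟨x, hx, hxK⟩ := hcross P.1.reverse hvR
            exact ⟨x, by simpa using hx, hxK⟩
          · exact nonneg
      · have : ∑ P, f u v P = 0 :=
          sum_eq_zero fun P _ => by_contra fun h => huv (hf.joins_commodity u v P h)
        simpa [this] using nonneg
    rw [e1]
    refine le_trans (le_of_eq ?_) (sum_le_sum fun u _ => sum_le_sum fun v _ => e2 u v)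
    simp_rw [sum_add_distrib, PathFlow.routed]
    rw [sum_filter]
    simp_rw [ite_add_zero]
    rw [sum_add_distrib]
    congr 1
    · refine sum_congr rfl fun u _ => ?_
      rw [sum_eq_single t (fun v _ hv => if_neg fun h => hv h.1) (by simp)]
      simp
    · rw [sum_comm]
      refine sum_congr rfl fun u _ => ?_
      rw [sum_eq_single t (fun v _ hv => if_neg fun h => hv h.1) (by simp)]
      simp
  have hcap : ∀ x ∈ K, D * f.load x ≤ c x := by
    intro x hx
    obtain ⟨hx1, hx2⟩ := (mem_filter.1 hx).2
    obtain ⟨q, hq⟩ := WithTop.ne_top_iff_exists.1 (h2 x hx1 hx2)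
    rw [hS.cap_coe x q hq.symm]
    exact mul_le_mul_of_nonneg_left (hf.capacity x q hq.symm) (by positivity)
  calc D * ∑ u ∈ univ.filter fun u : Fin I.n => (u : ℕ) ∈ R, f.routed u t ≤ D * ∑ x ∈ K, f.load x :=
        mul_le_mul_of_nonneg_left hload (by positivity)
    _ = ∑ x ∈ K, D * f.load x := mul_sum _ _ _
    _ ≤ ∑ x ∈ K, (c x : ℝ) := sum_le_sum hcap
    _ = ((∑ x ∈ K, c x : ℕ) : ℝ) := by push_cast; rfl
    _ ≤ innerCap I.n t B adj c R := by
        refine Nat.cast_le.2 ?_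
        have e1 : ∑ x ∈ K, c x ≤ ∑ x ∈ K, ∑ b ∈ range (2 * I.n + 1) \ R,
            net I.n t B adj c (fun _ => 0) x b := by
          refine sum_le_sum fun x hx => ?_
          obtain ⟨hx1, hx2⟩ := (mem_filter.1 hx).2
          have e2 := single_le_sum (f := fun b => net I.n t B adj c (fun _ => 0) x b)
            (fun _ _ => Nat.zero_le _)
            (mem_sdiff.2 ⟨mem_range.2 (by omega : I.n + x < 2 * I.n + 1), hx2⟩)
          simp only [net_in (hlt x), add_comm I.n, if_true] at e2 ⊢
          exact e2
        refine e1.trans ?_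
        unfold innerCap
        rw [← sum_image (s := K) (g := fun x : Fin I.n => (x : ℕ)) (f := fun a =>
          ∑ b ∈ range (2 * I.n + 1) \ R, net I.n t B adj c (fun _ => 0) a b)
          (fun _ _ _ _ h => Fin.ext h)]
        refine sum_le_sum_of_subset fun a ha => ?_
        obtain ⟨x, hx, rfl⟩ := mem_image.1 ha
        exact mem_erase.2 ⟨by have := x.2; omega, (mem_filter.1 hx).2.1⟩

theorem IsScaling.payoff_of_ne (hS : IsScaling I t D B adj c d) {f : I.PathFlow}
    {S : Set (Fin I.n)} (hf : f.Feasible S) {v : Fin I.n} (hv : v ≠ t) :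
    f.payoff v = f.routed v t := by
  unfold PathFlow.payoff
  rw [sum_eq_single t _ (by simp), f.routed_comm]
  intro w _ hw
  exact hf.routed_eq_zero fun h => (hS.sink w v h).elim hw hv

/-- Every unit of flow is paid once to the sink and once to the other end of its path. -/
theorem IsScaling.sum_payoff (hS : IsScaling I t D B adj c d) {f : I.PathFlow}
    {S : Set (Fin I.n)} (hf : f.Feasible S) :
    ∑ v, f.payoff v = 2 * ∑ w, f.routed w t := by
  have h0 : f.routed t t = 0 := hf.routed_eq_zero (I.commodity.loopless.irrefl t)
  rw [← add_sum_erase _ _ (mem_univ t), two_mul]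
  congr 1
  rw [← add_sum_erase _ (fun w => f.routed w t) (mem_univ t), h0, zero_add]
  exact sum_congr rfl fun v hv => hS.payoff_of_ne hf (ne_of_mem_erase hv)

/-- Nodes in `R` are charged to the inner arcs of the cut, the other nodes to their source arcs,
which belong to the cut. -/
theorem IsScaling.sum_routed_le_cutCap (hS : IsScaling I t D B adj c d) {f : I.PathFlow}
    {S : Set (Fin I.n)} (hf : f.Feasible S) {R : Finset ℕ} (hR : R ⊆ range (2 * I.n + 1))
    (hs : 2 * I.n ∈ R) (ht : I.n + t ∉ R) :
    D * ∑ u, f.routed u t ≤ cutCap (2 * I.n + 1) (net I.n t B adj c d) R := by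
  rw [cutCap_net hR hs, ← sum_filter_add_sum_filter_not univ (fun u : Fin I.n => (u : ℕ) ∈ R),
    mul_add]
  push_cast
  refine add_le_add (hS.routed_sum_le_innerCap hf ht) ?_
  rw [mul_sum]
  refine (sum_le_sum fun u _ => hS.routed_le hf u).trans (le_of_eq ?_)
  rw [← sum_image (s := univ.filter fun u : Fin I.n => (u : ℕ) ∉ R) (g := fun x : Fin I.n => (x : ℕ))
    (f := fun b => (d b : ℝ)) (fun _ _ _ _ h => Fin.ext h)]
  refine sum_congr ?_ fun _ _ => rfl
  ext b
  simp only [mem_image, mem_filter, mem_univ, true_and, mem_sdiff, mem_range]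
  exact ⟨by rintro ⟨u, hu, rfl⟩; exact ⟨u.2, hu⟩, fun ⟨h1, h2⟩ => ⟨⟨b, h1⟩, h2, rfl⟩⟩

theorem PathFlow.Feasible.payoff_nonneg {f : I.PathFlow} {S : Set (Fin I.n)} (hf : f.Feasible S)
    (v : Fin I.n) : 0 ≤ f.payoff v := sum_nonneg fun _ _ => hf.routed_nonneg _ _

theorem PathFlow.Feasible.payoff_eq_zero {f : I.PathFlow} {S : Set (Fin I.n)} (hf : f.Feasible S)
    {v : Fin I.n} (hv : v ∉ I.terminals) : f.payoff v = 0 :=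
  sum_eq_zero fun w _ => hf.routed_eq_zero fun h => hv ⟨w, h.symm⟩

theorem fairness_le {N : Type*} [Finite N] {W : Set N} {x : N → ℝ} {i : N} (hi : i ∈ W) :
    fairness W x ≤ x i :=
  ciInf_le (Set.finite_range fun i : W => x i).bddBelow (⟨i, hi⟩ : W)

theorem le_fairness {N : Type*} {W : Set N} {x : N → ℝ} {a : ℝ} (hW : W.Nonempty)
    (h : ∀ i ∈ W, a ≤ x i) : a ≤ fairness W x :=
  haveI : Nonempty W := hW.to_subtype
  le_ciInf fun i : W => h i i.2

/-- A feasible flow whose value is the capacity of a cut is in the core and maximizes social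
welfare. It is as fair as possible if all terminals get `ℓ`, and this is optimal by the demand of
some terminal or by some cut. -/
theorem IsScaling.optimal (hS : IsScaling I t D B adj c d) {y : ℕ → ℕ} {f : I.PathFlow}
    (hf : f.Feasible Set.univ) (hy : ∀ u, f.routed u t = (y u : ℝ) / D)
    {R : Finset ℕ} (hR : R ⊆ range (2 * I.n + 1)) (hs : 2 * I.n ∈ R) (ht : I.n + t ∉ R)
    (hcut : cutCap (2 * I.n + 1) (net I.n t B adj c d) R = ∑ u : Fin I.n, y u) {ℓ : ℕ}
    (hℓ : ∀ u : Fin I.n, I.commodity.Adj u t → ℓ ≤ y u)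
    (hmax : (∃ u : Fin I.n, I.commodity.Adj u t) →
      (∃ u : Fin I.n, I.commodity.Adj u t ∧ d u ≤ ℓ) ∨
      ∃ R : Finset ℕ, I.n + t ∉ R ∧ ∃ X : Finset (Fin I.n), X.Nonempty ∧
        (∀ u ∈ X, I.commodity.Adj u t ∧ (u : ℕ) ∈ R) ∧ innerCap I.n t B adj c R ≤ ℓ * #X) :
    f.payoff ∈ coalitionCore I.payoffs ∧
      IsGreatest (socialWelfare '' I.payoffs Set.univ) (socialWelfare f.payoff) ∧
      IsGreatest (fairness Set.univ '' I.payoffs Set.univ) (fairness Set.univ f.payoff) ∧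
      IsGreatest (fairness I.terminals '' I.payoffs Set.univ) (fairness I.terminals f.payoff) := by
  have hD : (0 : ℝ) < D := by exact_mod_cast hS.pos
  have hmem : f.payoff ∈ I.payoffs Set.univ := ⟨f, hf, rfl⟩
  have hvalue : D * ∑ u, f.routed u t = cutCap (2 * I.n + 1) (net I.n t B adj c d) R := by
    rw [hcut]
    simp_rw [hy]
    rw [← sum_div, mul_div_cancel₀ _ hD.ne']
    push_cast
    rfl
  have hbest : ∀ {f' : I.PathFlow} {S : Set (Fin I.n)}, f'.Feasible S →
      ∑ u, f'.routed u t ≤ ∑ u, f.routed u t := by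
    intro f' S hf'
    refine le_of_mul_le_mul_left ?_ hD
    rw [hvalue]
    exact hS.sum_routed_le_cutCap hf' hR hs ht
  have hfair : IsGreatest (fairness I.terminals '' I.payoffs Set.univ)
      (fairness I.terminals f.payoff) := by
    refine ⟨⟨_, hmem, rfl⟩, ?_⟩
    rintro _ ⟨_, ⟨f', hf', rfl⟩, rfl⟩
    by_cases hU : ∃ u : Fin I.n, I.commodity.Adj u t
    · have hself : ∀ u, I.commodity.Adj u t → (ℓ : ℝ) / D ≤ f.routed u t := by
        intro u hu
        rw [hy]
        gcongr
        exact hℓ u hu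
      have hlow : (ℓ : ℝ) / D ≤ fairness I.terminals f.payoff := by
        refine le_fairness (hU.imp fun u hu => ⟨t, hu⟩) ?_
        rintro v ⟨w, hvw⟩
        -- The sink receives at least what any single partner sends, so it cannot spoil the minimum.
        by_cases hv : v = t
        · subst hv
          exact (hself w hvw.symm).trans
            (single_le_sum (f := fun w => f.routed w v) (fun w _ => hf.routed_nonneg w v)
              (mem_univ w))
        · obtain rfl := (hS.sink v w hvw).resolve_left hv
          rw [hS.payoff_of_ne hf hv]
          exact hself v hvw
      refine le_trans ?_ hlow
      have hterm : ∀ u, I.commodity.Adj u t → fairness I.terminals f'.payoff ≤ f'.routed u t := by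
        intro u hu
        rw [← hS.payoff_of_ne hf' hu.ne]
        exact fairness_le ⟨t, hu⟩
      rcases hmax hU with ⟨u, hu, hdu⟩ | ⟨R', ht', X, hX, hXR, hcap⟩
      · refine (hterm u hu).trans ?_
        rw [le_div_iff₀' hD]
        exact (hS.routed_le hf' u).trans (by exact_mod_cast hdu)
      · rw [le_div_iff₀' hD]
        have hpos : (0 : ℝ) < #X := by exact_mod_cast hX.card_pos
        refine le_of_mul_le_mul_right ?_ hpos
        -- Averaging: the partners in `X` together send at most the capacity of the cut.
        calc D * fairness I.terminals f'.payoff * #X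
            = D * ∑ u ∈ X, fairness I.terminals f'.payoff := by
              rw [sum_const, nsmul_eq_mul]; ring
          _ ≤ D * ∑ u ∈ X, f'.routed u t :=
              mul_le_mul_of_nonneg_left (sum_le_sum fun u hu => hterm u (hXR u hu).1) hD.le
          _ ≤ D * ∑ u ∈ univ.filter fun u : Fin I.n => (u : ℕ) ∈ R', f'.routed u t :=
              mul_le_mul_of_nonneg_left (sum_le_sum_of_subset_of_nonneg
                (fun u hu => mem_filter.2 ⟨mem_univ _, (hXR u hu).2⟩)
                fun u _ _ => hf'.routed_nonneg u t) hD.le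
          _ ≤ innerCap I.n t B adj c R' := hS.routed_sum_le_innerCap hf' ht'
          _ ≤ ℓ * #X := by exact_mod_cast hcap
    -- Without commodities the real infimum over the empty set is `0` for every payoff vector.
    · have hempty : IsEmpty I.terminals := by
        refine ⟨fun ⟨v, w, hvw⟩ => hU ?_⟩
        rcases hS.sink v w hvw with rfl | rfl
        exacts [⟨w, hvw.symm⟩, ⟨v, hvw⟩]
      simp [fairness, Real.iInf_of_isEmpty]
  refine ⟨⟨hmem, ?_⟩, ⟨⟨_, hmem, rfl⟩, ?_⟩, ?_, hfair⟩
  · rintro S ⟨i, hi⟩ - ⟨_, ⟨f', hf', rfl⟩, hgt⟩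
    -- The payoff of `t` is the flow value, which no coalition can raise; a coalition without `t`
    -- earns `0`.
    by_cases htS : t ∈ S
    · exact absurd (hgt t htS) (not_lt.2 (hbest hf'))
    · have hit : i ≠ t := by rintro rfl; exact htS hi
      have h1 : f'.routed i t = 0 := by
        have hz : ∀ u v (P : I.supply.Path u v), t ∈ P.1.support → f' u v P = 0 := fun u v P hP =>
          by_contra fun h => htS (hf'.inside u v P h t hP)
        unfold PathFlow.routed
        rw [sum_eq_zero fun P _ => hz i t P P.1.end_mem_support,
          sum_eq_zero fun P _ => hz t i P P.1.start_mem_support, add_zero]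
      have h2 := hgt i hi
      rw [hS.payoff_of_ne hf' hit, h1] at h2
      exact absurd h2 (not_lt.2 (hf.payoff_nonneg i))
  · rintro _ ⟨_, ⟨f', hf', rfl⟩, rfl⟩
    unfold socialWelfare
    rw [hS.sum_payoff hf', hS.sum_payoff hf]
    exact mul_le_mul_of_nonneg_left (hbest hf') (by norm_num)
  · by_cases hall : I.terminals = Set.univ
    · rwa [hall] at hfair
    · obtain ⟨v, hv⟩ := (Set.ne_univ_iff_exists_notMem _).1 hall
      refine ⟨⟨_, hmem, rfl⟩, ?_⟩
      rintro _ ⟨_, ⟨f', hf', rfl⟩, rfl⟩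
      refine (fairness_le (Set.mem_univ v)).trans ?_
      rw [hf'.payoff_eq_zero hv]
      exact le_fairness ⟨v, trivial⟩ fun i _ => hf.payoff_nonneg i

end

end MultiflowInstance

/-! ### Equal amounts from all partners, and extension to a maximum flow. -/

namespace MultiflowInstance
open Finset

section
variable {n t B : ℕ} {adj : ℕ → ℕ → ℕ} {c d : ℕ → ℕ} {U : Finset ℕ}

theorem cutCap_net_source : cutCap (2 * n + 1) (net n t B adj c d) {2 * n} = ∑ b ∈ range n, d b := by
  rw [cutCap_net (by simp) (by simp)]
  rw [sdiff_singleton_eq_erase, erase_eq_of_notMem (by simp; omega)]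
  simp [innerCap]

theorem le_cutCap_source {r : ℕ → ℕ → ℕ} {b : ℕ} (hb : b < n) :
    r (2 * n) b ≤ cutCap (2 * n + 1) r {2 * n} := by
  unfold cutCap
  rw [sum_singleton]
  exact single_le_sum (f := fun b => r (2 * n) b) (fun _ _ => Nat.zero_le _)
    (by simp only [mem_sdiff, mem_range, mem_singleton]; omega)

/-- All nodes of `U` can send `ℓ` units to the sink. -/
def CanSend (n t B : ℕ) (adj : ℕ → ℕ → ℕ) (c d : ℕ → ℕ) (U : Finset ℕ) (ℓ : ℕ) : Prop :=
  (∀ b ∈ U, ℓ ≤ d b) ∧ ∃ r x, Pushes (2 * n + 1) (2 * n) (n + t)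
    (net n t B adj c fun b => min ℓ (d b)) r x ∧ ∀ b < n, r (2 * n) b = 0

/-- A demand or a cut shows that the nodes of `U` cannot send `ℓ` units. -/
def Blocked (n t B : ℕ) (adj : ℕ → ℕ → ℕ) (c d : ℕ → ℕ) (U : Finset ℕ) (ℓ : ℕ) : Prop :=
  (∃ b ∈ U, d b < ℓ) ∨ ∃ R ⊆ range (2 * n + 1), 2 * n ∈ R ∧ n + t ∉ R ∧
    innerCap n t B adj c R < ℓ * #(U ∩ R)

theorem canSend_zero : CanSend n t B adj c d U 0 :=
  ⟨by simp, _, _, .refl _ _ _ _, fun b hb => by simp [net_source, hb]⟩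

/-- If the demands suffice and yet a source arc is not used up, the value of the flow is less than
`ℓ * #U`. It is also the capacity of the saturated cut, which is the inner part plus `ℓ * #(U \ R)`;
subtraction leaves the inequality for `U ∩ R`. -/
theorem blocked_of_saturated (ht : t < n) (hU : U ⊆ range n) (hd : ∀ b < n, b ∉ U → d b = 0)
    {ℓ : ℕ} {r : ℕ → ℕ → ℕ} {x : ℤ}
    (hP : Pushes (2 * n + 1) (2 * n) (n + t) (net n t B adj c fun b => min ℓ (d b)) r x)
    (hr : Saturated (2 * n + 1) (2 * n) (n + t) r)
    (h : ¬ ((∀ b ∈ U, ℓ ≤ d b) ∧ ∀ b < n, r (2 * n) b = 0)) : Blocked n t B adj c d U ℓ := by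
  by_cases hℓ : ∀ b ∈ U, ℓ ≤ d b
  swap
  · push Not at hℓ
    exact .inl hℓ
  right
  obtain ⟨R, hR, hs, hz, hcut⟩ := hr
  refine ⟨R, hR, hs, hz, ?_⟩
  have hmin : ∀ b < n, min ℓ (d b) = if b ∈ U then ℓ else 0 := by
    intro b hb
    split_ifs with hbU
    · exact min_eq_left (hℓ b hbU)
    · simp [hd b hb hbU]
  obtain ⟨b, hb, hrb⟩ : ∃ b < n, r (2 * n) b ≠ 0 := by
    by_contra! h'
    exact h ⟨hℓ, h'⟩
  have e1 := hP.cutCap hR hs hz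
  have e2 := hP.cutCap (R := {2 * n}) (by simp) (by simp) (by simp; omega)
  rw [hcut, cutCap_net hR hs] at e1
  rw [cutCap_net_source] at e2
  have e3 : ∑ b ∈ range n, min ℓ (d b) = #U * ℓ := by
    rw [sum_congr rfl fun b hb => hmin b (mem_range.1 hb), ← sum_filter, sum_const, smul_eq_mul,
      filter_mem_eq_inter, inter_eq_right.2 hU]
  have e4 : ∑ b ∈ range n \ R, min ℓ (d b) = #(U \ R) * ℓ := by
    rw [sum_congr rfl fun b hb => hmin b (mem_range.1 (mem_sdiff.1 hb).1), ← sum_filter, sum_const,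
      smul_eq_mul]
    congr 2
    ext b
    simp only [mem_filter, mem_sdiff, mem_range]
    exact ⟨fun h => ⟨h.2, h.1.2⟩, fun h => ⟨⟨mem_range.1 (hU h.1), h.2⟩, h.1⟩⟩
  have e5 : #(U ∩ R) + #(U \ R) = #U := card_inter_add_card_sdiff U R
  have e6 := le_cutCap_source (r := r) hb
  rw [e4] at e1
  rw [e3, ← e5, add_mul] at e2
  rw [mul_comm]
  push_cast at e1 e2
  zify at e6 hrb ⊢
  have : (0 : ℤ) < r (2 * n) b := by positivity
  linarith

/-- There is no capacity between the source and such a node in either direction, so antisymmetry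
forces the net amount to vanish. -/
theorem Pushes.source_eq_zero {r : ℕ → ℕ → ℕ} {x : ℤ}
    (hP : Pushes (2 * n + 1) (2 * n) (n + t) (net n t B adj c d) r x) {b : ℕ} (hb : n ≤ b)
    (hb' : b < 2 * n + 1) : r (2 * n) b = 0 := by
  obtain ⟨Δ, hΔ, h⟩ := hP
  have h1 := h (2 * n) (by omega) b hb'
  have h2 := h b hb' (2 * n) (by omega)
  have h3 := hΔ.antisymm b (2 * n)
  rw [net_source, if_neg (by omega)] at h1
  have h4 : net n t B adj c d b (2 * n) = 0 := by
    rcases Nat.lt_succ_iff_lt_or_eq.1 hb' with h | rfl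
    · obtain ⟨v, rfl⟩ := Nat.exists_eq_add_of_le hb
      rw [net_out (by omega), if_neg (by omega)]
    · rw [net_source, if_neg (by omega)]
  rw [h4] at h2
  omega

/-- A flow that uses up all source arcs has the largest possible value; any flow that saturates a
cut has the same value and uses them up too. Hence the flow for a level known to be possible can be
computed afresh. -/
theorem CanSend.eq_zero_of_saturated (ht : t < n) {ℓ : ℕ} (hA : CanSend n t B adj c d U ℓ)
    {r : ℕ → ℕ → ℕ} {x : ℤ}
    (hP : Pushes (2 * n + 1) (2 * n) (n + t) (net n t B adj c fun b => min ℓ (d b)) r x)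
    (hr : Saturated (2 * n + 1) (2 * n) (n + t) r) : ∀ b < n, r (2 * n) b = 0 := by
  obtain ⟨-, r', x', hP', hr'⟩ := hA
  obtain ⟨R, hR, hs, hz, hcut⟩ := hr
  have e1 := hP.cutCap hR hs hz
  have e2 := hP.cutCap (R := {2 * n}) (by simp) (by simp) (by simp; omega)
  have e3 := hP'.cutCap hR hs hz
  have e4 := hP'.cutCap (R := {2 * n}) (by simp) (by simp) (by simp; omega)
  have e5 : cutCap (2 * n + 1) r' {2 * n} = 0 := by
    unfold cutCap
    rw [sum_singleton]
    refine sum_eq_zero fun b hb => ?_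
    have hb := mem_range.1 (mem_sdiff.1 hb).1
    by_cases h : b < n
    · exact hr' b h
    · exact Pushes.source_eq_zero hP' (by omega) hb
  intro b hb
  have e6 := le_cutCap_source (r := r) hb
  omega

/-- A flow that gives `ℓ` to all nodes of `U` and a subsequent maximum flow in the residual network
in which nothing is sent back to the source add up to a maximum flow. -/
theorem exists_netFlow (ht : t < n) {ℓ : ℕ} (hℓ : ∀ b ∈ U, ℓ ≤ d b) {r₁ r₁' r₂ : ℕ → ℕ → ℕ}
    {x₁ x₂ : ℤ}
    (hP₁ : Pushes (2 * n + 1) (2 * n) (n + t) (net n t B adj c fun b => min ℓ (d b)) r₁ x₁)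
    (h0 : ∀ b < n, r₁ (2 * n) b = 0) (hsrc : ∀ b < n, r₁' (2 * n) b = d b - ℓ)
    (hback : ∀ b < n, r₁' b (2 * n) = 0)
    (hrest : ∀ a < 2 * n + 1, ∀ b < 2 * n + 1, ¬ (a = 2 * n ∧ b < n) → ¬ (b = 2 * n ∧ a < n) →
      r₁' a b = r₁ a b)
    (hP₂ : Pushes (2 * n + 1) (2 * n) (n + t) r₁' r₂ x₂)
    (hr₂ : Saturated (2 * n + 1) (2 * n) (n + t) r₂) :
    (∃ φ x, IsNetFlow (2 * n + 1) (2 * n) (n + t) φ x ∧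
      (∀ a < 2 * n + 1, ∀ b < 2 * n + 1, φ a b ≤ net n t B adj c d a b) ∧
      ∀ b < n, φ (2 * n) b = (d b - r₂ (2 * n) b : ℕ)) ∧
    (∀ b < n, b ∈ U → ℓ ≤ d b - r₂ (2 * n) b) ∧
    ∃ R ⊆ range (2 * n + 1), 2 * n ∈ R ∧ n + t ∉ R ∧
      cutCap (2 * n + 1) (net n t B adj c d) R = ∑ b ∈ range n, (d b - r₂ (2 * n) b) := by
  have hP₁' := hP₁
  obtain ⟨Δ₁, hΔ₁, h₁⟩ := hP₁
  obtain ⟨Δ₂, hΔ₂, h₂⟩ := hP₂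
  obtain ⟨R, hR, hs, hz, hcut⟩ := hr₂
  -- With no residual capacity back to the source, the second stage can only increase the flow on a
  -- source arc.
  have hr₂le : ∀ b < n, r₂ (2 * n) b ≤ d b - ℓ := by
    intro b hb
    have e1 := h₂ (2 * n) (by omega) b (by omega)
    have e2 := h₂ b (by omega) (2 * n) (by omega)
    have e3 := hΔ₂.antisymm b (2 * n)
    rw [hsrc b hb] at e1
    rw [hback b hb] at e2
    omega
  have hφs : ∀ b < n, Δ₁ (2 * n) b + Δ₂ (2 * n) b = (d b - r₂ (2 * n) b : ℕ) := by
    intro b hb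
    have e1 := h₂ (2 * n) (by omega) b (by omega)
    have e2 := h₁ (2 * n) (by omega) b (by omega)
    have e3 := hr₂le b hb
    rw [hsrc b hb] at e1
    rw [net_source, if_pos hb, h0 b hb] at e2
    omega
  -- Arcs into the source are left out, since their residual capacities have been erased. This is
  -- harmless: no such arc leaves a cut that contains the source.
  have hφ : ∀ a < 2 * n + 1, ∀ b < 2 * n + 1, ¬ (b = 2 * n ∧ a < n) →
      (net n t B adj c d a b : ℤ) = Δ₁ a b + Δ₂ a b + r₂ a b := by
    intro a ha b hb hab
    by_cases hab' : a = 2 * n ∧ b < n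
    · obtain ⟨rfl, hbn⟩ := hab'
      have := hr₂le b hbn
      rw [hφs b hbn, net_source, if_pos hbn]
      omega
    · have e1 := h₂ a ha b hb
      have e2 := h₁ a ha b hb
      rw [hrest a ha b hb hab' hab] at e1
      have e3 : net n t B adj c (fun b => min ℓ (d b)) a b = net n t B adj c d a b := by
        unfold net
        split_ifs <;> first | rfl | (exfalso; omega)
      rw [e3] at e2
      omega
  have hadd := hΔ₁.add hΔ₂
  have hle : ∀ a < 2 * n + 1, ∀ b < 2 * n + 1, Δ₁ a b + Δ₂ a b ≤ net n t B adj c d a b := by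
    intro a ha b hb
    by_cases hab : b = 2 * n ∧ a < n
    · obtain ⟨rfl, han⟩ := hab
      have := hadd.antisymm a (2 * n)
      have := hφs a han
      omega
    · have := hφ a ha b hb hab
      omega
  refine ⟨⟨_, _, hadd, hle, hφs⟩, fun b hb hbU => ?_, R, hR, hs, hz, ?_⟩
  · have e1 := hr₂le b hb
    have e2 := hℓ b hbU
    omega
  · have e1 : (cutCap (2 * n + 1) (net n t B adj c d) R : ℤ) =
        ∑ a ∈ R, ∑ b ∈ range (2 * n + 1) \ R, (Δ₁ a b + Δ₂ a b) + cutCap (2 * n + 1) r₂ R := by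
      unfold cutCap
      push_cast
      rw [← sum_add_distrib]
      refine sum_congr rfl fun a ha => ?_
      rw [← sum_add_distrib]
      refine sum_congr rfl fun b hb => hφ a (mem_range.1 (hR ha)) b
        (mem_range.1 (mem_sdiff.1 hb).1) ?_
      rintro ⟨rfl, -⟩
      exact (mem_sdiff.1 hb).2 hs
    have e2 := hadd.excess (2 * n) (by omega)
    rw [if_pos rfl, if_neg (by omega), sub_zero] at e2
    have e3 : ∑ b ∈ range (2 * n + 1), (Δ₁ (2 * n) b + Δ₂ (2 * n) b) =
        ∑ b ∈ range n, (Δ₁ (2 * n) b + Δ₂ (2 * n) b) := by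
      refine (sum_subset (range_subset_range.2 (by omega)) fun b hb hbn => ?_).symm
      have hb := mem_range.1 hb
      have hbn : n ≤ b := by simpa using hbn
      have e4 := hle (2 * n) (by omega) b hb
      have e5 := hle b hb (2 * n) (by omega)
      have e6 := hadd.antisymm b (2 * n)
      have e7 : net n t B adj c d b (2 * n) = 0 := by
        rcases Nat.lt_succ_iff_lt_or_eq.1 hb with h | rfl
        · obtain ⟨v, rfl⟩ := Nat.exists_eq_add_of_le hbn
          rw [net_out (by omega), if_neg (by omega)]
        · rw [net_source, if_neg (by omega)]
      rw [net_source, if_neg (by omega)] at e4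
      rw [e7] at e5
      omega
    rw [hadd.cut hR hs hz, hcut, ← e2, e3, sum_congr rfl fun b hb => hφs b (mem_range.1 hb)] at e1
    push_cast at e1
    exact_mod_cast e1

end
end MultiflowInstance

/-! ### Programs that find the sink and scale the data to integers. -/

namespace RAM
open Finset

/-- The distance of two numbers. -/
abbrev Expr.dist (e₁ e₂ : Expr) : Expr := .add (.sub e₁ e₂) (.sub e₂ e₁)

/-- The maximum of a number and `1`. -/
abbrev Expr.atLeastOne (e : Expr) : Expr := .add e (.sub (.const 1) e)

/-- Put into register `2` a node that is incident to all commodities. -/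
def findSink : Program :=
  .seq (.assign 2 (.const 0))
  (.seq (.assign 17 (.mul (.reg 0) (.reg 0)))
  (.seq (.assign 8 (.const 0))
  (.loop (.le (.add (.reg 8) (.const 1)) (.reg 17))
    (.seq (.assign 9 (.div (.reg 8) (.reg 0)))
    (.seq (.assign 10 (.sub (.reg 8) (.mul (.reg 9) (.reg 0))))
    (.cond (.mul (.mul (.le (.const 1) (.cell 4 (.reg 8))) (.le (.const 1) (.dist (.reg 9) (.reg 2))))
        (.le (.const 1) (.dist (.reg 10) (.reg 2))))
      (.seq (.assign 2 (.add (.reg 2) (.const 1))) (.assign 8 (.const 0)))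
      (.assign 8 (.add (.reg 8) (.const 1)))))))))

/-- A commodity avoiding the candidate rules it out but never rules out `t₀`, so the candidate moves
up and cannot pass `t₀`. It may stop earlier, at another common node. -/
theorem total_findSink {σ : State} {n t₀ : ℕ} (h0 : σ.reg 0 = n) (ht₀ : t₀ < n)
    (hsink : ∀ a < n, ∀ b < n, σ.arr 4 (a * n + b) ≠ 0 → a = t₀ ∨ b = t₀) :
    Total findSink σ fun τ k => k ≤ 200 * (n + 1) ^ 4 ∧ τ.reg 2 < n ∧
      ∀ a < n, ∀ b < n, σ.arr 4 (a * n + b) ≠ 0 → a = τ.reg 2 ∨ b = τ.reg 2 := by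
  have hsz := size_le_self n
  unfold findSink
  simp only [total_seq, total_assign, Expr.val, Expr.cost, setReg_reg, h0, if_false,
    OfNat.zero_ne_ofNat]
  -- Lexicographic variant: the distance to `t₀`, then the rest of the scan.
  refine (Total.loop (fun m τ => τ.reg 8 ≤ n * n ∧ τ.reg 2 ≤ t₀ ∧
    (∀ a < n, ∀ b < n, a * n + b < τ.reg 8 → σ.arr 4 (a * n + b) ≠ 0 →
      a = τ.reg 2 ∨ b = τ.reg 2) ∧
    (t₀ - τ.reg 2) * (n * n + 1) + (n * n - τ.reg 8) ≤ m)
    (n + 70) (m := t₀ * (n * n + 1) + n * n) ?_ ?_).mono ?_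
  · simp
  · rintro m τ hFτ ⟨hle, ht, hC, hm⟩
    have f0 : τ.reg 0 = n := by rw [hFτ.reg 0 (by decide)]; simpa using h0
    have f17 : τ.reg 17 = n * n := by rw [hFτ.reg 17 (by decide)]; simp
    have b4 : τ.arr 4 = σ.arr 4 := by rw [hFτ.arr 4 (by decide)]; rfl
    refine ⟨by simp [Expr.cost], fun hv => ?_⟩
    have hlt : τ.reg 8 < n * n := by simpa [Expr.val, f17, Nat.succ_le_iff] using hv
    have hN : 0 < n := by omega
    obtain ⟨a, b, ha, hb, hab⟩ : ∃ a b, a < n ∧ b < n ∧ τ.reg 8 = a * n + b :=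
      ⟨τ.reg 8 / n, τ.reg 8 % n, Nat.div_lt_of_lt_mul hlt, Nat.mod_lt _ hN,
        (Nat.div_add_mod' _ _).symm⟩
    have hdiv : (a * n + b) / n = a := by
      rw [mul_comm, Nat.mul_add_div hN, Nat.div_eq_of_lt hb, add_zero]
    simp only [total_seq, total_assign, total_cond, Expr.val, Expr.cost, setReg_reg,
      setReg_arr, f0, b4, hab, hdiv, Nat.add_sub_cancel_left,
      if_true, if_false, Nat.reduceEqDiff, OfNat.zero_ne_ofNat]
    have hs1 := size_ite_le (1 ≤ a - τ.reg 2 + (τ.reg 2 - a))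
    have hs2 := size_ite_le (1 ≤ b - τ.reg 2 + (τ.reg 2 - b))
    have hab' := index_lt ha hb
    refine ⟨fun hc => ⟨by omega, ?_⟩, fun hc => ⟨by omega, ?_⟩⟩
    · simp only [mul_ne_zero_iff, ne_eq, ite_eq_right_iff, one_ne_zero, imp_false, not_not] at hc
      obtain ⟨⟨h4, h5⟩, h6⟩ := hc
      have h7 := hsink a ha b hb (by omega)
      have h8 : τ.reg 2 + 1 ≤ t₀ := by omega
      refine ⟨_, ?_, by omega, h8, by simp, le_rfl⟩
      obtain ⟨d, rfl⟩ := Nat.exists_eq_add_of_le h8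
      have h9 : τ.reg 2 + 1 + d - τ.reg 2 = d + 1 := by omega
      have h10 : τ.reg 2 + 1 + d - (τ.reg 2 + 1) = d := by omega
      rw [h9, add_mul] at hm
      rw [h10]
      omega
    · refine ⟨_, ?_, hab', ht, fun a' ha' b' hb' hlt' h4 => ?_, le_rfl⟩
      · omega
      · rcases Nat.lt_succ_iff_lt_or_eq.1 hlt' with h | h
        · exact hC a' ha' b' hb' (by omega) h4
        · obtain ⟨rfl, rfl⟩ := (index_inj hb' hb).1 h
          by_contra hr
          have c1 : 1 ≤ σ.arr 4 (a' * n + b') := by omega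
          have c2 : 1 ≤ a' - τ.reg 2 + (τ.reg 2 - a') := by omega
          have c3 : 1 ≤ b' - τ.reg 2 + (τ.reg 2 - b') := by omega
          simp [c1, c2, c3] at hc
  · rintro τ k hFτ ⟨hk, ⟨m', hm', hle, ht, hC, -⟩, hz⟩
    have f17 : τ.reg 17 = n * n := by rw [hFτ.reg 17 (by decide)]; simp
    have hidx : n * n ≤ τ.reg 8 := by
      simp only [Expr.val, f17] at hz
      split_ifs at hz
      omega
    refine ⟨?_, by omega, fun a ha b hb => hC a ha b hb ((index_lt ha hb).trans_le hidx)⟩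
    have h1 : t₀ * (n * n + 1) ≤ n * (n * n + 1) := Nat.mul_le_mul_right _ ht₀.le
    have h2 : (t₀ * (n * n + 1) + n * n + 1) * (2 * (n + 70) + 1) ≤
      (n * (n * n + 1) + n * n + 1) * (2 * (n + 70) + 1) := by gcongr
    have : (n * (n * n + 1) + n * n + 1) * (2 * (n + 70) + 1) + n + 20
      ≤ 200 * (n + 1) ^ 4 := by
      ring_nf; nlinarith [Nat.zero_le (n^2)]
    omega

/-- The scalars `N`, `s`, `z` and `N * N`. -/
def setScalars : Program :=
  .seq (.assign 1 (.add (.add (.reg 0) (.reg 0)) (.const 1)))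
  (.seq (.assign 14 (.add (.reg 0) (.reg 0)))
  (.seq (.assign 15 (.add (.reg 0) (.reg 2)))
  (.assign 18 (.mul (.reg 1) (.reg 1)))))

theorem total_setScalars {σ : State} {n t : ℕ} (h0 : σ.reg 0 = n) (h2 : σ.reg 2 = t) :
    Total setScalars σ fun τ k => k ≤ 2 * n + 30 ∧ τ.reg 1 = 2 * n + 1 ∧ τ.reg 14 = 2 * n ∧
      τ.reg 15 = n + t ∧ τ.reg 18 = (2 * n + 1) * (2 * n + 1) := by
  have := size_le_self (n + n + 1)
  unfold setScalars
  simp only [total_seq, total_assign, Expr.val, Expr.cost, setReg_reg, h0, h2, if_false,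
    OfNat.zero_ne_ofNat, Nat.reduceEqDiff, if_true, OfNat.ofNat_ne_one, zero_ne_one]
  refine ⟨by omega, by omega, by omega, trivial, ?_⟩
  rw [two_mul]

/-- The scaling factor. -/
def setFactor : Program :=
  .seq (.assign 3 (.const 1))
  (.for 8 0 (.seq (.assign 17 (.add (.mul (.reg 8) (.reg 0)) (.reg 2)))
    (.assign 3 (.mul (.mul (.mul (.reg 3) (.add (.reg 8) (.const 1)))
      (.atLeastOne (.cell 1 (.reg 8)))) (.atLeastOne (.cell 4 (.reg 17)))))))

theorem size_atLeastOne_le {x M : ℕ} (h : x < 2 ^ M) : Nat.size (x + (1 - x)) ≤ M + 1 := by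
  rw [Nat.size_le, pow_succ]
  have : 0 < 2 ^ M := by positivity
  omega

/-- The long product is always the first factor, whose length is not charged; the second factors
have at most `n` or `M + 1` bits. The factors `i + 1` contribute `n!`, and replacing `0` by `1`
skips infinite capacities and absent commodities. -/
theorem total_setFactor {σ : State} {n t M : ℕ} (h0 : σ.reg 0 = n) (h2 : σ.reg 2 = t)
    (hM : ∀ a i, (a = 1 ∨ a = 4) → σ.arr a i < 2 ^ M) :
    Total setFactor σ fun τ k => k ≤ 200 * (n + 1) * (n + M + 1) ∧
      τ.reg 3 = ∏ i ∈ range n, (i + 1) * (σ.arr 1 i + (1 - σ.arr 1 i)) *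
        (σ.arr 4 (i * n + t) + (1 - σ.arr 4 (i * n + t))) := by
  have hsz := size_le_self n
  unfold setFactor
  rw [total_seq, total_assign]
  refine (total_for (fun j τ => τ.reg 3 = ∏ i ∈ range j,
    (i + 1) * (σ.arr 1 i + (1 - σ.arr 1 i)) *
        (σ.arr 4 (i * n + t) + (1 - σ.arr 4 (i * n + t)))) (2 * n + 2 * M + 70)
    (by decide) (by decide) (by decide) (by simp [Expr.val]) ?_).mono ?_
  · rintro j hj τ hF hj8 hI
    have f0 : τ.reg 0 = n := by rw [hF.reg 0 (by decide)]; simpa using h0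
    have f2 : τ.reg 2 = t := by rw [hF.reg 2 (by decide)]; simpa using h2
    have b1 : τ.arr 1 = σ.arr 1 := by rw [hF.arr 1 (by decide)]; rfl
    have b4 : τ.arr 4 = σ.arr 4 := by rw [hF.arr 4 (by decide)]; rfl
    simp only [setReg_reg, h0, if_false, OfNat.zero_ne_ofNat] at hj
    have s1 := size_le_self (j + 1)
    have s2 := size_atLeastOne_le (hM 1 j (.inl rfl))
    have s3 := size_atLeastOne_le (hM 4 (j * n + t) (.inr rfl))
    simp only [total_seq, total_assign, Expr.val, Expr.cost, setReg_reg, setReg_arr, f0, f2, b1, b4,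
      hj8, hI, if_true, if_false, Nat.reduceEqDiff]
    refine ⟨by omega, ?_⟩
    rw [prod_range_succ]
    ring
  · rintro τ k hF ⟨hk, hI⟩
    simp only [setReg_reg, h0, if_false, OfNat.zero_ne_ofNat] at hk hI
    refine ⟨?_, hI⟩
    simp only [Expr.cost]
    nlinarith [Nat.zero_le (n * n), Nat.zero_le (n * M)]

/-- The scaled demands, in array `10`, and their sum. -/
def setDemands : Program :=
  .seq (.assign 4 (.const 0))
  (.for 8 0 (.seq (.assign 17 (.add (.mul (.reg 8) (.reg 0)) (.reg 2)))
    (.seq (.store 10 (.reg 8) (.mul (.div (.reg 3) (.atLeastOne (.cell 4 (.reg 17))))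
      (.cell 3 (.reg 17))))
    (.assign 4 (.add (.reg 4) (.cell 10 (.reg 8)))))))

theorem total_setDemands {σ : State} {n t M D : ℕ} (h0 : σ.reg 0 = n) (h2 : σ.reg 2 = t)
    (h3 : σ.reg 3 = D) (hM : ∀ i, σ.arr 3 i < 2 ^ M) :
    Total setDemands σ fun τ k => k ≤ 200 * (n + 1) * (n + M + 1) ∧
      (∀ i < n, τ.arr 10 i =
        D / (σ.arr 4 (i * n + t) + (1 - σ.arr 4 (i * n + t))) * σ.arr 3 (i * n + t)) ∧
      τ.reg 4 = ∑ i ∈ range n, τ.arr 10 i := by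
  have hsz := size_le_self n
  unfold setDemands
  rw [total_seq, total_assign]
  refine (total_for (fun j τ => (∀ i < j, τ.arr 10 i =
        D / (σ.arr 4 (i * n + t) + (1 - σ.arr 4 (i * n + t))) * σ.arr 3 (i * n + t)) ∧
      τ.reg 4 = ∑ i ∈ range j, τ.arr 10 i) (2 * n + 2 * M + 70)
    (by decide) (by decide) (by decide) (by simp [Expr.val]) ?_).mono ?_
  · rintro j hj τ hF hj8 ⟨hI, hI'⟩
    have f0 : τ.reg 0 = n := by rw [hF.reg 0 (by decide)]; simpa using h0
    have f2 : τ.reg 2 = t := by rw [hF.reg 2 (by decide)]; simpa using h2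
    have f3 : τ.reg 3 = D := by rw [hF.reg 3 (by decide)]; simpa using h3
    have b3 : τ.arr 3 = σ.arr 3 := by rw [hF.arr 3 (by decide)]; rfl
    have b4 : τ.arr 4 = σ.arr 4 := by rw [hF.arr 4 (by decide)]; rfl
    have s1 : Nat.size (σ.arr 3 (j * n + t)) ≤ M := Nat.size_le.2 (hM _)
    simp only [total_seq, total_assign, total_store, Expr.val, Expr.cost, setReg_reg, setReg_arr,
      setCell_reg, setCell_arr_self, f0, f2, f3, b3, b4, hj8, if_true, if_false, Nat.reduceEqDiff]
    refine ⟨by omega, fun i hi => ?_, ?_⟩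
    · split_ifs with h
      · rw [h]
      · exact hI i (by omega)
    · rw [sum_range_succ, if_pos rfl, hI']
      congr 1
      exact sum_congr rfl fun i hi => (if_neg (mem_range.1 hi).ne).symm
  · rintro τ k hF ⟨hk, hI⟩
    simp only [setReg_reg, h0, if_false, OfNat.zero_ne_ofNat] at hk hI
    refine ⟨?_, hI⟩
    simp only [Expr.cost]
    nlinarith [Nat.zero_le (n * n), Nat.zero_le (n * M)]

/-- The scaled capacities, in array `9`. -/
def setCapacities : Program :=
  .for 8 0 (.cond (.cell 1 (.reg 8))
    (.store 9 (.reg 8) (.mul (.div (.reg 3) (.cell 1 (.reg 8))) (.cell 0 (.reg 8))))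
    (.store 9 (.reg 8) (.reg 4)))

/-- A denominator `0` marks an infinite capacity. The total demand is as good as infinity, since no
flow exceeds it. -/
theorem total_setCapacities {σ : State} {n M D B : ℕ} (h0 : σ.reg 0 = n)
    (h3 : σ.reg 3 = D) (h4 : σ.reg 4 = B) (hM : ∀ i, σ.arr 0 i < 2 ^ M) :
    Total setCapacities σ fun τ k => k ≤ 200 * (n + 1) * (n + M + 1) ∧
      ∀ i < n, τ.arr 9 i = if σ.arr 1 i = 0 then B else D / σ.arr 1 i * σ.arr 0 i := by
  unfold setCapacities
  refine (total_for (fun j τ => ∀ i < j, τ.arr 9 i =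
    if σ.arr 1 i = 0 then B else D / σ.arr 1 i * σ.arr 0 i) (M + 30)
    (by decide) (by decide) (by decide) (by simp) ?_).mono ?_
  · rintro j hj τ hF hj8 hI
    have f3 : τ.reg 3 = D := by rw [hF.reg 3 (by decide)]; simpa using h3
    have f4 : τ.reg 4 = B := by rw [hF.reg 4 (by decide)]; simpa using h4
    have b0 : τ.arr 0 = σ.arr 0 := by rw [hF.arr 0 (by decide)]
    have b1 : τ.arr 1 = σ.arr 1 := by rw [hF.arr 1 (by decide)]
    have s1 : Nat.size (σ.arr 0 j) ≤ M := Nat.size_le.2 (hM _)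
    simp only [total_cond, total_store, Expr.val, Expr.cost, setReg_arr,
      setCell_arr_self, f3, f4, b0, b1, hj8]
    refine ⟨fun h => ⟨by omega, fun i hi => ?_⟩, fun h => ⟨by omega, fun i hi => ?_⟩⟩
    · split_ifs with h1 h2 h2
      · subst h1; exact absurd h2 h
      · rw [h1]
      · rw [hI i (by omega), if_pos h2]
      · rw [hI i (by omega), if_neg h2]
    · split_ifs with h1 h2 h2
      · rfl
      · subst h1; exact absurd h h2
      · rw [hI i (by omega), if_pos h2]
      · rw [hI i (by omega), if_neg h2]
  · rintro τ k hF ⟨hk, hI⟩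
    rw [h0] at hk hI
    refine ⟨?_, hI⟩
    nlinarith [Nat.zero_le (n * n), Nat.zero_le (n * M)]

/-- A power of `2` that exceeds register `4`. -/
def setPower : Program :=
  .seq (.assign 13 (.const 1))
  (.loop (.le (.reg 13) (.reg 4)) (.assign 13 (.add (.reg 13) (.reg 13))))

theorem total_setPower {σ : State} {B L : ℕ} (h4 : σ.reg 4 = B) (hL : B < 2 ^ L) :
    Total setPower σ fun τ k => k ≤ 30 * (L + 1) ∧ ∃ K ≤ L, τ.reg 13 = 2 ^ K ∧ B < 2 ^ K := by
  unfold setPower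
  rw [total_seq, total_assign]
  refine (Total.loop (fun m τ => ∃ j, τ.reg 13 = 2 ^ j ∧ j + m = L) 5 (m := L)
    ⟨0, by simp [Expr.val], by simp⟩ ?_).mono ?_
  · rintro m τ hF ⟨j, hj, hm⟩
    have f4 : τ.reg 4 = B := by rw [hF.reg 4 (by decide)]; simpa using h4
    refine ⟨by simp [Expr.cost], fun h => ?_⟩
    have h1 : 2 ^ j ≤ B := by
      simp only [Expr.val, hj, f4] at h
      by_contra h'
      simp [h'] at h
    have h2 : j < L := (Nat.pow_lt_pow_iff_right (by norm_num : 1 < 2)).1 (h1.trans_lt hL)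
    simp only [total_assign, Expr.cost, Expr.val, hj, setReg_reg, if_true]
    exact ⟨by omega, m - 1, by omega, j + 1, by ring, by omega⟩
  · rintro τ k hF ⟨hk, ⟨m, hm, j, hj, hjL⟩, hz⟩
    have f4 : τ.reg 4 = B := by rw [hF.reg 4 (by decide)]; simpa using h4
    refine ⟨by simp only [Expr.cost]; omega, j, by omega, hj, ?_⟩
    simp only [Expr.val, hj, f4] at hz
    by_contra h'
    simp [not_lt.1 h'] at hz

end RAM

/-! ### Writing the network and testing a level. -/

namespace RAM
open Finset MultiflowInstance

/-- Write the network, in which the source can send the amount in register `5` to every node whose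
demand is at least as large, into array `7`. -/
def buildNet : Program :=
  .for 8 18 (.seq (.assign 9 (.div (.reg 8) (.reg 1)))
    (.seq (.assign 10 (.sub (.reg 8) (.mul (.reg 9) (.reg 1))))
    (.cond (.le (.add (.reg 9) (.const 1)) (.reg 0))
      (.cond (.dist (.reg 10) (.add (.reg 9) (.reg 0)))
        (.store 7 (.reg 8) (.const 0)) (.store 7 (.reg 8) (.cell 9 (.reg 9))))
      (.cond (.le (.add (.reg 9) (.const 1)) (.reg 14))
        (.cond (.mul (.mul (.le (.add (.reg 10) (.const 1)) (.reg 0))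
            (.le (.const 1) (.dist (.reg 9) (.reg 15))))
            (.le (.const 1) (.cell 2 (.add (.mul (.sub (.reg 9) (.reg 0)) (.reg 0)) (.reg 10)))))
          (.store 7 (.reg 8) (.reg 4)) (.store 7 (.reg 8) (.const 0)))
        (.cond (.le (.add (.reg 10) (.const 1)) (.reg 0))
          (.store 7 (.reg 8) (.sub (.reg 5) (.sub (.reg 5) (.cell 10 (.reg 10)))))
          (.store 7 (.reg 8) (.const 0)))))))

/-- The data that the programs below work on: the number of nodes, the sink, the number of nodes of
the network and its square, source and sink of the network, the total demand and a larger power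
of `2`. -/
structure Params (n t B K : ℕ) (σ : State) : Prop where
  r0 : σ.reg 0 = n
  r1 : σ.reg 1 = 2 * n + 1
  r2 : σ.reg 2 = t
  r4 : σ.reg 4 = B
  r13 : σ.reg 13 = 2 ^ K
  r14 : σ.reg 14 = 2 * n
  r15 : σ.reg 15 = n + t
  r18 : σ.reg 18 = (2 * n + 1) * (2 * n + 1)

theorem Params.of_frame {n t B K : ℕ} {σ τ : State} {p : Program} (h : Params n t B K σ)
    (hF : Frame p σ τ) (hp : ∀ r ∈ [0, 1, 2, 4, 13, 14, 15, 18], r ∉ p.regs) :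
    Params n t B K τ := by
  simp only [List.mem_cons, List.not_mem_nil, or_false, forall_eq_or_imp, forall_eq] at hp
  obtain ⟨p0, p1, p2, p4, p13, p14, p15, p18⟩ := hp
  exact ⟨by rw [hF.reg _ p0, h.r0], by rw [hF.reg _ p1, h.r1], by rw [hF.reg _ p2, h.r2],
    by rw [hF.reg _ p4, h.r4], by rw [hF.reg _ p13, h.r13], by rw [hF.reg _ p14, h.r14],
    by rw [hF.reg _ p15, h.r15], by rw [hF.reg _ p18, h.r18]⟩

/-- The network with the capacities and demands in the memory. -/
def stateNet (n t B : ℕ) (σ : State) (d : ℕ → ℕ) : ℕ → ℕ → ℕ :=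
  net n t B (fun a b => σ.arr 2 (a * n + b)) (σ.arr 9) d

theorem total_buildNet {σ : State} {n t B K : ℕ} (h : Params n t B K σ) :
    Total buildNet σ fun τ k => k ≤ 1000 * (n + 1) ^ 3 ∧
      ∀ a < 2 * n + 1, ∀ b < 2 * n + 1,
        res (2 * n + 1) τ a b = stateNet n t B σ (fun i => min (σ.reg 5) (σ.arr 10 i)) a b := by
  have hsz := size_le_self n
  have hsz' := size_le_self (2 * n + 1)
  unfold buildNet
  refine (total_for (fun j τ => ∀ a < 2 * n + 1, ∀ b < 2 * n + 1, a * (2 * n + 1) + b < j →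
    res (2 * n + 1) τ a b = stateNet n t B σ (fun i => min (σ.reg 5) (σ.arr 10 i)) a b)
    (3 * n + 100) (by decide) (by decide) (by decide) (by simp) ?_).mono ?_
  · rintro j hj τ hF hj8 hI
    have hp := h.of_frame hF (by decide)
    have f5 : τ.reg 5 = σ.reg 5 := hF.reg 5 (by decide)
    have b2 : τ.arr 2 = σ.arr 2 := hF.arr 2 (by decide)
    have b9 : τ.arr 9 = σ.arr 9 := hF.arr 9 (by decide)
    have b10 : τ.arr 10 = σ.arr 10 := hF.arr 10 (by decide)
    rw [h.r18] at hj
    obtain ⟨a, b, ha, hb, hab⟩ : ∃ a b, a < 2 * n + 1 ∧ b < 2 * n + 1 ∧ j = a * (2 * n + 1) + b :=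
      ⟨j / (2 * n + 1), j % (2 * n + 1), Nat.div_lt_of_lt_mul hj, Nat.mod_lt _ (by omega),
        (Nat.div_add_mod' _ _).symm⟩
    have hdiv : (a * (2 * n + 1) + b) / (2 * n + 1) = a := by
      rw [mul_comm, Nat.mul_add_div (by omega), Nat.div_eq_of_lt hb, add_zero]
    -- All branches write only the current cell, so the remaining cells are settled once for all of
    -- them.
    have fin : ∀ υ : State, (∀ i, υ.arr 7 i = if i = a * (2 * n + 1) + b then
        stateNet n t B σ (fun i => min (σ.reg 5) (σ.arr 10 i)) a b else τ.arr 7 i) →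
        ∀ a' < 2 * n + 1, ∀ b' < 2 * n + 1, a' * (2 * n + 1) + b' < j + 1 →
          υ.arr 7 (a' * (2 * n + 1) + b') =
            stateNet n t B σ (fun i => min (σ.reg 5) (σ.arr 10 i)) a' b' := by
      intro υ hυ a' ha' b' hb' hlt
      rw [hυ]
      split_ifs with h
      · obtain ⟨rfl, rfl⟩ := (index_inj hb' hb).1 h
        rfl
      · exact hI a' ha' b' hb' (by omega)
    have s1 := size_ite_le (1 ≤ a - (n + t) + (n + t - a))
    have s2 := size_ite_le (1 ≤ σ.arr 2 ((a - n) * n + b))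
    simp only [total_seq, total_assign, total_cond, total_store, Expr.val, Expr.cost, setReg_reg,
      setReg_arr, hp.r0, hp.r1, hp.r4, hp.r14, hp.r15, f5, b2, b9, b10, hj8, hab, hdiv,
      Nat.add_sub_cancel_left, if_true, if_false, Nat.reduceEqDiff, OfNat.zero_ne_ofNat,
      OfNat.one_ne_ofNat]
    rw [← hab]
    refine ⟨fun c1 => ⟨fun c2 => ⟨by omega, ?_⟩, fun c2 => ⟨by omega, ?_⟩⟩,
      fun c1 => ⟨fun c2 => ⟨fun c3 => ⟨by omega, ?_⟩, fun c3 => ⟨by omega, ?_⟩⟩,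
        fun c2 => ⟨fun c3 => ⟨by omega, ?_⟩, fun c3 => ⟨by omega, ?_⟩⟩⟩⟩
    all_goals
      refine fin _ fun i => ?_
      rw [setReg_arr, setCell_arr_self, hab]
      refine if_congr Iff.rfl ?_ rfl
      simp only [stateNet, net]
    · have h1 : a < n := by by_contra h'; simp [h'] at c1
      rw [if_pos h1, if_neg (by omega)]
    · have h1 : a < n := by by_contra h'; simp [h'] at c1
      rw [if_pos h1, if_pos (by omega)]
    · have h1 : ¬ a < n := by intro h'; simp [h'] at c1
      have h2 : a < 2 * n := by by_contra h'; simp [h'] at c2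
      simp only [mul_ne_zero_iff, ne_eq, ite_eq_right_iff, one_ne_zero, imp_false, not_not] at c3
      rw [if_neg h1, if_pos h2, if_pos ⟨by omega, by omega, by omega⟩]
    · have h1 : ¬ a < n := by intro h'; simp [h'] at c1
      have h2 : a < 2 * n := by by_contra h'; simp [h'] at c2
      rw [if_neg h1, if_pos h2, if_neg]
      rintro ⟨h3, h4, h5⟩
      have c1 : 1 ≤ σ.arr 2 ((a - n) * n + b) := by omega
      have c2 : 1 ≤ a - (n + t) + (n + t - a) := by omega
      simp [c1, c2, h3] at c3
    · have h1 : ¬ a < n := by intro h'; simp [h'] at c1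
      have h2 : ¬ a < 2 * n := by intro h'; simp [h'] at c2
      have h3 : b < n := by by_contra h'; simp [h'] at c3
      rw [if_neg h1, if_neg h2, if_pos h3]
      -- With truncated subtraction, `x - (x - y)` is the minimum of `x` and `y`.
      omega
    · have h1 : ¬ a < n := by intro h'; simp [h'] at c1
      have h2 : ¬ a < 2 * n := by intro h'; simp [h'] at c2
      have h3 : ¬ b < n := by intro h'; simp [h'] at c3
      rw [if_neg h1, if_neg h2, if_neg h3]
  · rintro τ k hF ⟨hk, hI⟩
    rw [h.r18] at hk hI
    refine ⟨?_, fun a ha b hb => hI a ha b hb (index_lt ha hb)⟩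
    have : ((2 * n + 1) * (2 * n + 1) + 1) * (2 * (3 * n + 100) + 25) ≤ 1000 * (n + 1) ^ 3 := by
      ring_nf; nlinarith [Nat.zero_le (n^2)]
    omega

/-- Register `16` becomes `0` if all commodities send the amount in register `5`. -/
def checkSent : Program :=
  .seq (.assign 16 (.const 0))
  (.for 8 0 (.seq (.assign 17 (.add (.mul (.reg 8) (.reg 0)) (.reg 2)))
    (.assign 16 (.add (.add (.reg 16) (.cell 7 (.add (.mul (.reg 14) (.reg 1)) (.reg 8))))
      (.mul (.sub (.reg 5) (.cell 10 (.reg 8))) (.le (.const 1) (.cell 4 (.reg 17))))))))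

/-- Register `16` is a sum of natural numbers, so it vanishes only if every source arc is used up
and the demand of no partner falls short. -/
theorem total_checkSent {σ : State} {n t B K : ℕ} (h : Params n t B K σ) :
    Total checkSent σ fun τ k => k ≤ 300 * (n + 1) ^ 2 ∧ (τ.reg 16 = 0 ↔
      ∀ b < n, res (2 * n + 1) σ (2 * n) b = 0 ∧
        (σ.arr 4 (b * n + t) ≠ 0 → σ.reg 5 ≤ σ.arr 10 b)) := by
  have hsz := size_le_self n
  have hsz' := size_le_self (2 * n + 1)
  unfold checkSent
  rw [total_seq, total_assign]
  refine (total_for (fun j τ => τ.reg 16 = 0 ↔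
      ∀ b < j, res (2 * n + 1) σ (2 * n) b = 0 ∧
        (σ.arr 4 (b * n + t) ≠ 0 → σ.reg 5 ≤ σ.arr 10 b)) (3 * n + 70)
    (by decide) (by decide) (by decide) (by simp [Expr.val]) ?_).mono ?_
  · rintro j hj τ hF hj8 hI
    have hp : Params n t B K τ := Params.of_frame
      (by constructor <;> simp [h.r0, h.r1, h.r2, h.r4, h.r13, h.r14, h.r15, h.r18]) hF (by decide)
    have f5 : τ.reg 5 = σ.reg 5 := by rw [hF.reg 5 (by decide)]; simp
    have b4 : τ.arr 4 = σ.arr 4 := hF.arr 4 (by decide)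
    have b7 : τ.arr 7 = σ.arr 7 := hF.arr 7 (by decide)
    have b10 : τ.arr 10 = σ.arr 10 := hF.arr 10 (by decide)
    have s1 := size_ite_le (1 ≤ σ.arr 4 (j * n + t))
    simp only [total_seq, total_assign, Expr.val, Expr.cost, setReg_reg,
      setReg_arr, hp.r0, hp.r1, hp.r2, hp.r14, f5, b4, b7, b10, hj8, if_true, if_false,
      Nat.reduceEqDiff, OfNat.one_ne_ofNat]
    refine ⟨by omega, ?_⟩
    rw [Nat.add_eq_zero_iff, Nat.add_eq_zero_iff, hI, Nat.mul_eq_zero, Nat.forall_lt_succ_right,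
      and_assoc]
    refine and_congr Iff.rfl (and_congr Iff.rfl ?_)
    by_cases h4 : σ.arr 4 (j * n + t) = 0
    · simp [h4]
    · simp [h4, Nat.one_le_iff_ne_zero, Nat.sub_eq_zero_iff_le]
  · rintro τ k hF ⟨hk, hI⟩
    simp only [setReg_reg, h.r0, if_false, OfNat.zero_ne_ofNat] at hk hI
    refine ⟨?_, hI⟩
    simp only [Expr.cost]
    nlinarith

end RAM

/-! ### Bisection for the best level. -/

namespace RAM
open Finset MultiflowInstance

theorem cutCap_congr {N : ℕ} {r r' : ℕ → ℕ → ℕ} (h : ∀ a < N, ∀ b < N, r a b = r' a b)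
    {R : Finset ℕ} (hR : R ⊆ range N) : cutCap N r R = cutCap N r' R :=
  sum_congr rfl fun a ha => sum_congr rfl fun b hb =>
    h a (mem_range.1 (hR ha)) b (mem_range.1 (mem_sdiff.1 hb).1)

theorem Pushes.congr_left {N s z : ℕ} {r r' r₁ : ℕ → ℕ → ℕ} {x : ℤ} (hP : Pushes N s z r r₁ x)
    (h : ∀ a < N, ∀ b < N, r a b = r' a b) : Pushes N s z r' r₁ x := by
  obtain ⟨Δ, h1, h2⟩ := hP
  exact ⟨Δ, h1, fun a ha b hb => by rw [← h a ha b hb, h2 a ha b hb]⟩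

theorem Params.total_maxflow {σ : State} {n t B K : ℕ} (h : Params n t B K σ) (ht : t < n)
    (hcut : cutCap (2 * n + 1) (res (2 * n + 1) σ) {2 * n} < 2 ^ K) :
    Total maxflow σ fun τ k => k ≤ 448000 * (n + 1) ^ 6 * (K + 1) ∧
      (∃ x, 0 ≤ x ∧ Pushes (2 * n + 1) (2 * n) (n + t) (res (2 * n + 1) σ) (res (2 * n + 1) τ) x) ∧
      Saturated (2 * n + 1) (2 * n) (n + t) (res (2 * n + 1) τ) := by
  refine (RAM.total_maxflow h.r1 h.r18 h.r14 h.r15 h.r13 (by omega) (by omega) (by omega)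
    hcut).mono fun τ k _ ⟨hk, h1⟩ => ⟨hk.trans (le_of_eq ?_), h1⟩
  have : 2 * n + 1 + 1 = 2 * (n + 1) := by ring
  rw [this]; ring

/-- A maximum flow in which every commodity sends at most the amount in register `5`. -/
def solve : Program := .seq buildNet maxflow

theorem total_solve {σ : State} {n t B K : ℕ} (h : Params n t B K σ) (ht : t < n)
    (hB : ∑ b ∈ range n, σ.arr 10 b = B) (hK : B < 2 ^ K) :
    Total solve σ fun τ k => k ≤ 449000 * (n + 1) ^ 6 * (K + 1) ∧
      (∃ x, Pushes (2 * n + 1) (2 * n) (n + t)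
        (stateNet n t B σ fun i => min (σ.reg 5) (σ.arr 10 i)) (res (2 * n + 1) τ) x) ∧
      Saturated (2 * n + 1) (2 * n) (n + t) (res (2 * n + 1) τ) := by
  unfold solve
  rw [total_seq]
  refine (total_buildNet h).mono fun τ k hF ⟨hk, hr⟩ => ?_
  have hp := h.of_frame hF (by decide)
  have hcut : cutCap (2 * n + 1) (res (2 * n + 1) τ) {2 * n} < 2 ^ K := by
    rw [cutCap_congr hr (by simp)]
    unfold stateNet
    rw [cutCap_net_source]
    exact lt_of_le_of_lt (sum_le_sum fun b _ => min_le_right _ _) (hB ▸ hK)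
  refine (hp.total_maxflow ht hcut).mono fun υ l _ ⟨hl, ⟨x, _, hP⟩, hS⟩ =>
    ⟨?_, ⟨x, Pushes.congr_left hP hr⟩, hS⟩
  have h1 : (n + 1) ^ 3 ≤ (n + 1) ^ 6 := Nat.pow_le_pow_right (by omega) (by omega)
  have h2 : (n + 1) ^ 6 * 1 ≤ (n + 1) ^ 6 * (K + 1) := Nat.mul_le_mul_left _ (by omega)
  nlinarith

/-- Bitwise search for the largest amount that all commodities can send, in register `5`. -/
def setLevel : Program :=
  .seq (.assign 5 (.const 0))
  (.seq (.assign 6 (.reg 13))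
  (.loop (.le (.const 2) (.reg 6))
    (.seq (.assign 6 (.div (.reg 6) (.const 2)))
    (.seq (.assign 5 (.add (.reg 5) (.reg 6)))
    (.seq solve
    (.seq checkSent
    (.cond (.reg 16) (.assign 5 (.sub (.reg 5) (.reg 6))) .skip)))))))

/-- The nodes that are joined to `t` by a commodity. -/
def partners (n t : ℕ) (σ : State) : Finset ℕ := {b ∈ range n | σ.arr 4 (b * n + t) ≠ 0}

/-- Two-sided invariant: the current amount can be sent, and adding the current power of `2` makes
it blocked. Once the power is `1`, the amount is the largest possible integer. -/
theorem total_setLevel {σ : State} {n t B K : ℕ} (h : Params n t B K σ) (ht : t < n)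
    (hB : ∑ b ∈ range n, σ.arr 10 b = B) (hK : B < 2 ^ K)
    (hd : ∀ b < n, σ.arr 4 (b * n + t) = 0 → σ.arr 10 b = 0) :
    Total setLevel σ fun τ k => k ≤ 1000000 * (n + 1) ^ 6 * (K + 1) ^ 2 ∧
      CanSend n t B (fun a b => σ.arr 2 (a * n + b)) (σ.arr 9) (σ.arr 10) (partners n t σ)
        (τ.reg 5) ∧
      ((partners n t σ).Nonempty → Blocked n t B (fun a b => σ.arr 2 (a * n + b)) (σ.arr 9)
        (σ.arr 10) (partners n t σ) (τ.reg 5 + 1)) := by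
  have hU : partners n t σ ⊆ range n := filter_subset _ _
  have hp1 : 1 ≤ (n + 1) ^ 6 * (K + 1) := Nat.mul_pos (by positivity) (by omega)
  unfold setLevel
  simp only [total_seq (p := Program.assign _ _), total_assign]
  refine (Total.loop (fun m τ => τ.reg 6 = 2 ^ m ∧
      CanSend n t B (fun a b => σ.arr 2 (a * n + b)) (σ.arr 9) (σ.arr 10) (partners n t σ)
        (τ.reg 5) ∧
      ((partners n t σ).Nonempty → Blocked n t B (fun a b => σ.arr 2 (a * n + b)) (σ.arr 9)
        (σ.arr 10) (partners n t σ) (τ.reg 5 + 2 ^ m)))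
    (449400 * ((n + 1) ^ 6 * (K + 1))) (m := K) ?_ ?_).mono ?_
  · simp only [Expr.val, setReg_reg, h.r13, if_true, if_false, Nat.reduceEqDiff]
    -- All demands are at most `B < 2 ^ K`, so the demand of any partner blocks `2 ^ K`.
    refine ⟨trivial, canSend_zero, fun ⟨b, hb⟩ => .inl ⟨b, hb, ?_⟩⟩
    rw [zero_add]
    refine lt_of_le_of_lt ?_ (hB ▸ hK)
    exact single_le_sum (f := fun b => σ.arr 10 b) (fun _ _ => Nat.zero_le _) (hU hb)
  · rintro m τ hF ⟨h6, hC, hBl⟩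
    have hp : Params n t B K τ := Params.of_frame
      (by constructor <;>
        simp [Expr.val, h.r0, h.r1, h.r2, h.r4, h.r13, h.r14, h.r15, h.r18]) hF (by decide)
    have b2 : τ.arr 2 = σ.arr 2 := hF.arr 2 (by decide)
    have b4 : τ.arr 4 = σ.arr 4 := hF.arr 4 (by decide)
    have b9 : τ.arr 9 = σ.arr 9 := hF.arr 9 (by decide)
    have b10 : τ.arr 10 = σ.arr 10 := hF.arr 10 (by decide)
    refine ⟨by simp only [Expr.cost]; omega, fun hv => ?_⟩
    have hm : m ≠ 0 := by rintro rfl; simp [Expr.val, h6] at hv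
    obtain ⟨m, rfl⟩ := Nat.exists_eq_succ_of_ne_zero hm
    have h2 : 2 ^ (m + 1) / 2 = 2 ^ m := by rw [pow_succ]; simp
    rw [total_seq, total_assign, total_seq, total_assign, total_seq]
    simp only [Expr.val, Expr.cost, h6, h2, setReg_reg, if_true, if_false,
      Nat.succ_eq_add_one, Nat.reduceEqDiff]
    generalize hτ' : (τ.setReg 6 (2 ^ m)).setReg 5 (τ.reg 5 + 2 ^ m) = τ'
    have g5 : τ'.reg 5 = τ.reg 5 + 2 ^ m := by simp [← hτ']
    have g6 : τ'.reg 6 = 2 ^ m := by simp [← hτ']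
    have c2 : τ'.arr 2 = σ.arr 2 := by rw [← b2, ← hτ']; rfl
    have c4 : τ'.arr 4 = σ.arr 4 := by rw [← b4, ← hτ']; rfl
    have c9 : τ'.arr 9 = σ.arr 9 := by rw [← b9, ← hτ']; rfl
    have c10 : τ'.arr 10 = σ.arr 10 := by rw [← b10, ← hτ']; rfl
    have hp' : Params n t B K τ' := by
      constructor <;> simp [← hτ', hp.r0, hp.r1, hp.r2, hp.r4, hp.r13, hp.r14, hp.r15, hp.r18]
    refine (total_solve hp' ht (c10 ▸ hB) hK).mono fun υ k hFυ ⟨hk, ⟨x, hP⟩, hS⟩ => ?_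
    have hpυ := hp'.of_frame hFυ (by decide)
    have d5 : υ.reg 5 = τ.reg 5 + 2 ^ m := by rw [hFυ.reg 5 (by decide), g5]
    have d6 : υ.reg 6 = 2 ^ m := by rw [hFυ.reg 6 (by decide), g6]
    have d4 : υ.arr 4 = σ.arr 4 := by rw [hFυ.arr 4 (by decide), c4]
    have d10 : υ.arr 10 = σ.arr 10 := by rw [hFυ.arr 10 (by decide), c10]
    unfold stateNet at hP
    rw [c2, c9, c10, g5] at hP
    rw [total_seq]
    refine (total_checkSent hpυ).mono fun φ l hFφ ⟨hl, hiff⟩ => ?_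
    have e5 : φ.reg 5 = τ.reg 5 + 2 ^ m := by rw [hFφ.reg 5 (by decide), d5]
    have e6 : φ.reg 6 = 2 ^ m := by rw [hFφ.reg 6 (by decide), d6]
    rw [d4, d5, d10] at hiff
    have hl' : (n + 1) ^ 2 ≤ (n + 1) ^ 6 * (K + 1) := by
      calc (n + 1) ^ 2 ≤ (n + 1) ^ 6 := Nat.pow_le_pow_right (by omega) (by omega)
        _ ≤ _ := Nat.le_mul_of_pos_right _ (by omega)
    simp only [total_cond, total_assign, total_skip, Expr.val, Expr.cost, setReg_reg, e5, e6,
      Nat.add_sub_cancel, if_true, if_false, Nat.reduceEqDiff]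
    have hsplit : ((∀ b ∈ partners n t σ, τ.reg 5 + 2 ^ m ≤ σ.arr 10 b) ∧
        ∀ b < n, res (2 * n + 1) υ (2 * n) b = 0) ↔ φ.reg 16 = 0 := by
      rw [hiff]
      simp only [partners, mem_filter, mem_range]
      exact ⟨fun h b hb => ⟨h.2 b hb, fun h' => h.1 b ⟨hb, h'⟩⟩,
        fun h => ⟨fun b hb => (h b hb.1).2 hb.2, fun b hb => (h b hb).1⟩⟩
    refine ⟨fun h16 => ⟨by nlinarith, m, by omega, rfl, hC, fun _ => ?_⟩,
      fun h16 => ⟨by nlinarith, m, by omega, rfl, ?_, fun hne => ?_⟩⟩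
    · refine blocked_of_saturated ht hU (fun b hb hbU => hd b hb ?_) hP hS
        fun h' => h16 (hsplit.1 h')
      by_contra h'
      exact hbU (mem_filter.2 ⟨mem_range.2 hb, h'⟩)
    · exact ⟨(hsplit.2 h16).1, _, _, hP, (hsplit.2 h16).2⟩
    · have := hBl hne
      rwa [Nat.succ_eq_add_one, pow_succ, mul_two, ← add_assoc] at this
  · rintro τ k hF ⟨hk, ⟨m, hm, h6, hC, hBl⟩, hz⟩
    have hm0 : m = 0 := by
      by_contra h
      have : 2 ^ 1 ≤ 2 ^ m := Nat.pow_le_pow_right (by omega) (by omega)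
      simp only [Expr.val, h6] at hz
      split_ifs at hz
      omega
    subst hm0
    refine ⟨?_, hC, by simpa using hBl⟩
    simp only [Expr.cost]
    have h7 : 1 ≤ (n + 1) ^ 6 := Nat.one_le_pow _ _ (by omega)
    generalize (n + 1) ^ 6 = Y at *
    rw [mul_assoc, pow_two, ← mul_assoc Y]
    generalize hZ : Y * (K + 1) = Z at *
    have : (K + 1) * (2 * (449400 * Z) + 1) + 20 ≤ 898821 * (Z * (K + 1)) := by
      nlinarith [Nat.mul_le_mul hp1 (Nat.le_refl (K + 1))]
    nlinarith

end RAM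

/-! ### Completion to a maximum flow, and output. -/

namespace RAM
open Finset MultiflowInstance

/-- Let the source send the remaining demands, and never take back what has been sent. -/
def fixSource : Program :=
  .for 8 0 (.seq (.store 7 (.add (.mul (.reg 14) (.reg 1)) (.reg 8))
    (.sub (.cell 10 (.reg 8)) (.reg 5)))
    (.store 7 (.add (.mul (.reg 8) (.reg 1)) (.reg 14)) (.const 0)))

theorem total_fixSource {σ : State} {n t B K : ℕ} (h : Params n t B K σ) :
    Total fixSource σ fun τ k => k ≤ 300 * (n + 1) ^ 2 ∧
      ∀ a < 2 * n + 1, ∀ b < 2 * n + 1, res (2 * n + 1) τ a b =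
        if a = 2 * n ∧ b < n then σ.arr 10 b - σ.reg 5 else
          if b = 2 * n ∧ a < n then 0 else res (2 * n + 1) σ a b := by
  have hsz' := size_le_self (2 * n + 1)
  unfold fixSource
  refine (total_for (fun j τ => ∀ a < 2 * n + 1, ∀ b < 2 * n + 1, res (2 * n + 1) τ a b =
        if a = 2 * n ∧ b < j then σ.arr 10 b - σ.reg 5 else
          if b = 2 * n ∧ a < j then 0 else res (2 * n + 1) σ a b) (4 * n + 60)
    (by decide) (by decide) (by decide) (by simp [res]) ?_).mono ?_
  · rintro j hj τ hF hj8 hI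
    rw [h.r0] at hj
    have hp : Params n t B K τ := h.of_frame hF (by decide)
    have f5 : τ.reg 5 = σ.reg 5 := by rw [hF.reg 5 (by decide)]
    have b10 : τ.arr 10 = σ.arr 10 := hF.arr 10 (by decide)
    simp only [total_seq, total_store, Expr.val, Expr.cost, setCell_reg,
      hp.r1, hp.r14, f5, b10, hj8]
    refine ⟨by omega, fun a ha b hb => ?_⟩
    have hI' := hI a ha b hb
    simp only [res] at hI' ⊢
    have i1 := index_inj (a := a) (a' := j) hb (by omega : 2 * n < 2 * n + 1)
    have i2 := index_inj (a := a) (a' := 2 * n) hb (by omega : j < 2 * n + 1)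
    simp only [setReg_arr, setCell_arr_self, i1, i2, hI']
    by_cases c1 : a = 2 * n ∧ b < n
    · have c2 : ¬ (b = 2 * n) := by omega
      have c3 : ¬ (a = j) := by omega
      have c4 : b < j + 1 ↔ b = j ∨ b < j := by omega
      simp only [c1.1, c2, c4, false_and, and_false, if_false, true_and]
      by_cases c5 : b = j
      · simp [c5]
      · simp [c5]
    · by_cases c2 : b = 2 * n ∧ a < n
      · have c1 : ¬ (a = 2 * n) := by omega
        have c4 : a < j + 1 ↔ a = j ∨ a < j := by omega
        simp only [c2.1, c1, c4, false_and, if_false, true_and]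
        by_cases c5 : a = j
        · simp [c5]
        · simp [c5]
      · have d1 : ¬ (a = j ∧ b = 2 * n) := by omega
        have d2 : ¬ (a = 2 * n ∧ b = j) := by omega
        have d3 : ¬ (a = 2 * n ∧ b < j) := by omega
        have d4 : ¬ (b = 2 * n ∧ a < j) := by omega
        have d5 : ¬ (a = 2 * n ∧ b < j + 1) := by omega
        have d6 : ¬ (b = 2 * n ∧ a < j + 1) := by omega
        simp only [d1, d2, d3, d4, d5, d6, if_false]
  · rintro τ k hF ⟨hk, hI⟩
    rw [h.r0] at hk hI
    refine ⟨?_, hI⟩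
    nlinarith

/-- Write the payoffs: what a node sends, and for the sink the sum. -/
def writeOutput : Program :=
  .seq (.assign 16 (.const 0))
  (.seq (.for 8 0
    (.seq (.store 5 (.reg 8) (.sub (.cell 10 (.reg 8))
      (.cell 7 (.add (.mul (.reg 14) (.reg 1)) (.reg 8)))))
    (.seq (.store 6 (.reg 8) (.reg 3))
    (.assign 16 (.add (.reg 16) (.cell 5 (.reg 8)))))))
  (.store 5 (.reg 2) (.reg 16)))

theorem total_writeOutput {σ : State} {n t B K : ℕ} (h : Params n t B K σ) :
    Total writeOutput σ fun τ k => k ≤ 300 * (n + 1) ^ 2 ∧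
      (∀ v < n, τ.arr 6 v = σ.reg 3) ∧
      ∀ v < n, τ.arr 5 v = if v = t then
          ∑ b ∈ range n, (σ.arr 10 b - res (2 * n + 1) σ (2 * n) b)
        else σ.arr 10 v - res (2 * n + 1) σ (2 * n) v := by
  have hsz' := size_le_self (2 * n + 1)
  unfold writeOutput
  rw [total_seq, total_assign, total_seq]
  refine (total_for (fun j τ => (∀ v < j, τ.arr 6 v = σ.reg 3) ∧
      (∀ v < j, τ.arr 5 v = σ.arr 10 v - res (2 * n + 1) σ (2 * n) v) ∧
      τ.reg 16 = ∑ b ∈ range j, (σ.arr 10 b - res (2 * n + 1) σ (2 * n) b)) (2 * n + 60)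
    (by decide) (by decide) (by decide) (by simp [Expr.val]) ?_).mono ?_
  · rintro j hj τ hF hj8 ⟨hI6, hI5, hI⟩
    have hp : Params n t B K τ := Params.of_frame
      (by constructor <;> simp [h.r0, h.r1, h.r2, h.r4, h.r13, h.r14, h.r15, h.r18]) hF (by decide)
    have f3 : τ.reg 3 = σ.reg 3 := by rw [hF.reg 3 (by decide)]; simp
    have b7 : τ.arr 7 = σ.arr 7 := hF.arr 7 (by decide)
    have b10 : τ.arr 10 = σ.arr 10 := hF.arr 10 (by decide)
    simp only [total_seq, total_store, total_assign, Expr.val, Expr.cost, setCell_reg, setReg_arr,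
      setReg_reg, hp.r1, hp.r14, f3, b7, b10, hj8, setCell_arr, if_true, if_false, Nat.reduceEqDiff,
      true_and, false_and, hI]
    refine ⟨by omega, fun v hv => ?_, fun v hv => ?_, ?_⟩
    · split_ifs with h
      · rfl
      · exact hI6 v (by omega)
    · split_ifs with h
      · rw [h]; rfl
      · exact hI5 v (by omega)
    · rw [sum_range_succ]; rfl
  · rintro τ k hF ⟨hk, hI6, hI5, hI⟩
    have f2 : τ.reg 2 = t := by rw [hF.reg 2 (by decide)]; simpa using h.r2
    have hm : (σ.setReg 16 (Expr.val σ (.const 0))).reg 0 = n := by simpa using h.r0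
    rw [hm] at hk hI6 hI5 hI
    simp only [total_store, Expr.val, Expr.cost, f2, hI, setCell_arr_self]
    refine ⟨by nlinarith, fun v hv => ?_, fun v hv => ?_⟩
    · rw [setCell_arr_of_ne _ _ _ (by decide)]; exact hI6 v hv
    · split_ifs with h
      · rfl
      · exact hI5 v hv

/-- Extend a flow that sends the amount in register `5` everywhere to a maximum flow. -/
def finish : Program := .seq solve (.seq fixSource (.seq maxflow writeOutput))

/-- The bisection leaves behind the residual capacities of its last trial, which may have failed; so
the flow for the chosen level is computed again before it is extended. -/
theorem total_finish {σ : State} {n t B K : ℕ} (h : Params n t B K σ) (ht : t < n)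
    (hB : ∑ b ∈ range n, σ.arr 10 b = B) (hK : B < 2 ^ K)
    (hC : CanSend n t B (fun a b => σ.arr 2 (a * n + b)) (σ.arr 9) (σ.arr 10) (partners n t σ)
        (σ.reg 5)) :
    Total finish σ fun τ k => k ≤ 1000000 * (n + 1) ^ 6 * (K + 1) ∧
      (∀ v < n, τ.arr 6 v = σ.reg 3) ∧ ∃ y : ℕ → ℕ,
      (∀ v < n, τ.arr 5 v = if v = t then ∑ b ∈ range n, y b else y v) ∧
      (∃ φ x, IsNetFlow (2 * n + 1) (2 * n) (n + t) φ x ∧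
        (∀ a < 2 * n + 1, ∀ b < 2 * n + 1, φ a b ≤ stateNet n t B σ (σ.arr 10) a b) ∧
        ∀ b < n, φ (2 * n) b = y b) ∧
      (∀ b < n, b ∈ partners n t σ → σ.reg 5 ≤ y b) ∧
      ∃ R ⊆ range (2 * n + 1), 2 * n ∈ R ∧ n + t ∉ R ∧
        cutCap (2 * n + 1) (stateNet n t B σ (σ.arr 10)) R = ∑ b ∈ range n, y b := by
  unfold finish
  rw [total_seq]
  refine (total_solve h ht hB hK).mono fun σ₁ k₁ hF₁ ⟨hk₁, ⟨x₁, hP₁⟩, hS₁⟩ => ?_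
  have h₁ := h.of_frame hF₁ (by decide)
  have h0 := hC.eq_zero_of_saturated ht hP₁ hS₁
  rw [total_seq]
  refine (total_fixSource h₁).mono fun σ₂ k₂ hF₂ ⟨hk₂, hr₂⟩ => ?_
  have h₂ := h₁.of_frame hF₂ (by decide)
  have e5 : σ₁.reg 5 = σ.reg 5 := hF₁.reg 5 (by decide)
  have e10 : σ₁.arr 10 = σ.arr 10 := hF₁.arr 10 (by decide)
  rw [e5, e10] at hr₂
  have hcut : cutCap (2 * n + 1) (res (2 * n + 1) σ₂) {2 * n} < 2 ^ K := by
    refine lt_of_le_of_lt ?_ (hB ▸ hK)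
    unfold cutCap
    rw [sum_singleton, ← sum_sdiff (s₁ := range n) (s₂ := range (2 * n + 1) \ {2 * n})
      (fun b hb => by simp only [mem_sdiff, mem_range, mem_singleton] at hb ⊢; omega)]
    -- Only the arcs to `0, …, n - 1` leave the source with residual capacity, and these carry at
    -- most the demands.
    have z1 : ∑ b ∈ (range (2 * n + 1) \ {2 * n}) \ range n, res (2 * n + 1) σ₂ (2 * n) b = 0 := by
      refine sum_eq_zero fun b hb => ?_
      simp only [mem_sdiff, mem_range, mem_singleton] at hb
      rw [hr₂ _ (by omega) b (by omega), if_neg (by omega), if_neg (by omega)]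
      exact MultiflowInstance.Pushes.source_eq_zero hP₁ (by omega) (by omega)
    rw [z1, zero_add]
    refine sum_le_sum fun b hb => ?_
    have hb := mem_range.1 hb
    rw [hr₂ _ (by omega) b (by omega), if_pos ⟨rfl, hb⟩]
    exact Nat.sub_le _ _
  rw [total_seq]
  refine (h₂.total_maxflow ht hcut).mono fun σ₃ k₃ hF₃ ⟨hk₃, ⟨x₃, _, hP₃⟩, hS₃⟩ => ?_
  have h₃ := h₂.of_frame hF₃ (by decide)
  refine (total_writeOutput h₃).mono fun τ k₄ _ ⟨hk₄, h6, h5⟩ => ?_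
  have f3 : σ₃.reg 3 = σ.reg 3 := by
    rw [hF₃.reg 3 (by decide), hF₂.reg 3 (by decide), hF₁.reg 3 (by decide)]
  have f10 : σ₃.arr 10 = σ.arr 10 := by
    rw [hF₃.arr 10 (by decide), hF₂.arr 10 (by decide), e10]
  rw [f3] at h6
  rw [f10] at h5
  refine ⟨?_, h6, _, h5, exists_netFlow ht hC.1 hP₁ h0 (fun b hb => ?_) (fun b hb => ?_)
    (fun a ha b hb c1 c2 => ?_) hP₃ hS₃⟩
  · have j1 : (n + 1) ^ 2 ≤ (n + 1) ^ 6 := Nat.pow_le_pow_right (by omega) (by omega)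
    have j2 : (n + 1) ^ 6 ≤ (n + 1) ^ 6 * (K + 1) := Nat.le_mul_of_pos_right _ (by omega)
    rw [mul_assoc] at *
    omega
  · rw [hr₂ _ (by omega) b (by omega), if_pos ⟨rfl, hb⟩]
  · rw [hr₂ _ (by omega) _ (by omega), if_neg (by omega), if_pos ⟨rfl, hb⟩]
  · rw [hr₂ a ha b hb, if_neg c1, if_neg c2]

end RAM

/-! ### The whole program and its unit cost. -/

namespace RAM
open Finset MultiflowInstance

/-- Used to bound the length of the total demand after scaling, and with it the exponent `K`. -/
theorem Total.bdd {p : Program} {σ : State} {Q : State → ℕ → Prop} (h : Total p σ Q) {M : ℕ}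
    (hM : σ.Bdd M) : Total p σ fun τ k => Q τ k ∧ τ.Bdd (M + k) := by
  obtain ⟨τ, k, h1, h2⟩ := h
  exact ⟨τ, k, h1, h2, h1.bdd hM⟩

/-- Find the sink and scale the data to integers. -/
def scale : Program :=
  .seq findSink (.seq setScalars (.seq setFactor (.seq setDemands setCapacities)))

/-- The scaling factor, computed from the denominators of the capacities and demands. -/
def factor (n t : ℕ) (p q : ℕ → ℕ) : ℕ :=
  ∏ i ∈ range n, (i + 1) * (p i + (1 - p i)) * (q (i * n + t) + (1 - q (i * n + t)))

/-- The scaled demands. -/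
def scaledDemand (n t : ℕ) (σ : State) (i : ℕ) : ℕ :=
  factor n t (σ.arr 1) (σ.arr 4) / (σ.arr 4 (i * n + t) + (1 - σ.arr 4 (i * n + t))) *
    σ.arr 3 (i * n + t)

/-- The scaled capacities. -/
def scaledCapacity (n t : ℕ) (σ : State) (i : ℕ) : ℕ :=
  if σ.arr 1 i = 0 then ∑ b ∈ range n, scaledDemand n t σ b
  else factor n t (σ.arr 1) (σ.arr 4) / σ.arr 1 i * σ.arr 0 i

theorem total_scale {σ : State} {n t₀ M : ℕ} (h0 : σ.reg 0 = n) (ht₀ : t₀ < n)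
    (hsink : ∀ a < n, ∀ b < n, σ.arr 4 (a * n + b) ≠ 0 → a = t₀ ∨ b = t₀) (hM : σ.Bdd M) :
    Total scale σ fun τ k => k ≤ 1000 * (n + 1) ^ 4 * (M + 1) ∧ ∃ t < n,
      (∀ a < n, ∀ b < n, σ.arr 4 (a * n + b) ≠ 0 → a = t ∨ b = t) ∧
      τ.reg 1 = 2 * n + 1 ∧ τ.reg 2 = t ∧ τ.reg 14 = 2 * n ∧ τ.reg 15 = n + t ∧
      τ.reg 18 = (2 * n + 1) * (2 * n + 1) ∧ τ.reg 3 = factor n t (σ.arr 1) (σ.arr 4) ∧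
      τ.reg 4 = ∑ b ∈ range n, scaledDemand n t σ b ∧
      (∀ i < n, τ.arr 10 i = scaledDemand n t σ i) ∧
      ∀ i < n, τ.arr 9 i = scaledCapacity n t σ i := by
  unfold scale
  rw [total_seq]
  refine (total_findSink h0 ht₀ hsink).mono fun σ₁ k₁ hF₁ ⟨hk₁, ht, hs⟩ => ?_
  generalize ht' : σ₁.reg 2 = t at ht hs
  have a0 : σ₁.reg 0 = n := (hF₁.reg 0 (by decide)).trans h0
  rw [total_seq]
  refine (total_setScalars a0 ht').mono fun σ₂ k₂ hF₂ ⟨hk₂, b1, b14, b15, b18⟩ => ?_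
  have b0 : σ₂.reg 0 = n := (hF₂.reg 0 (by decide)).trans a0
  have b2 : σ₂.reg 2 = t := (hF₂.reg 2 (by decide)).trans ht'
  have b : σ₂.arr = σ.arr := funext fun a =>
    (hF₂.arr a (by simp [setScalars, Program.arrs])).trans
      (hF₁.arr a (by simp [findSink, Program.arrs]))
  rw [total_seq]
  refine (total_setFactor b0 b2 (M := M) fun a i _ => b ▸ hM.2 a i).mono
    fun σ₃ k₃ hF₃ ⟨hk₃, c3⟩ => ?_
  have c0 : σ₃.reg 0 = n := (hF₃.reg 0 (by decide)).trans b0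
  have c2 : σ₃.reg 2 = t := (hF₃.reg 2 (by decide)).trans b2
  have c : σ₃.arr = σ.arr := (funext fun a =>
    (hF₃.arr a (by simp [setFactor, Program.for, Program.arrs]))).trans b
  rw [b] at c3
  rw [total_seq]
  refine (total_setDemands c0 c2 c3 (M := M) fun i => c ▸ hM.2 3 i).mono
    fun σ₄ k₄ hF₄ ⟨hk₄, d10, d4⟩ => ?_
  have d0 : σ₄.reg 0 = n := (hF₄.reg 0 (by decide)).trans c0
  have d3 := (hF₄.reg 3 (by decide)).trans c3
  have e0 : σ₄.arr 0 = σ.arr 0 := (hF₄.arr 0 (by decide)).trans (c ▸ rfl)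
  have e1 : σ₄.arr 1 = σ.arr 1 := (hF₄.arr 1 (by decide)).trans (c ▸ rfl)
  rw [c] at d10
  have d10' : ∀ i < n, σ₄.arr 10 i = scaledDemand n t σ i := d10
  have d4' : σ₄.reg 4 = ∑ b ∈ range n, scaledDemand n t σ b := by
    rw [d4]; exact sum_congr rfl fun i hi => d10' i (mem_range.1 hi)
  refine (total_setCapacities d0 d3 d4' (M := M) fun i => e0 ▸ hM.2 0 i).mono
    fun σ₅ k₅ hF₅ ⟨hk₅, f9⟩ => ?_
  rw [e0, e1] at f9
  have r : ∀ r, r = 1 ∨ r = 14 ∨ r = 15 ∨ r = 18 → σ₅.reg r = σ₂.reg r := by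
    intro r hr
    rw [hF₅.reg r (by rcases hr with rfl | rfl | rfl | rfl <;> decide),
      hF₄.reg r (by rcases hr with rfl | rfl | rfl | rfl <;> decide),
      hF₃.reg r (by rcases hr with rfl | rfl | rfl | rfl <;> decide)]
  refine ⟨?_, t, ht, hs, by rw [r 1 (by simp), b1], ?_, by rw [r 14 (by simp), b14],
    by rw [r 15 (by simp), b15], by rw [r 18 (by simp), b18], ?_, ?_, ?_, f9⟩
  · have h1 : n + M + 1 ≤ (n + 1) * (M + 1) := by nlinarith [Nat.zero_le (n * M)]
    have h2 : 200 * (n + 1) * (n + M + 1) ≤ 200 * (n + 1) ^ 4 * (M + 1) := by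
      calc 200 * (n + 1) * (n + M + 1) ≤ 200 * (n + 1) * ((n + 1) * (M + 1)) :=
            Nat.mul_le_mul_left _ h1
        _ = 200 * (n + 1) ^ 2 * (M + 1) := by ring
        _ ≤ _ := by gcongr <;> omega
    have h3 : (n + 1) ^ 4 * 1 ≤ (n + 1) ^ 4 * (M + 1) := Nat.mul_le_mul_left _ (by omega)
    have h4 : (n + 1) ^ 1 ≤ (n + 1) ^ 4 := Nat.pow_le_pow_right (by omega) (by omega)
    rw [pow_one] at h4
    have h5 : n + 1 ≤ (n + 1) ^ 4 * (M + 1) := by omega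
    rw [mul_assoc] at h2 ⊢
    rw [mul_assoc 200 ((n + 1) ^ 4)] at h2
    rw [mul_assoc] at hk₃ hk₄ hk₅
    omega
  · rw [hF₅.reg 2 (by decide), hF₄.reg 2 (by decide), c2]
  · rw [hF₅.reg 3 (by decide), d3]; rfl
  · rw [hF₅.reg 4 (by decide), d4']
  · rw [hF₅.arr 10 (by decide)]; exact d10'

/-- The algorithm. -/
def singleSinkProgram : Program := .seq scale (.seq setPower (.seq setLevel finish))

theorem total_singleSinkProgram {σ : State} {n t₀ M : ℕ} (h0 : σ.reg 0 = n) (ht₀ : t₀ < n)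
    (hsink : ∀ a < n, ∀ b < n, σ.arr 4 (a * n + b) ≠ 0 → a = t₀ ∨ b = t₀)
    (h34 : ∀ i, σ.arr 4 i = 0 → σ.arr 3 i = 0) (hM : σ.Bdd M) (hn : n ≤ M) :
    Total singleSinkProgram σ fun τ k => k ≤ 3 * 10 ^ 12 * (M + 1) ^ 16 ∧
      ∃ t < n, (∀ a < n, ∀ b < n, σ.arr 4 (a * n + b) ≠ 0 → a = t ∨ b = t) ∧
      ∃ B c d, B = ∑ b ∈ range n, scaledDemand n t σ b ∧
      (∀ i < n, d i = scaledDemand n t σ i) ∧ (∀ i < n, c i = scaledCapacity n t σ i) ∧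
      (∀ v < n, τ.arr 6 v = factor n t (σ.arr 1) (σ.arr 4)) ∧ ∃ y : ℕ → ℕ,
      (∀ v < n, τ.arr 5 v = if v = t then ∑ b ∈ range n, y b else y v) ∧
      (∃ φ x, IsNetFlow (2 * n + 1) (2 * n) (n + t) φ x ∧
        (∀ a < 2 * n + 1, ∀ b < 2 * n + 1,
          φ a b ≤ net n t B (fun a b => σ.arr 2 (a * n + b)) c d a b) ∧
        ∀ b < n, φ (2 * n) b = y b) ∧
      (∃ R ⊆ range (2 * n + 1), 2 * n ∈ R ∧ n + t ∉ R ∧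
        cutCap (2 * n + 1) (net n t B (fun a b => σ.arr 2 (a * n + b)) c d) R =
          ∑ b ∈ range n, y b) ∧
      ∃ ℓ, (∀ b < n, b ∈ partners n t σ → ℓ ≤ y b) ∧
        ((partners n t σ).Nonempty → Blocked n t B (fun a b => σ.arr 2 (a * n + b)) c d
          (partners n t σ) (ℓ + 1)) := by
  unfold singleSinkProgram
  rw [total_seq]
  refine ((total_scale h0 ht₀ hsink hM).bdd hM).mono fun σ₁ k₁ hF₁
    ⟨⟨hk₁, t, ht, hs, a1, a2, a14, a15, a18, a3, a4, a10, a9⟩, hM₁⟩ => ?_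
  have a0 : σ₁.reg 0 = n := (hF₁.reg 0 (by decide)).trans h0
  rw [total_seq]
  refine (total_setPower rfl (hM₁.1 4)).mono fun σ₂ k₂ hF₂ ⟨hk₂, K, hK, b13, hBK⟩ => ?_
  have hp : Params n t (σ₁.reg 4) K σ₂ :=
    ⟨(hF₂.reg 0 (by decide)).trans a0, (hF₂.reg 1 (by decide)).trans a1,
      (hF₂.reg 2 (by decide)).trans a2, hF₂.reg 4 (by decide), b13,
      (hF₂.reg 14 (by decide)).trans a14, (hF₂.reg 15 (by decide)).trans a15,
      (hF₂.reg 18 (by decide)).trans a18⟩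
  have b : σ₂.arr = σ₁.arr := funext fun a => hF₂.arr a (by simp [setPower, Program.arrs])
  have arr2 : σ₂.arr 2 = σ.arr 2 := by rw [b, hF₁.arr 2 (by decide)]
  have arr4 : σ₂.arr 4 = σ.arr 4 := by rw [b, hF₁.arr 4 (by decide)]
  have b10 : ∀ i < n, σ₂.arr 10 i = scaledDemand n t σ i := by rw [b]; exact a10
  have hB : ∑ b ∈ range n, σ₂.arr 10 b = σ₁.reg 4 := by
    rw [a4]; exact sum_congr rfl fun i hi => b10 i (mem_range.1 hi)
  have hd : ∀ b < n, σ₂.arr 4 (b * n + t) = 0 → σ₂.arr 10 b = 0 := by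
    intro i hi h4
    rw [arr4] at h4
    rw [b10 i hi, scaledDemand, h34 _ h4, mul_zero]
  have hU : partners n t σ₂ = partners n t σ := by unfold partners; rw [arr4]
  rw [total_seq]
  refine (total_setLevel hp ht hB hBK hd).mono fun σ₃ k₃ hF₃ ⟨hk₃, hC, hBl⟩ => ?_
  have hp₃ := hp.of_frame hF₃ (by decide)
  have c2 : σ₃.arr 2 = σ₂.arr 2 := hF₃.arr 2 (by decide)
  have c4 : σ₃.arr 4 = σ₂.arr 4 := hF₃.arr 4 (by decide)
  have c9 : σ₃.arr 9 = σ₂.arr 9 := hF₃.arr 9 (by decide)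
  have c10 : σ₃.arr 10 = σ₂.arr 10 := hF₃.arr 10 (by decide)
  have hU₃ : partners n t σ₃ = partners n t σ := by
    rw [← hU]; unfold partners; rw [c4]
  refine (total_finish hp₃ ht (c10 ▸ hB) hBK (by rw [c2, c9, c10, hU₃, ← hU]; exact hC)).mono
    fun τ k₄ _ ⟨hk₄, h6, y, h5, hφ, hy, hR⟩ => ?_
  unfold stateNet at hφ hR
  rw [c2, arr2, c9, c10] at hφ hR
  rw [hU₃] at hy
  rw [hU, arr2] at hBl
  have d3 : σ₃.reg 3 = factor n t (σ.arr 1) (σ.arr 4) := by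
    rw [hF₃.reg 3 (by decide), hF₂.reg 3 (by decide), a3]
  rw [d3] at h6
  refine ⟨?_, t, ht, hs, σ₁.reg 4, σ₂.arr 9, σ₂.arr 10, a4, b10, by rw [b]; exact a9, h6, y, h5, hφ,
    hR, _, hy, hBl⟩
  clear hBl hy hR hφ h5 h6 hC
  -- `K` is at most `M` plus the cost of scaling, hence of order `(M + 1) ^ 5`. The bisection costs
  -- `(n + 1) ^ 6 * (K + 1) ^ 2` up to a constant; it dominates and gives the exponent `6 + 2 * 5 =
  -- 16`.
  have e1 : 1000 * (n + 1) ^ 4 * (M + 1) ≤ 1000 * (M + 1) ^ 5 := by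
    calc 1000 * (n + 1) ^ 4 * (M + 1) ≤ 1000 * (M + 1) ^ 4 * (M + 1) := by gcongr
      _ = _ := by ring
  have e2 : M + 1 ≤ (M + 1) ^ 5 := Nat.le_self_pow (by omega) _
  have e3 : K + 1 ≤ 1001 * (M + 1) ^ 5 := by omega
  have e4 : 1000000 * (n + 1) ^ 6 * (K + 1) ≤ 1001000000 * (M + 1) ^ 16 := by
    calc 1000000 * (n + 1) ^ 6 * (K + 1) ≤ 1000000 * (M + 1) ^ 6 * (1001 * (M + 1) ^ 5) := by
          gcongr
      _ = 1001000000 * (M + 1) ^ 11 := by ring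
      _ ≤ _ := by gcongr <;> omega
  have e5 : 1000000 * (n + 1) ^ 6 * (K + 1) ^ 2 ≤ 1002001000000 * (M + 1) ^ 16 := by
    calc 1000000 * (n + 1) ^ 6 * (K + 1) ^ 2
        ≤ 1000000 * (M + 1) ^ 6 * (1001 * (M + 1) ^ 5) ^ 2 := by gcongr
      _ = _ := by ring
  have e6 : (M + 1) ^ 5 ≤ (M + 1) ^ 16 := Nat.pow_le_pow_right (by omega) (by omega)
  omega

end RAM

/-! ### Divisibility by `n!`, and the input as a scaled instance. -/

namespace MultiflowInstance
open Finset RAM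

theorem factorial_mul_eq_factor (n t : ℕ) (p q : ℕ → ℕ) :
    factor n t p q = n.factorial * (∏ i ∈ range n, (p i + (1 - p i))) *
      ∏ i ∈ range n, (q (i * n + t) + (1 - q (i * n + t))) := by
  unfold factor
  rw [prod_mul_distrib, prod_mul_distrib, prod_range_add_one_eq_factorial]

theorem factor_pos (n t : ℕ) (p q : ℕ → ℕ) : 0 < factor n t p q :=
  prod_pos fun i _ => Nat.mul_pos (Nat.mul_pos (by omega) (by omega)) (by omega)

/-- Each denominator occurs in the product next to `n!`; dividing one of them out leaves an integer
that is still divisible by `n!`. -/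
theorem factor_div {n t : ℕ} {p q : ℕ → ℕ} {u : ℕ} (hu : u < n) :
    (q (u * n + t) + (1 - q (u * n + t)) ∣ factor n t p q ∧
      n.factorial ∣ factor n t p q / (q (u * n + t) + (1 - q (u * n + t)))) ∧
    (p u + (1 - p u) ∣ factor n t p q ∧ n.factorial ∣ factor n t p q / (p u + (1 - p u))) := by
  have hq := dvd_prod_of_mem (fun i => q (i * n + t) + (1 - q (i * n + t))) (mem_range.2 hu)
  have hp := dvd_prod_of_mem (fun i => p i + (1 - p i)) (mem_range.2 hu)
  rw [factorial_mul_eq_factor]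
  refine ⟨⟨hq.mul_left _, ?_⟩, (hp.mul_left _).mul_right _, ?_⟩
  · rw [Nat.mul_div_assoc _ hq]
    exact ((dvd_mul_right _ _).mul_right _)
  · rw [mul_right_comm, Nat.mul_div_assoc _ hp]
    exact ((dvd_mul_right _ _).mul_right _)

theorem factorial_dvd_scaledDemand {n t : ℕ} (σ : State) {i : ℕ} (hi : i < n) :
    n.factorial ∣ scaledDemand n t σ i := (factor_div hi).1.2.mul_right _

theorem factorial_dvd_scaledCapacity {n t : ℕ} (σ : State) {i : ℕ} (hi : i < n) :
    n.factorial ∣ scaledCapacity n t σ i := by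
  unfold scaledCapacity
  split_ifs with h
  · exact dvd_sum fun b hb => factorial_dvd_scaledDemand σ (mem_range.1 hb)
  · have := (factor_div (t := t) (p := σ.arr 1) (q := σ.arr 4) hi).2.2
    rw [show σ.arr 1 i + (1 - σ.arr 1 i) = σ.arr 1 i by omega] at this
    exact this.mul_right _

theorem dvd_innerCap {n t B k : ℕ} {adj : ℕ → ℕ → ℕ} {c : ℕ → ℕ} (hB : k ∣ B)
    (hc : ∀ i < n, k ∣ c i) (R : Finset ℕ) : k ∣ innerCap n t B adj c R := by
  refine dvd_sum fun a _ => dvd_sum fun b _ => ?_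
  unfold net
  split_ifs
  exacts [hc _ ‹_›, dvd_zero _, hB, dvd_zero _, dvd_zero _, dvd_zero _]

/-- If all capacities are divisible by `n!` then a cut that blocks `ℓ + 1` units is as tight as a
cut that blocks everything above `ℓ`. -/
theorem innerCap_le_of_lt {n t B ℓ j : ℕ} {adj : ℕ → ℕ → ℕ} {c : ℕ → ℕ} (hB : n.factorial ∣ B)
    (hc : ∀ i < n, n.factorial ∣ c i) {R : Finset ℕ} (hj : j ≤ n)
    (h : innerCap n t B adj c R < (ℓ + 1) * j) : 0 < j ∧ innerCap n t B adj c R ≤ ℓ * j := by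
  have hj0 : 0 < j := by
    rcases Nat.eq_zero_or_pos j with rfl | h'
    · simp at h
    · exact h'
  -- Here `j` is to be a number of partners, at most `n`. The capacity of the cut is then an
  -- integral multiple of `j`, and the multiplier, being below `ℓ + 1`, is at most `ℓ`.
  have hdvd : j ∣ n.factorial := Nat.dvd_factorial hj0 hj
  obtain ⟨m, hm⟩ := dvd_innerCap (adj := adj) (t := t) (hdvd.trans hB)
    (fun i hi => hdvd.trans (hc i hi)) R
  rw [hm, mul_comm, Nat.mul_lt_mul_right hj0] at h
  refine ⟨hj0, ?_⟩
  rw [hm, mul_comm]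
  exact Nat.mul_le_mul_right _ (by omega)

variable {I : MultiflowInstance}

theorem matToArr_apply {n : ℕ} (A : Fin n → Fin n → ℕ) (u v : Fin n) :
    matToArr A (u * n + v) = A u v := by
  have hn : 0 < n := by have := u.2; omega
  have h1 : (u * n + v) / n = (u : ℕ) := by
    rw [mul_comm, Nat.mul_add_div hn, Nat.div_eq_of_lt v.2, add_zero]
  have h2 : (u * n + v) % n = (v : ℕ) := by
    rw [mul_comm, Nat.mul_add_mod, Nat.mod_eq_of_lt v.2]
  have h : (u * n + v) / n < n ∧ (u * n + v) % n < n := by rw [h1, h2]; exact ⟨u.2, v.2⟩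
  unfold matToArr
  rw [dif_pos h]
  congr 1 <;> exact Fin.ext (by assumption)

theorem vecToArr_apply {n : ℕ} (x : Fin n → ℕ) (v : Fin n) : vecToArr x v = x v := by
  simp [vecToArr]

theorem demandDen_ne_zero {u v : Fin I.n} : I.demandDen u v ≠ 0 ↔ I.commodity.Adj u v := by
  unfold demandDen
  split_ifs with h <;> simp [h]

theorem input_bdd : I.input.Bdd I.size := by
  have lt : ∀ {x : ℕ}, Nat.size x ≤ I.size → x < 2 ^ I.size := fun h => Nat.size_le.1 h
  have hn : I.n < 2 ^ I.size := lt (by unfold size; omega)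
  have hvec : ∀ v, Nat.size (I.capNum v) + Nat.size (I.capDen v) ≤ I.size := by
    intro v
    have := single_le_sum
      (f := fun v => (Nat.size (I.capNum v) + 1) + (Nat.size (I.capDen v) + 1))
      (fun _ _ => Nat.zero_le _) (mem_univ v)
    unfold size
    omega
  have hmat : ∀ u v, Nat.size (I.supplyBit u v) + Nat.size (I.demandNum u v) +
      Nat.size (I.demandDen u v) ≤ I.size := by
    intro u v
    have h1 := single_le_sum
      (f := fun v => (Nat.size (I.supplyBit u v) + 1) + (Nat.size (I.demandNum u v) + 1) +
      (Nat.size (I.demandDen u v) + 1)) (fun _ _ => Nat.zero_le _) (mem_univ v)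
    have h2 := single_le_sum
      (f := fun u => ∑ v, ((Nat.size (I.supplyBit u v) + 1) + (Nat.size (I.demandNum u v) + 1) +
      (Nat.size (I.demandDen u v) + 1))) (fun _ _ => Nat.zero_le _) (mem_univ u)
    unfold size
    omega
  have vec : ∀ (x : Fin I.n → ℕ), (∀ v, x v < 2 ^ I.size) → ∀ i, vecToArr x i < 2 ^ I.size := by
    intro x hx i
    unfold vecToArr
    split_ifs
    exacts [hx _, by positivity]
  have mat : ∀ (A : Fin I.n → Fin I.n → ℕ), (∀ u v, A u v < 2 ^ I.size) →
      ∀ i, matToArr A i < 2 ^ I.size := by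
    intro A hA i
    unfold matToArr
    split_ifs
    exacts [hA _ _, by positivity]
  refine ⟨fun r => ?_, fun a i => ?_⟩
  · simp only [input]
    split_ifs
    exacts [hn, by positivity]
  · unfold input
    dsimp only
    split
    · exact vec _ (fun v => lt (by have := hvec v; omega)) i
    · exact vec _ (fun v => lt (by have := hvec v; omega)) i
    · exact mat _ (fun u v => lt (by have := hmat u v; omega)) i
    · exact mat _ (fun u v => lt (by have := hmat u v; omega)) i
    · exact mat _ (fun u v => lt (by have := hmat u v; omega)) i
    · positivity

theorem n_le_size : I.n ≤ I.size := by
  have : ∑ _v : Fin I.n, 1 ≤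
      ∑ v, ((Nat.size (I.capNum v) + 1) + (Nat.size (I.capDen v) + 1)) :=
    sum_le_sum fun v _ => by omega
  simp only [sum_const, card_univ, Fintype.card_fin, smul_eq_mul, mul_one] at this
  unfold size
  omega

theorem cast_div_mul_num {D : ℕ} {q : ℚ≥0} (h : q.den ∣ D) :
    ((D / q.den * q.num : ℕ) : ℝ) = D * (q : ℝ) := by
  rw [Nat.cast_mul, Nat.cast_div h (by exact_mod_cast q.den_ne_zero), NNRat.cast_def]
  ring

theorem isScaling_input {t : Fin I.n} (ht : ∀ u v, I.commodity.Adj u v → u = t ∨ v = t)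
    {B : ℕ} {c d : ℕ → ℕ} (hB : B = ∑ b ∈ range I.n, scaledDemand I.n t I.input b)
    (hd : ∀ i < I.n, d i = scaledDemand I.n t I.input i)
    (hc : ∀ i < I.n, c i = scaledCapacity I.n t I.input i) :
    IsScaling I t (factor I.n t (I.input.arr 1) (I.input.arr 4)) B
      (fun a b => I.input.arr 2 (a * I.n + b)) c d := by
  have a0 : ∀ v : Fin I.n, I.input.arr 0 v = I.capNum v := vecToArr_apply _
  have a1 : ∀ v : Fin I.n, I.input.arr 1 v = I.capDen v := vecToArr_apply _
  have a2 : ∀ u v : Fin I.n, I.input.arr 2 (u * I.n + v) = I.supplyBit u v := matToArr_apply _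
  have a3 : ∀ u v : Fin I.n, I.input.arr 3 (u * I.n + v) = I.demandNum u v := matToArr_apply _
  have a4 : ∀ u v : Fin I.n, I.input.arr 4 (u * I.n + v) = I.demandDen u v := matToArr_apply _
  refine ⟨ht, factor_pos _ _ _ _, fun u v => ?_, fun u hu => ?_, fun u hu => ?_, fun v q hq => ?_,
    fun v hv => ?_, ?_⟩
  · rw [a2]
    unfold supplyBit
    split_ifs with h <;> simp [h]
  · rw [hd u u.2]
    have h1 := (factor_div (p := I.input.arr 1) (q := I.input.arr 4) (t := t) u.2).1.1
    have h2 : I.demandDen u t = (I.demand s(u, t)).den := if_pos hu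
    have h3 : I.demandNum u t = (I.demand s(u, t)).num := if_pos hu
    have h4 : (I.demand s(u, t)).den ≠ 0 := NNRat.den_ne_zero _
    have h5 : (I.demand s(u, t)).den + (1 - (I.demand s(u, t)).den) = (I.demand s(u, t)).den := by
      omega
    unfold scaledDemand
    rw [a4, h2, h5] at h1
    rw [a3, a4, h2, h3, h5]
    exact cast_div_mul_num h1
  · rw [hd u u.2]
    unfold scaledDemand
    rw [a3]
    have : I.demandNum u t = 0 := if_neg hu
    rw [this, mul_zero]
  · rw [hc v v.2]
    have h1 := (factor_div (p := I.input.arr 1) (q := I.input.arr 4) (t := t) v.2).2.1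
    have h2 : I.capDen v = q.den := by unfold capDen; rw [hq]
    have h3 : I.capNum v = q.num := by unfold capNum; rw [hq]
    have h4 : q.den ≠ 0 := q.den_ne_zero
    unfold scaledCapacity
    rw [a1, h2, show q.den + (1 - q.den) = q.den by omega] at h1
    rw [a0, a1, h2, h3, if_neg h4]
    exact cast_div_mul_num h1
  · rw [hc v v.2]
    have h2 : I.capDen v = 0 := by unfold capDen; rw [hv]
    unfold scaledCapacity
    rw [a1, if_pos h2, hB]
  · rw [hB, sum_range]
    exact sum_congr rfl fun u _ => (hd u u.2).symm

end MultiflowInstance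

/-! ### The theorem. -/

theorem theorem3 :
    ∃ (prog : RAM.Program) (T : Polynomial ℕ),
      ∀ I : MultiflowInstance, I.SingleSink →
        ∃ (σ : RAM.State) (k : ℕ) (x : Fin I.n → ℝ),
          RAM.Runs prog I.input σ k ∧ k ≤ T.eval I.size ∧ I.IsOutput σ x ∧
          x ∈ coalitionCore I.payoffs ∧
          IsGreatest (socialWelfare '' I.payoffs Set.univ) (socialWelfare x) ∧
          IsGreatest (fairness Set.univ '' I.payoffs Set.univ) (fairness Set.univ x) ∧
          IsGreatest (fairness I.terminals '' I.payoffs Set.univ) (fairness I.terminals x) := by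
  open MultiflowInstance RAM Finset in
  -- The unit cost is at most `3 * 10 ^ 12 * (size + 1) ^ 16`; by `Steps.runs` the time is at most
  -- this times `1 + size + cost`, whose bound is `4 * 10 ^ 12 * (size + 1) ^ 16`.
  refine ⟨singleSinkProgram, Polynomial.C (12 * 10 ^ 24) * (Polynomial.X + 1) ^ 32,
    fun I ⟨t₀, ht₀⟩ => ?_⟩
  have a4 : ∀ u v : Fin I.n, I.input.arr 4 (u * I.n + v) = I.demandDen u v := matToArr_apply _
  have hsink : ∀ a < I.n, ∀ b < I.n, I.input.arr 4 (a * I.n + b) ≠ 0 → a = t₀ ∨ b = t₀ := by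
    intro a ha b hb h
    rw [a4 ⟨a, ha⟩ ⟨b, hb⟩, demandDen_ne_zero] at h
    have h1 := ht₀ _ (I.commodity.mem_edgeSet.2 h)
    rcases Sym2.mem_iff.1 h1 with rfl | rfl <;> simp
  have h34 : ∀ i, I.input.arr 4 i = 0 → I.input.arr 3 i = 0 := by
    intro i h
    change matToArr I.demandDen i = 0 at h
    change matToArr I.demandNum i = 0
    unfold matToArr at h ⊢
    split_ifs at h ⊢ with hi
    · have : ¬ I.commodity.Adj _ _ := fun hadj => demandDen_ne_zero.2 hadj h
      exact if_neg this
    · rfl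
  obtain ⟨τ, k, hrun, hk, t', htn, hs, B, c, d, hB, hd, hc, h6, y, h5, ⟨φ, z, hφ, hφle, hφy⟩,
    ⟨R, hR, hRs, hRt, hcut⟩, ℓ, hℓ, hmax⟩ :=
      total_singleSinkProgram (n := I.n) rfl t₀.2 hsink h34 input_bdd n_le_size
  -- The sink found by the program need not be `t₀`; everything that follows refers to `t`.
  obtain ⟨t, rfl⟩ : ∃ t : Fin I.n, t' = t := ⟨⟨t', htn⟩, rfl⟩
  have ht : ∀ u v, I.commodity.Adj u v → u = t ∨ v = t := fun u v huv =>
    (hs u u.2 v v.2 (by rw [a4]; exact demandDen_ne_zero.2 huv)).imp Fin.ext Fin.ext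
  have hS := isScaling_input ht hB hd hc
  obtain ⟨f, hf, hfy⟩ := exists_feasible_of_netFlow hS hφ hφle hφy
  obtain ⟨k', hk', hruns⟩ := hrun.runs input_bdd
  have hmem : ∀ u : Fin I.n, (u : ℕ) ∈ partners I.n t I.input ↔ I.commodity.Adj u t := by
    intro u
    simp only [partners, mem_filter, mem_range, u.2, true_and]
    rw [a4, demandDen_ne_zero]
  have hD := hS.pos
  refine ⟨τ, k', f.payoff, hruns, ?_, fun v => ⟨by rw [h6 v v.2]; exact hD.ne', ?_⟩,
    hS.optimal hf hfy hR hRs hRt (by rw [hcut, sum_range]) (ℓ := ℓ)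
      (fun u hu => hℓ u u.2 ((hmem u).2 hu)) ?_⟩
  · simp only [Polynomial.eval_mul, Polynomial.eval_C, Polynomial.eval_pow, Polynomial.eval_add,
      Polynomial.eval_X, Polynomial.eval_one]
    have h1 : I.size + 1 ≤ (I.size + 1) ^ 16 := Nat.le_self_pow (by omega) _
    calc k' ≤ k * (1 + I.size + k) := hk'
      _ ≤ (3 * 10 ^ 12 * (I.size + 1) ^ 16) * (4 * 10 ^ 12 * (I.size + 1) ^ 16) := by
          gcongr; omega
      _ = 12 * 10 ^ 24 * (I.size + 1) ^ 32 := by ring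
  · rw [h5 v v.2, h6 v v.2]
    by_cases hv : v = t
    · subst hv
      rw [if_pos rfl]
      unfold PathFlow.payoff
      simp_rw [hfy]
      rw [← sum_div, sum_range]
      push_cast
      rfl
    · rw [if_neg (fun h => hv (Fin.ext h)), hS.payoff_of_ne hf hv, hfy]
  · rintro ⟨u, hu⟩
    have hfd : I.n.factorial ∣ B := hB ▸
      dvd_sum fun b hb => factorial_dvd_scaledDemand _ (mem_range.1 hb)
    rcases hmax ⟨u, (hmem u).2 hu⟩ with ⟨b, hb, hdb⟩ | ⟨R', hR', -, hRt', hlt⟩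
    · have hbn : b < I.n := mem_range.1 (mem_filter.1 hb).1
      exact .inl ⟨⟨b, hbn⟩, (hmem ⟨b, hbn⟩).1 hb, by simpa using Nat.lt_succ_iff.1 hdb⟩
    · let X : Finset (Fin I.n) :=
        univ.filter fun u : Fin I.n => (u : ℕ) ∈ partners I.n t I.input ∩ R'
      have hX : #X = #(partners I.n t I.input ∩ R') := by
        rw [← card_image_of_injective X Fin.val_injective]
        congr 1
        ext b
        simp only [X, mem_image, mem_filter, mem_univ, true_and]
        exact ⟨by rintro ⟨u, hu, rfl⟩; exact hu,
          fun hb => ⟨⟨b, mem_range.1 (mem_filter.1 (mem_inter.1 hb).1).1⟩, hb, rfl⟩⟩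
      rw [← hX] at hlt
      -- Divisibility turns the strict bound at level `ℓ + 1` into the tight bound at level `ℓ`,
      -- which also excludes fairer flows with fractional amounts.
      obtain ⟨hpos, hle⟩ := innerCap_le_of_lt hfd
        (fun i hi => (hc i hi) ▸ factorial_dvd_scaledCapacity _ hi)
        ((card_le_univ X).trans (Fintype.card_fin _).le) hlt
      refine .inr ⟨R', hRt', X, card_pos.1 hpos, fun u hu => ?_, hle⟩
      have hu := mem_inter.1 (mem_filter.1 hu).2
      exact ⟨(hmem u).1 hu.1, hu.2⟩
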